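/- Consider the discrete NLS equation on a stripe lattice $$ i\,\partial_t u_m+\epsilon(u_{m+1}+u_{m-1}-2u_m)+\kappa\,\partial_y^2u_m+|u_m|^2u_m=0,\qquad m\in\mathbb Z, $$ with $\kappa=-1$, and its fundamental line soliton $u_m(y,t)=e^{it}\psi_m$, where for small $\epsilon>0$ the real sequence $\psi=\psi(\epsilon)\in\ell^2(\mathbb Z)$ is the positive solution of $-\psi_m+\epsilon(\psi_{m+1}+\psi_{m-1}-2\psi_m)+\psi_m^3=0$ with $\psi_m\to\delta_{m,0}$ (in $\ell^2$) as $\epsilon\to0^+$. For a transverse wavenumber $p\in\mathbb R$, let $L_\pm(p)$ be the operators $$ (L_+(p)U)_m=-\epsilon(U_{m+1}+U_{m-1}-2U_m)+(1-p^2)U_m-3\psi_m^2U_m, $$ $$ (L_-(p)W)_m=-\epsilon(W_{m+1}+W_{m-1}-2W_m)+(1-p^2)W_m-\psi_m^2W_m. $$ A number $\lambda\in\mathbb C$ is called an eigenvalue at $p$ if $L_+(p)U=-\lambda W$, $L_-(p)W=\lambda U$ for some $(U,W)\ne0$ in $\ell^2(\mathbb Z,\mathbb C)^2$; for $\lambda\in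 i\mathbb R$ with $\operatorname{Im}\lambda>0$ its Krein signature is the sign of $\langle L_+(p)U,U\rangle$ at its eigenvectors. (0) At $\epsilon=0$ (with $\psi_m=\delta_{m,0}$) and $0<|p|<1$, $|p|\ne\frac12$, the number $i|p|\sqrt{2+p^2}$ is an eigenvalue with one-dimensional eigenspace and negative Krein signature, and $i(1-p^2)$ is an eigenvalue with infinite-dimensional eigenspace and positive Krein signature. For $0<|p|<1$ the two numbers coincide if and only if $|p|=\frac12$, where they equal $\frac{3i}4$. There are $\epsilon_0>0$ and, for $\epsilon\in(0,\epsilon_0)$, numbers $0<p_c^-(\epsilon)<p_c^+(\epsilon)<\infty$ such that: (1) For all $p$ with $|p|\in(p_c^-(\epsilon),p_c^+(\epsilon))$ there is a quartet of eigenvalues $\pm\lambda(\epsilon,p)$, $\pm\bar\lambda(\epsilon,p)$ with $\operatorname{Re}\lambda(\epsilon,p)>0$ and $\operatorname{Im}\lambda(\epsilon,p)>0$. It emanates from the resonance in (0): $|\lambda(\epsilon,p)-\frac{3i}4|\le C\epsilon$, with $C$ independent of $\epsilon$ and $p$. (2) As $\epsilon\to0^+$, $$ p_c^\pm(\epsilon)=\frac12+\frac\epsilon2\Bigl(1\pm\frac{\sqrt{15}}2\Bigr)+O(\epsilon^2).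 $$ (3) With $\delta=\epsilon^{-1}(p^2-\frac14)$, as $\epsilon\to0^+$, $$ \lambda(\epsilon,p)=\frac34i+\frac{i\epsilon}{15}(14+17\delta)+\frac{2\epsilon}{15}\sqrt{15-4(1-2\delta)^2}+O(\epsilon^2), $$ uniformly for $\delta$ in any compact subset of $\{\delta: 4(1-2\delta)^2<15\}$ (such $p$ satisfy $|p|\in(p_c^-(\epsilon),p_c^+(\epsilon))$ for small $\epsilon$). (4) There is $p_{\max}(\epsilon)\in(p_c^-(\epsilon),p_c^+(\epsilon))$ such that, with $\lambda_{\max}(\epsilon)=\lambda(\epsilon,p_{\max}(\epsilon))=\lambda(\epsilon,-p_{\max}(\epsilon))$, every eigenvalue $\nu$ at every $p\in\mathbb R$ satisfies $\operatorname{Re}\nu\le\operatorname{Re}\lambda_{\max}(\epsilon)$, with equality only if $p=\pm p_{\max}(\epsilon)$ and $\nu\in\{\lambda_{\max}(\epsilon),\overline{\lambda_{\max}(\epsilon)}\}$. As $\epsilon\to0^+$, $$ \lambda_{\max}(\epsilon)=\frac34i+\epsilon\Bigl(\frac2{\sqrt{15}}+\frac32i\Bigr)+O(\epsilon^2),\qquad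 p_{\max}(\epsilon)=\frac12+\frac\epsilon2+O(\epsilon^2). $$ -/

import Mathlib

open scoped Topology ComplexConjugate
open Filter Asymptotics

/-- Square-summable complex sequences on `ℤ`. -/
abbrev Ell2 : Type := lp (fun _ : ℤ => ℂ) 2

/-- A family `ε ↦ ψ ε` of real `ℓ²(ℤ)` sequences is the fundamental (single-site) soliton branch
of the stationary one-dimensional discrete NLS equation with `μ = 1` near the anti-continuum
limit: for all small `ε > 0` it is a positive solution of
`ε (ψ_{m+1} + ψ_{m-1} - 2 ψ_m) - ψ_m + ψ_m ^ 3 = 0`, and it converges in `ℓ²` to the sequence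
concentrated at the site `m = 0` (with value `1`) as `ε → 0⁺`. -/
def IsFundamentalLineSoliton (ψ : ℝ → lp (fun _ : ℤ => ℝ) 2) : Prop :=
  (∀ᶠ ε in 𝓝[>] (0 : ℝ),
    (∀ m : ℤ, ε * (ψ ε (m + 1) + ψ ε (m - 1) - 2 * ψ ε m) - ψ ε m + ψ ε m ^ 3 = 0) ∧
    (∀ m : ℤ, 0 < ψ ε m)) ∧
  Tendsto ψ (𝓝[>] (0 : ℝ)) (𝓝 (lp.single 2 (0 : ℤ) (1 : ℝ)))

/-- `(L₊(p) U)_m = -ε (U_{m+1} + U_{m-1} - 2 U_m) + (1 + κ p²) U_m - 3 ψ_m² U_m`. -/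
def Lplus (κ ε p : ℝ) (ψ : ℤ → ℝ) (U : ℤ → ℂ) (m : ℤ) : ℂ :=
  -(ε : ℂ) * (U (m + 1) + U (m - 1) - 2 * U m) + (1 + (κ : ℂ) * (p : ℂ) ^ 2) * U m
    - 3 * (ψ m : ℂ) ^ 2 * U m

/-- `(L₋(p) W)_m = -ε (W_{m+1} + W_{m-1} - 2 W_m) + (1 + κ p²) W_m - ψ_m² W_m`. -/
def Lminus (κ ε p : ℝ) (ψ : ℤ → ℝ) (W : ℤ → ℂ) (m : ℤ) : ℂ :=
  -(ε : ℂ) * (W (m + 1) + W (m - 1) - 2 * W m) + (1 + (κ : ℂ) * (p : ℂ) ^ 2) * W m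
    - (ψ m : ℂ) ^ 2 * W m

/-- The `ℓ²` solutions `(U, W)` of the linear-stability problem
`L₊(p) U = -λ W`, `L₋(p) W = λ U` on the stripe lattice. -/
def stabilityEigenspace (κ ε p : ℝ) (ψ : ℤ → ℝ) (lam : ℂ) : Submodule ℂ (Ell2 × Ell2) where
  carrier := {x | (∀ m, Lplus κ ε p ψ x.1 m = -lam * x.2 m) ∧
    (∀ m, Lminus κ ε p ψ x.2 m = lam * x.1 m)}
  add_mem' := by
    rintro x y ⟨hx, hx'⟩ ⟨hy, hy'⟩
    refine ⟨fun m => ?_, fun m => ?_⟩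
    · have h1 := hx m
      have h2 := hy m
      simp only [Lplus, Prod.fst_add, Prod.snd_add, lp.coeFn_add, Pi.add_apply] at *
      linear_combination h1 + h2
    · have h1 := hx' m
      have h2 := hy' m
      simp only [Lminus, Prod.fst_add, Prod.snd_add, lp.coeFn_add, Pi.add_apply] at *
      linear_combination h1 + h2
  zero_mem' := by
    constructor <;> intro m <;> simp [Lplus, Lminus]
  smul_mem' := by
    rintro c x ⟨hx, hx'⟩
    refine ⟨fun m => ?_, fun m => ?_⟩
    · have h1 := hx m
      simp only [Lplus, Prod.smul_fst, Prod.smul_snd, lp.coeFn_smul, Pi.smul_apply,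
        smul_eq_mul] at *
      linear_combination c * h1
    · have h1 := hx' m
      simp only [Lminus, Prod.smul_fst, Prod.smul_snd, lp.coeFn_smul, Pi.smul_apply,
        smul_eq_mul] at *
      linear_combination c * h1

/-- `lam` is an eigenvalue of the linear-stability problem: it has a nonzero `ℓ²` eigenvector. -/
def IsStabilityEigenvalue (κ ε p : ℝ) (ψ : ℤ → ℝ) (lam : ℂ) : Prop :=
  stabilityEigenspace κ ε p ψ lam ≠ ⊥

/-- The energy `⟨L₊(p) U, U⟩`, whose sign at the eigenvectors `(U, W)` is the Krein signature of
an eigenvalue on the positive imaginary axis. -/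
noncomputable def kreinEnergy (κ ε p : ℝ) (ψ : ℤ → ℝ) (U : Ell2) : ℝ :=
  ∑' m : ℤ, (Lplus κ ε p ψ U m * conj (U m)).re

/-- The single-site profile `δ_{m,0}`, the value of the soliton at `ε = 0`. -/
def singleSite : ℤ → ℝ := Pi.single 0 1

/-- The leading-order formula for the unstable eigenvalue, with `p² = 1/4 + ε δ`. -/
noncomputable def leadingEigenvalue (ε δ : ℝ) : ℂ :=
  3 / 4 * Complex.I + Complex.I * ε / 15 * (14 + 17 * δ)
    + ((2 * ε / 15 * Real.sqrt (15 - 4 * (1 - 2 * δ) ^ 2) : ℝ) : ℂ)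

/-! Write λ = iω, q = 1 - p², X = U + iW, Y = U - iW. The stability problem becomes two scalar
lattice equations, with coefficients q + ω and q - ω, coupled only through ψ_m². Near the resonance
q = ω = 3/4 the first coefficient is about 3/2, while the second is of order ε, so that Y is at the
edge of the continuous spectrum. The substitution p² = 1/4 + εδ, ω = 3/4 + ε(2 - z - 1/z - δ) turns
2ε + q - ω into ε(z + 1/z): away from the centre the leading-order Y is a multiple of z^|m|, with
|z| < 1.

Since ψ² = O(ε²) off the centre, the values of X and Y at the sites m ≠ 0 can be eliminated by
inverting small perturbations of explicit operators. A 2×2 system for (X_0, Y_0) remains. At ε = 0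
its matrix has rows (-1/2, -1) and (-1, -2), and it is singular: this is the resonance. Dividing its
determinant by ε and multiplying by 2z gives a holomorphic function F(z, δ) within O(ε) of 5z² - 4(1
- 2δ)z + 3, whose zeros in an annulus inside the unit disc are the eigenvalues
(`exists_evansFunction`, `SolitonBounds.exists_evansFunction`).

The limiting roots are a non-real conjugate pair exactly when 15 - 4(1 - 2δ)² > 0, and then |z|² =
3/5. As Re λ = ε Im(z + 1/z), the root in the lower half plane is the growing mode. A
maximum-principle argument gives zeros of F (`exists_zero_near_resonance`), and they are not real as
soon as the discriminant exceeds a large multiple of ε. The interval of wavenumbers is therefore the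
asymptotic one shortened by a multiple of ε² at each end.

Maximality needs control of all eigenvalues at all p. Those with Re λ ≥ ε/2, a threshold just below
2ε/√15, are confined to an O(ε) neighbourhood of the resonance
(`SolitonBounds.eigenvalue_localization`). Away from resonance an eigenvector concentrates at the
centre, where L₊ is negative; this forces λ to be real and ⟨U, W⟩ > 0, contradicting the identity
obtained by pairing with ψ, an eigenvector of L₋(p) for -p². Near resonance the growth rate bounds
the central amplitudes from below, and Cramer's rule then makes the central determinant small.

Inside the neighbourhood, a zero growing as fast as the best one must be near z = -i√(3/5), δ = 1/2
(`near_centralRoot_of_growth`). There a Newton iteration gives a branch holomorphic in δ. Cauchy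
estimates bound the second derivative of its deviation from the limiting branch, so the growth rate
remains strictly concave and its maximum is unique (`exists_growth_maximum`). -/

/-! ### Quantitative inversion in Banach algebras. -/

/-- A perturbation of an invertible element of a Banach algebra is invertible, with quantitative
control of the inverse. -/
theorem isUnit_sub_of_norm_mul_le {A : Type*} [NormedRing A] [CompleteSpace A] {T N : A} {K : ℝ}
    (hT : IsUnit T) (hK : ‖Ring.inverse T‖ ≤ K) (hN : K * ‖N‖ ≤ 1 / 2) :
    IsUnit (T - N) ∧ ‖Ring.inverse (T - N)‖ ≤ 2 * K ∧
      ‖Ring.inverse (T - N) - Ring.inverse T‖ ≤ 2 * K * ‖N‖ * K := by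
  have hK0 : 0 ≤ K := (norm_nonneg _).trans hK
  have ht : ‖Ring.inverse T * N‖ ≤ 1 / 2 :=
    (norm_mul_le _ _).trans ((mul_le_mul_of_nonneg_right hK (norm_nonneg _)).trans hN)
  have hu : IsUnit (T - N) := by
    have h1 : IsUnit (1 - Ring.inverse T * N) :=
      ⟨Units.oneSub _ (ht.trans_lt (by norm_num)), rfl⟩
    have h2 : T - N = T * (1 - Ring.inverse T * N) := by
      rw [mul_sub, mul_one, ← mul_assoc, Ring.mul_inverse_cancel _ hT, one_mul]
    rw [h2]
    exact hT.mul h1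
  set y := Ring.inverse (T - N) with hy
  have h3 : y - Ring.inverse T = y * N * Ring.inverse T := by
    have h4 : y * (T - N) = 1 := Ring.inverse_mul_cancel _ hu
    have h5 : T * Ring.inverse T = 1 := Ring.mul_inverse_cancel _ hT
    have h6 : y * T = 1 + y * N := by rw [← h4, mul_sub]; abel
    calc y - Ring.inverse T = y * (T * Ring.inverse T) - Ring.inverse T := by rw [h5, mul_one]
      _ = (y * T) * Ring.inverse T - Ring.inverse T := by rw [mul_assoc]
      _ = y * N * Ring.inverse T := by rw [h6, add_mul, one_mul]; abel
  have h4 : ‖y * N * Ring.inverse T‖ ≤ ‖y‖ * ‖N‖ * K :=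
    (norm_mul_le _ _).trans (mul_le_mul (norm_mul_le _ _) hK (norm_nonneg _) (by positivity))
  have h5 : ‖y‖ ≤ 2 * K := by
    have h6 : ‖y‖ ≤ ‖y - Ring.inverse T‖ + ‖Ring.inverse T‖ := by
      simpa using norm_add_le (y - Ring.inverse T) (Ring.inverse T)
    rw [h3] at h6
    nlinarith [norm_nonneg y, norm_nonneg N, mul_le_mul_of_nonneg_left hN (norm_nonneg y)]
  refine ⟨hu, h5, ?_⟩
  rw [h3]
  refine h4.trans ?_
  gcongr

/-- `1 - t` is invertible for `‖t‖ < 1`, with the geometric bound for the inverse. -/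
theorem isUnit_one_sub_norm_inverse_le {A : Type*} [NormedRing A] [CompleteSpace A]
    (h1 : ‖(1 : A)‖ ≤ 1) {t : A} {r : ℝ} (ht : ‖t‖ ≤ r) (hr : r < 1) :
    IsUnit (1 - t) ∧ ‖Ring.inverse (1 - t)‖ ≤ 1 / (1 - r) := by
  have hu : IsUnit (1 - t) := ⟨Units.oneSub _ (ht.trans_lt hr), rfl⟩
  refine ⟨hu, ?_⟩
  set y := Ring.inverse (1 - t)
  have h2 : y = 1 + y * t := by
    have : y * (1 - t) = 1 := Ring.inverse_mul_cancel _ hu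
    rw [← this, mul_sub, mul_one]; abel
  have h3 : ‖y‖ ≤ 1 + ‖y‖ * r := by
    calc ‖y‖ = ‖1 + y * t‖ := by rw [← h2]
      _ ≤ ‖(1 : A)‖ + ‖y * t‖ := norm_add_le _ _
      _ ≤ 1 + ‖y‖ * r := by
        gcongr
        exact (norm_mul_le _ _).trans (by gcongr)
  rw [le_div_iff₀ (by linarith)]
  linarith

theorem Ring.inverse_unique {A : Type*} [Ring A] {T y : A} (hT : IsUnit T) (h : T * y = 1) :
    Ring.inverse T = y := by
  have h1 : Ring.inverse T * T = 1 := Ring.inverse_mul_cancel _ hT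
  calc Ring.inverse T = Ring.inverse T * (T * y) := by rw [h, mul_one]
    _ = y := by rw [← mul_assoc, h1, one_mul]

/-! ### Coordinates and weighted composition operators on ℓ²(ℤ). -/

/-- Sums over a finite set of the squared coordinates are bounded by the squared norm. -/
theorem Ell2.sum_sq_le (x : Ell2) (s : Finset ℤ) : ∑ m ∈ s, ‖x m‖ ^ 2 ≤ ‖x‖ ^ 2 := by
  have h := lp.sum_rpow_le_norm_rpow (p := 2) (by norm_num) x s
  simpa using h

theorem Ell2.norm_le_of_sum_sq_le {x : Ell2} {C : ℝ} (hC : 0 ≤ C)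
    (h : ∀ s : Finset ℤ, ∑ m ∈ s, ‖x m‖ ^ 2 ≤ C ^ 2) : ‖x‖ ≤ C := by
  refine lp.norm_le_of_forall_sum_le (p := 2) (by norm_num) hC fun s => ?_
  simpa using h s

theorem Ell2.memℓp_of_sum_sq_le {f : ℤ → ℂ} {C : ℝ}
    (h : ∀ s : Finset ℤ, ∑ m ∈ s, ‖f m‖ ^ 2 ≤ C) : Memℓp f 2 := by
  refine memℓp_gen' (C := C) fun s => ?_
  simpa using h s

theorem Ell2.norm_apply_le (x : Ell2) (m : ℤ) : ‖x m‖ ≤ ‖x‖ :=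
  lp.norm_apply_le_norm (by norm_num) x m

/-- Weighted composition operators on `ℓ²(ℤ)`. -/
theorem Ell2.exists_weightedComp (c : ℤ → ℂ) (σ : ℤ → ℤ) {B : ℝ} (hB : 0 ≤ B)
    (hc : ∀ m, ‖c m‖ ≤ B) (hσ : Set.InjOn σ {m | c m ≠ 0}) :
    ∃ T : Ell2 →L[ℂ] Ell2, (∀ x m, T x m = c m * x (σ m)) ∧ ‖T‖ ≤ B := by
  classical
  have key : ∀ (x : Ell2) (s : Finset ℤ), ∑ m ∈ s, ‖c m * x (σ m)‖ ^ 2 ≤ (B * ‖x‖) ^ 2 := by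
    intro x s
    have h1 : ∑ m ∈ s, ‖c m * x (σ m)‖ ^ 2 = ∑ m ∈ s.filter (fun m => c m ≠ 0),
        ‖c m * x (σ m)‖ ^ 2 := by
      rw [Finset.sum_filter]
      refine Finset.sum_congr rfl fun m _ => ?_
      by_cases h : c m = 0 <;> simp [h]
    rw [h1]
    calc ∑ m ∈ s.filter (fun m => c m ≠ 0), ‖c m * x (σ m)‖ ^ 2
        ≤ ∑ m ∈ s.filter (fun m => c m ≠ 0), B ^ 2 * ‖x (σ m)‖ ^ 2 := by
          refine Finset.sum_le_sum fun m _ => ?_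
          rw [norm_mul, mul_pow]
          gcongr
          exact hc m
      _ = B ^ 2 * ∑ k ∈ (s.filter (fun m => c m ≠ 0)).image σ, ‖x k‖ ^ 2 := by
          rw [← Finset.mul_sum, Finset.sum_image]
          intro i hi j hj hij
          exact hσ (by simpa using (Finset.mem_filter.1 hi).2)
            (by simpa using (Finset.mem_filter.1 hj).2) hij
      _ ≤ (B * ‖x‖) ^ 2 := by
          rw [mul_pow]
          gcongr
          exact Ell2.sum_sq_le x _
  let L : Ell2 →ₗ[ℂ] Ell2 :=
    { toFun := fun x => ⟨fun m => c m * x (σ m), Ell2.memℓp_of_sum_sq_le (key x)⟩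
      map_add' := fun x y => by
        apply lp.ext
        funext m
        change c m * (x + y) (σ m) = c m * x (σ m) + c m * y (σ m)
        rw [lp.coeFn_add, Pi.add_apply, mul_add]
      map_smul' := fun k x => by
        apply lp.ext
        funext m
        change c m * (k • x) (σ m) = k * (c m * x (σ m))
        rw [lp.coeFn_smul, Pi.smul_apply, smul_eq_mul]
        ring }
  refine ⟨L.mkContinuous B fun x => ?_, fun x m => rfl, L.mkContinuous_norm_le hB _⟩
  exact Ell2.norm_le_of_sum_sq_le (by positivity) (key x)

/-! ### Operators off the centre and their inverses. -/

/-- The limiting characteristic polynomial of the resonance. -/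
noncomputable def resonancePoly (x : ℂ × ℂ) : ℂ := 5 * x.1 ^ 2 - 4 * (1 - 2 * x.2) * x.1 + 3

/-- The domain of the spectral parameters `(z, δ)`. -/
def evansDomain : Set (ℂ × ℂ) := {x | 1 / 100 < ‖x.1‖ ∧ ‖x.1‖ < 99 / 100 ∧ ‖x.2‖ < 100}

theorem isOpen_evansDomain : IsOpen evansDomain := by
  refine (isOpen_lt continuous_const continuous_fst.norm).inter
    ((isOpen_lt continuous_fst.norm continuous_const).inter
      (isOpen_lt continuous_snd.norm continuous_const))

section Evans

variable {H : Type*} [NormedAddCommGroup H] [NormedSpace ℂ H] [CompleteSpace H]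

/-- The coefficient `4 - z - z⁻¹ - 2 δ`. -/
noncomputable def evansCoeff (x : ℂ × ℂ) : ℂ := 4 - x.1 - x.1⁻¹ - 2 * x.2

/-- The operator of the nonresonant component outside the central site. -/
noncomputable def nonresonantOp (ε : ℝ) (R Rs b : H →L[ℂ] H) (x : ℂ × ℂ) : H →L[ℂ] H :=
  (3 / 2 + ε * evansCoeff x) • 1 - (ε : ℂ) • (R + Rs) - (2 * (ε : ℂ) ^ 2) • b

/-- The unperturbed operator of the resonant component outside the central site. -/
noncomputable def resonantOp₀ (R Rs : H →L[ℂ] H) (x : ℂ × ℂ) : H →L[ℂ] H :=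
  (1 - x.1 • Rs) * (1 - x.1 • R)

/-- The operator of the resonant component after elimination of the nonresonant one. -/
noncomputable def resonantOp (ε : ℝ) (R Rs b : H →L[ℂ] H) (x : ℂ × ℂ) : H →L[ℂ] H :=
  resonantOp₀ R Rs x - ((ε : ℂ) * x.1) •
    (b * ((2 : ℂ) • 1 + ((ε : ℂ) ^ 2) • (Ring.inverse (nonresonantOp ε R Rs b x) * b)))

omit [CompleteSpace H] in
theorem ContinuousLinearMap.norm_one_le' : ‖(1 : H →L[ℂ] H)‖ ≤ 1 := ContinuousLinearMap.norm_id_le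

variable {ε : ℝ} {R Rs b : H →L[ℂ] H} {x : ℂ × ℂ}

theorem norm_evansCoeff_le (hx : x ∈ evansDomain) : ‖evansCoeff x‖ ≤ 305 := by
  obtain ⟨h1, h2, h3⟩ := hx
  have h4 : ‖x.1⁻¹‖ ≤ 100 := by
    rw [norm_inv, inv_le_comm₀ (by linarith) (by norm_num)]
    linarith
  have h5 : ‖2 * x.2‖ ≤ 200 := by rw [norm_mul, Complex.norm_ofNat]; linarith
  have h6 : ‖(4 : ℂ)‖ = 4 := Complex.norm_ofNat 4
  unfold evansCoeff
  linarith [norm_sub_le (4 - x.1 - x.1⁻¹) (2 * x.2), norm_sub_le (4 - x.1) x.1⁻¹,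
    norm_sub_le 4 x.1]

/-- The operator is 3/2 plus terms of total size at most 310ε, so a Neumann series around the scalar
3/2 suffices. -/
theorem nonresonantOp_spec (hε : 0 < ε) (hε' : ε ≤ 1 / 10 ^ 12) (hR : ‖R‖ ≤ 1) (hRs : ‖Rs‖ ≤ 1)
    (hb : ‖b‖ ≤ 9) (hx : x ∈ evansDomain) :
    IsUnit (nonresonantOp ε R Rs b x) ∧ ‖Ring.inverse (nonresonantOp ε R Rs b x)‖ ≤ 2 := by
  have hT : IsUnit ((3 / 2 : ℂ) • (1 : H →L[ℂ] H)) :=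
    ⟨⟨(3 / 2 : ℂ) • 1, (2 / 3 : ℂ) • 1, by simp [smul_smul], by simp [smul_smul]⟩, rfl⟩
  have hTi : Ring.inverse ((3 / 2 : ℂ) • (1 : H →L[ℂ] H)) = (2 / 3 : ℂ) • 1 :=
    Ring.inverse_unique hT (by simp [smul_smul])
  have hK : ‖Ring.inverse ((3 / 2 : ℂ) • (1 : H →L[ℂ] H))‖ ≤ 1 := by
    rw [hTi, norm_smul]
    have : ‖(2 / 3 : ℂ)‖ = 2 / 3 := by simp
    rw [this]
    linarith [ContinuousLinearMap.norm_one_le' (H := H)]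
  have hN : ‖-((ε * evansCoeff x) • (1 : H →L[ℂ] H)) + (ε : ℂ) • (R + Rs)
      + (2 * (ε : ℂ) ^ 2) • b‖ ≤ 310 * ε := by
    have h1 : ‖(ε * evansCoeff x) • (1 : H →L[ℂ] H)‖ ≤ ε * 305 * 1 := by
      rw [norm_smul, norm_mul, Complex.norm_of_nonneg hε.le]
      gcongr
      · exact norm_evansCoeff_le hx
      · exact ContinuousLinearMap.norm_one_le'
    have h2 : ‖(ε : ℂ) • (R + Rs)‖ ≤ ε * 2 := by
      rw [norm_smul, Complex.norm_of_nonneg hε.le]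
      gcongr
      linarith [norm_add_le R Rs]
    have h3 : ‖(2 * (ε : ℂ) ^ 2) • b‖ ≤ 2 * ε ^ 2 * 9 := by
      rw [norm_smul, norm_mul, norm_pow, Complex.norm_of_nonneg hε.le, Complex.norm_ofNat]
      gcongr
    have h4 := norm_add_le (-((ε * evansCoeff x) • (1 : H →L[ℂ] H)) + (ε : ℂ) • (R + Rs))
      ((2 * (ε : ℂ) ^ 2) • b)
    have h5 := norm_add_le (-((ε * evansCoeff x) • (1 : H →L[ℂ] H))) ((ε : ℂ) • (R + Rs))
    rw [norm_neg] at h5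
    nlinarith
  have h := isUnit_sub_of_norm_mul_le hT hK
    (N := -((ε * evansCoeff x) • (1 : H →L[ℂ] H)) + (ε : ℂ) • (R + Rs)
      + (2 * (ε : ℂ) ^ 2) • b) (by linarith)
  have e : nonresonantOp ε R Rs b x = (3 / 2 : ℂ) • (1 : H →L[ℂ] H) -
      (-((ε * evansCoeff x) • (1 : H →L[ℂ] H)) + (ε : ℂ) • (R + Rs) + (2 * (ε : ℂ) ^ 2) • b) := by
    unfold nonresonantOp
    rw [add_smul]
    abel
  rw [e]
  exact ⟨h.1, by linarith [h.2.1]⟩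

/-- Each factor is inverted by a geometric series, which is where |z| < 99/100 enters: on |z| = 1
the parameter meets the continuous spectrum and uniform inversion is lost. -/
theorem resonantOp₀_spec (hR : ‖R‖ ≤ 1) (hRs : ‖Rs‖ ≤ 1) (hx : x ∈ evansDomain) :
    IsUnit (resonantOp₀ R Rs x) ∧ ‖Ring.inverse (resonantOp₀ R Rs x)‖ ≤ 10 ^ 4 := by
  have key : ∀ S : H →L[ℂ] H, ‖S‖ ≤ 1 →
      IsUnit (1 - x.1 • S) ∧ ‖Ring.inverse (1 - x.1 • S)‖ ≤ 100 := by
    intro S hS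
    have h := isUnit_one_sub_norm_inverse_le (t := x.1 • S) (r := 99 / 100)
      (ContinuousLinearMap.norm_one_le' (H := H))
      (by rw [norm_smul]; nlinarith [hx.2.1, norm_nonneg x.1, norm_nonneg S]) (by norm_num)
    exact ⟨h.1, by linarith [h.2]⟩
  obtain ⟨u1, n1⟩ := key R hR
  obtain ⟨u2, n2⟩ := key Rs hRs
  have hu : IsUnit (resonantOp₀ R Rs x) := u2.mul u1
  refine ⟨hu, ?_⟩
  rw [Ring.inverse_unique hu (y := Ring.inverse (1 - x.1 • R) * Ring.inverse (1 - x.1 • Rs))]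
  · refine (norm_mul_le _ _).trans ?_
    nlinarith [norm_nonneg (Ring.inverse (1 - x.1 • R)), norm_nonneg (Ring.inverse (1 - x.1 • Rs))]
  · unfold resonantOp₀
    rw [mul_assoc, ← mul_assoc (1 - x.1 • R), Ring.mul_inverse_cancel _ u1, one_mul,
      Ring.mul_inverse_cancel _ u2]

/-- Eliminating X from the resonant equation adds only O(ε) to the explicit product, here at most
19ε. Closeness to the unperturbed inverse is what identifies the limit of the characteristic
function. -/
theorem resonantOp_spec (hε : 0 < ε) (hε' : ε ≤ 1 / 10 ^ 12) (hR : ‖R‖ ≤ 1) (hRs : ‖Rs‖ ≤ 1)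
    (hb : ‖b‖ ≤ 9) (hx : x ∈ evansDomain) :
    IsUnit (resonantOp ε R Rs b x) ∧ ‖Ring.inverse (resonantOp ε R Rs b x)‖ ≤ 2 * 10 ^ 4 ∧
      ‖Ring.inverse (resonantOp ε R Rs b x) - Ring.inverse (resonantOp₀ R Rs x)‖
        ≤ 4 * 10 ^ 9 * ε := by
  obtain ⟨u0, n0⟩ := resonantOp₀_spec hR hRs hx
  obtain ⟨u1, n1⟩ := nonresonantOp_spec hε hε' hR hRs hb hx
  have hN : ‖((ε : ℂ) * x.1) •
    (b * ((2 : ℂ) • 1 + ((ε : ℂ) ^ 2) • (Ring.inverse (nonresonantOp ε R Rs b x) * b)))‖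
      ≤ 19 * ε := by
    set V := Ring.inverse (nonresonantOp ε R Rs b x)
    have h1 : ‖V * b‖ ≤ 18 := (norm_mul_le _ _).trans (by nlinarith [norm_nonneg V, norm_nonneg b])
    have h2 : ‖((ε : ℂ) ^ 2) • (V * b)‖ ≤ ε ^ 2 * 18 := by
      rw [norm_smul, norm_pow, Complex.norm_of_nonneg hε.le]
      gcongr
    have h3 : ‖(2 : ℂ) • (1 : H →L[ℂ] H)‖ ≤ 2 := by
      rw [norm_smul, Complex.norm_ofNat]
      linarith [ContinuousLinearMap.norm_one_le' (H := H)]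
    have h4 : ‖(2 : ℂ) • (1 : H →L[ℂ] H) + ((ε : ℂ) ^ 2) • (V * b)‖ ≤ 2 + 1 / 9 := by
      refine (norm_add_le _ _).trans ?_
      nlinarith
    rw [norm_smul, norm_mul, Complex.norm_of_nonneg hε.le]
    have h5 : ‖b * ((2 : ℂ) • (1 : H →L[ℂ] H) + ((ε : ℂ) ^ 2) • (V * b))‖ ≤ 9 * (2 + 1 / 9) :=
      (norm_mul_le _ _).trans (by gcongr)
    have h6 : ‖x.1‖ ≤ 1 := by linarith [hx.2.1]
    calc _ ≤ ε * 1 * (9 * (2 + 1 / 9)) := by gcongr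
      _ = 19 * ε := by ring
  obtain ⟨a1, a2, a3⟩ := isUnit_sub_of_norm_mul_le u0 n0 (N := ((ε : ℂ) * x.1) •
    (b * ((2 : ℂ) • 1 + ((ε : ℂ) ^ 2) • (Ring.inverse (nonresonantOp ε R Rs b x) * b))))
    (by nlinarith)
  exact ⟨a1, a2, a3.trans (by nlinarith)⟩

theorem differentiableAt_evansCoeff (hx : x ∈ evansDomain) :
    DifferentiableAt ℂ evansCoeff x := by
  have h0 : x.1 ≠ 0 := by
    rw [← norm_pos_iff]; linarith [hx.1]
  have h1 : DifferentiableAt ℂ (fun y : ℂ × ℂ => y.1⁻¹) x := differentiableAt_fst.inv h0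
  unfold evansCoeff
  exact ((differentiableAt_fst.const_sub _).sub h1).sub (differentiableAt_snd.const_mul _)

theorem differentiableAt_inverse_nonresonantOp (hε : 0 < ε) (hε' : ε ≤ 1 / 10 ^ 12)
    (hR : ‖R‖ ≤ 1) (hRs : ‖Rs‖ ≤ 1) (hb : ‖b‖ ≤ 9) (hx : x ∈ evansDomain) :
    DifferentiableAt ℂ (fun y => Ring.inverse (nonresonantOp ε R Rs b y)) x := by
  refine DifferentiableAt.inverse ?_ (nonresonantOp_spec hε hε' hR hRs hb hx).1
  unfold nonresonantOp
  have := differentiableAt_evansCoeff hx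
  fun_prop

theorem differentiableAt_inverse_resonantOp (hε : 0 < ε) (hε' : ε ≤ 1 / 10 ^ 12)
    (hR : ‖R‖ ≤ 1) (hRs : ‖Rs‖ ≤ 1) (hb : ‖b‖ ≤ 9) (hx : x ∈ evansDomain) :
    DifferentiableAt ℂ (fun y => Ring.inverse (resonantOp ε R Rs b y)) x := by
  refine DifferentiableAt.inverse ?_ (resonantOp_spec hε hε' hR hRs hb hx).1
  unfold resonantOp resonantOp₀
  have := differentiableAt_inverse_nonresonantOp hε hε' hR hRs hb hx
  fun_prop

end Evans

/-! ### Reduction to a 2×2 determinant at the central site. -/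

section Evans

variable {H : Type*} [NormedAddCommGroup H] [NormedSpace ℂ H] [CompleteSpace H]

/-- The eigenvalue problem near the resonance, split into the central site `(X₀, Y₀)` and the
remaining sites `(X, Y)`. -/
structure IsReducedSolution (ε : ℝ) (R Rs b : H →L[ℂ] H) (e : H) (l : H →L[ℂ] ℂ) (a₀ : ℂ)
    (x : ℂ × ℂ) (X₀ Y₀ : ℂ) (X Y : H) : Prop where
  nonresonant : nonresonantOp ε R Rs b x X = ((ε : ℂ) ^ 2) • b Y + (ε * X₀) • e
  resonant : resonantOp₀ R Rs x Y - (ε * x.1) • b (X + (2 : ℂ) • Y) = (x.1 * Y₀) • e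
  site_nonresonant : (3 / 2 + ε * evansCoeff x - 2 * a₀) * X₀ - a₀ * Y₀ = ε * l X
  site_resonant : (ε * (x.1 + x.1⁻¹) - 2 * a₀) * Y₀ - a₀ * X₀ = ε * l Y

variable {ε : ℝ} {R Rs b : H →L[ℂ] H} {x : ℂ × ℂ} {e : H} {l : H →L[ℂ] ℂ}

omit [CompleteSpace H] in
theorem norm_functional_apply_le (hl : ‖l‖ ≤ 2) (he : ‖e‖ ≤ 2) {T : H →L[ℂ] H} {C : ℝ}
    (hT : ‖T‖ ≤ C) : ‖l (T e)‖ ≤ 4 * C := by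
  have hC : 0 ≤ C := (norm_nonneg _).trans hT
  calc ‖l (T e)‖ ≤ ‖l‖ * ‖T e‖ := l.le_opNorm _
    _ ≤ 2 * (C * 2) := by
      gcongr
      exact (T.le_opNorm e).trans (by gcongr)
    _ = 4 * C := by ring

/-- Since `Rs e = 0`, the outer factor fixes `e`, so the solution is v = (1 - zR)⁻¹e, that is v = e
+ zRv. The functional annihilates the range of `R`, which leaves `l e`. -/
theorem functional_inverse_resonantOp₀ (hR : ‖R‖ ≤ 1) (hRs : ‖Rs‖ ≤ 1)
    (hlR : ∀ y, l (R y) = 0) (hRe : Rs e = 0) (hle : l e = 2) (hx : x ∈ evansDomain) :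
    l (Ring.inverse (resonantOp₀ R Rs x) e) = 2 := by
  obtain ⟨u0, -⟩ := resonantOp₀_spec hR hRs hx
  have hu : IsUnit (1 - x.1 • R) := by
    have h := isUnit_one_sub_norm_inverse_le (t := x.1 • R) (r := 99 / 100)
      (ContinuousLinearMap.norm_one_le' (H := H))
      (by rw [norm_smul]; nlinarith [hx.2.1, norm_nonneg x.1, norm_nonneg R]) (by norm_num)
    exact h.1
  set v := Ring.inverse (1 - x.1 • R) e with hv
  have h1 : (1 - x.1 • R) v = e := by
    rw [hv, ← mul_apply_eq_comp, Ring.mul_inverse_cancel _ hu,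
      one_apply_eq_self]
  have h2 : resonantOp₀ R Rs x v = e := by
    unfold resonantOp₀
    rw [mul_apply_eq_comp, h1]
    simp [hRe]
  have h3 : Ring.inverse (resonantOp₀ R Rs x) e = v := by
    conv_lhs => rw [← h2]
    rw [← mul_apply_eq_comp, Ring.inverse_mul_cancel _ u0,
      one_apply_eq_self]
  rw [h3, ← hle, ← h1]
  simp [hlR]

-- A Schur complement: X and Y are expressed linearly through the two central values, and
-- solvability of the central equations becomes the vanishing of a determinant. Holomorphy is
-- inherited from that of operator inverses.
set_option maxHeartbeats 1000000 in
theorem exists_evansFunction (hε : 0 < ε) (hε' : ε ≤ 1 / 10 ^ 12) (hR : ‖R‖ ≤ 1) (hRs : ‖Rs‖ ≤ 1)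
    (hb : ‖b‖ ≤ 9) (hl : ‖l‖ ≤ 2) (he : ‖e‖ ≤ 2) (hlR : ∀ y, l (R y) = 0) (hRe : Rs e = 0)
    (hle : l e = 2) {a₀ b₀ : ℂ} (hb₀ : ‖b₀‖ ≤ 10) (ha₀ : a₀ = 1 + 2 * ε + ε ^ 2 * b₀) :
    ∃ F : ℂ × ℂ → ℂ, DifferentiableOn ℂ F evansDomain ∧
      (∀ x ∈ evansDomain, ‖F x - resonancePoly x‖ ≤ 10 ^ 11 * ε) ∧
      ∀ x ∈ evansDomain, F x = 0 ↔ ∃ X₀ Y₀ X Y, (X₀ ≠ 0 ∨ Y₀ ≠ 0) ∧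
        IsReducedSolution ε R Rs b e l a₀ x X₀ Y₀ X Y := by
  set V : ℂ × ℂ → (H →L[ℂ] H) := fun x => Ring.inverse (nonresonantOp ε R Rs b x) with hV
  set W : ℂ × ℂ → (H →L[ℂ] H) := fun x => Ring.inverse (resonantOp ε R Rs b x) with hW
  -- Responses of the neighbours to the centre: l X = m₁₁X₀ + m₁₂Y₀ and l Y = m₂₁X₀ + m₂₂Y₀.
  set m₁₁ : ℂ × ℂ → ℂ := fun x =>
    ε * l (V x e) + ε ^ 4 * x.1 * l ((V x * b * W x * b * V x) e) with hm₁₁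
  set m₁₂ : ℂ × ℂ → ℂ := fun x => ε ^ 2 * x.1 * l ((V x * b * W x) e) with hm₁₂
  set m₂₁ : ℂ × ℂ → ℂ := fun x => ε ^ 2 * x.1 * l ((W x * b * V x) e) with hm₂₁
  set m₂₂ : ℂ × ℂ → ℂ := fun x => x.1 * l (W x e) with hm₂₂
  -- The central matrix has rows (-1/2 + εA₁, -(1 + εA₃)) and (-(1 + εA₄), -2 + εA₂).
  set A₁ : ℂ × ℂ → ℂ := fun x => evansCoeff x - 4 - 2 * ε * b₀ - m₁₁ x with hA₁
  set A₂ : ℂ × ℂ → ℂ := fun x => x.1 + x.1⁻¹ - 4 - 2 * ε * b₀ - m₂₂ x with hA₂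
  set A₃ : ℂ × ℂ → ℂ := fun x => 2 + ε * b₀ + m₁₂ x with hA₃
  set A₄ : ℂ × ℂ → ℂ := fun x => 2 + ε * b₀ + m₂₁ x with hA₄
  -- The order-zero part (-1/2)(-2) - 1 of the determinant vanishes, so it can be divided by ε; the
  -- factor 2z clears the denominators of the limit.
  refine ⟨fun x => 2 * x.1 * (-A₂ x / 2 - 2 * A₁ x - A₃ x - A₄ x
    + ε * (A₁ x * A₂ x - A₃ x * A₄ x)), ?_, ?_, ?_⟩
  · intro x hx
    refine DifferentiableAt.differentiableWithinAt ?_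
    have h0 : x.1 ≠ 0 := by
      rw [← norm_pos_iff]; linarith [hx.1]
    have d1 : DifferentiableAt ℂ V x :=
      differentiableAt_inverse_nonresonantOp hε hε' hR hRs hb hx
    have d2 : DifferentiableAt ℂ W x :=
      differentiableAt_inverse_resonantOp hε hε' hR hRs hb hx
    have d3 := differentiableAt_evansCoeff hx
    have d4 : DifferentiableAt ℂ (fun y : ℂ × ℂ => y.1⁻¹) x := differentiableAt_fst.inv h0
    simp only [hA₁, hA₂, hA₃, hA₄, hm₁₁, hm₁₂, hm₂₁, hm₂₂]
    fun_prop
  · intro x hx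
    obtain ⟨u1, n1⟩ := nonresonantOp_spec hε hε' hR hRs hb hx
    obtain ⟨u2, n2, n3⟩ := resonantOp_spec hε hε' hR hRs hb hx
    change ‖V x‖ ≤ 2 at n1
    change ‖W x‖ ≤ 2 * 10 ^ 4 at n2
    change ‖W x - _‖ ≤ _ at n3
    have hz1 : ‖x.1‖ ≤ 1 := by linarith [hx.2.1]
    have h0 : x.1 ≠ 0 := by
      rw [← norm_pos_iff]; linarith [hx.1]
    have hz2 : ‖x.1⁻¹‖ ≤ 100 := by
      rw [norm_inv, inv_le_comm₀ (by linarith [hx.1]) (by norm_num)]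
      linarith [hx.1]
    have hε1 : ‖(ε : ℂ)‖ = ε := Complex.norm_of_nonneg hε.le
    have p1 : ‖V x * b‖ ≤ 18 := (norm_mul_le _ _).trans (by nlinarith [norm_nonneg (V x), norm_nonneg b])
    have p2 : ‖V x * b * W x‖ ≤ 18 * (2 * 10 ^ 4) := (norm_mul_le _ _).trans (by gcongr)
    have p3 : ‖V x * b * W x * b‖ ≤ 18 * (2 * 10 ^ 4) * 9 := (norm_mul_le _ _).trans (by gcongr)
    have p4 : ‖V x * b * W x * b * V x‖ ≤ 18 * (2 * 10 ^ 4) * 9 * 2 :=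
      (norm_mul_le _ _).trans (by gcongr)
    have p5 : ‖W x * b‖ ≤ 2 * 10 ^ 4 * 9 := (norm_mul_le _ _).trans (by gcongr)
    have p6 : ‖W x * b * V x‖ ≤ 2 * 10 ^ 4 * 9 * 2 := (norm_mul_le _ _).trans (by gcongr)
    have q1 := norm_functional_apply_le hl he n1
    have q2 := norm_functional_apply_le hl he p4
    have q3 := norm_functional_apply_le hl he p2
    have q4 := norm_functional_apply_le hl he p6
    have q5 := norm_functional_apply_le hl he n3
    have hε2 : ε ^ 2 ≤ ε * (1 / 10 ^ 12) := by nlinarith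
    have b12 : ‖m₁₂ x‖ ≤ ε := by
      simp only [hm₁₂, norm_mul, norm_pow, hε1]
      calc _ ≤ (ε * (1 / 10 ^ 12)) * 1 * (4 * (18 * (2 * 10 ^ 4))) := by gcongr
        _ ≤ ε := by nlinarith
    have b21 : ‖m₂₁ x‖ ≤ ε := by
      simp only [hm₂₁, norm_mul, norm_pow, hε1]
      calc _ ≤ (ε * (1 / 10 ^ 12)) * 1 * (4 * (2 * 10 ^ 4 * 9 * 2)) := by gcongr
        _ ≤ ε := by nlinarith
    have b11 : ‖m₁₁ x‖ ≤ 9 * ε := by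
      have e1 : ‖(ε : ℂ) * l (V x e)‖ ≤ ε * (4 * 2) := by
        rw [norm_mul, hε1]; gcongr
      have e2 : ‖(ε : ℂ) ^ 4 * x.1 * l ((V x * b * W x * b * V x) e)‖ ≤ ε := by
        rw [norm_mul, norm_mul, norm_pow, hε1]
        have : ε ^ 4 ≤ ε * (1 / 10 ^ 12) := by
          have : ε ^ 4 ≤ ε ^ 2 := pow_le_pow_of_le_one hε.le (by linarith) (by norm_num)
          linarith
        calc _ ≤ (ε * (1 / 10 ^ 12)) * 1 * (4 * (18 * (2 * 10 ^ 4) * 9 * 2)) := by gcongr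
          _ ≤ ε := by nlinarith
      refine (norm_add_le _ _).trans ?_
      linarith
    have b22 : ‖m₂₂ x - 2 * x.1‖ ≤ 16 * 10 ^ 9 * ε := by
      have e1 : m₂₂ x - 2 * x.1 = x.1 * l ((W x - Ring.inverse (resonantOp₀ R Rs x)) e) := by
        rw [sub_apply, map_sub,
          functional_inverse_resonantOp₀ hR hRs hlR hRe hle hx]
        simp only [hm₂₂]
        ring
      rw [e1, norm_mul]
      calc _ ≤ 1 * (4 * (4 * 10 ^ 9 * ε)) := by gcongr
        _ = _ := by ring
    have hb' : ‖(ε : ℂ) * b₀‖ ≤ ε * 10 := by rw [norm_mul, hε1]; gcongr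
    set t := (ε : ℂ) * b₀ with ht
    have c4 : ‖A₄ x - 2‖ ≤ 11 * ε := by
      have : A₄ x - 2 = t + m₂₁ x := by simp only [hA₄, ht]; ring
      rw [this]
      linarith [norm_add_le t (m₂₁ x)]
    have c3 : ‖A₃ x - 2‖ ≤ 11 * ε := by
      have : A₃ x - 2 = t + m₁₂ x := by simp only [hA₃, ht]; ring
      rw [this]
      linarith [norm_add_le t (m₁₂ x)]
    have c1 : ‖A₁ x - (evansCoeff x - 4)‖ ≤ 29 * ε := by
      have : A₁ x - (evansCoeff x - 4) = -(t + t + m₁₁ x) := by simp only [hA₁, ht]; ring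
      rw [this, norm_neg]
      linarith [norm_add_le (t + t) (m₁₁ x), norm_add_le t t]
    have c2 : ‖A₂ x - (x.1⁻¹ - x.1 - 4)‖ ≤ 17 * 10 ^ 9 * ε := by
      have : A₂ x - (x.1⁻¹ - x.1 - 4) = -(t + t + (m₂₂ x - 2 * x.1)) := by
        simp only [hA₂, ht]; ring
      rw [this, norm_neg]
      linarith [norm_add_le (t + t) (m₂₂ x - 2 * x.1), norm_add_le t t]
    have n4 : ‖(4 : ℂ)‖ = 4 := Complex.norm_ofNat 4
    have n2' : ‖(2 : ℂ)‖ = 2 := Complex.norm_ofNat 2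
    have d1 : ‖A₁ x‖ ≤ 310 := by
      have := norm_add_le (A₁ x - (evansCoeff x - 4)) (evansCoeff x - 4)
      rw [sub_add_cancel] at this
      linarith [norm_sub_le (evansCoeff x) 4, norm_evansCoeff_le hx]
    have d2 : ‖A₂ x‖ ≤ 106 := by
      have := norm_add_le (A₂ x - (x.1⁻¹ - x.1 - 4)) (x.1⁻¹ - x.1 - 4)
      rw [sub_add_cancel] at this
      linarith [norm_sub_le (x.1⁻¹ - x.1) 4, norm_sub_le (x.1⁻¹) x.1]
    have d3 : ‖A₃ x‖ ≤ 3 := by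
      have := norm_add_le (A₃ x - 2) 2
      rw [sub_add_cancel] at this
      linarith
    have d4 : ‖A₄ x‖ ≤ 3 := by
      have := norm_add_le (A₄ x - 2) 2
      rw [sub_add_cancel] at this
      linarith
    have d5 : ‖(ε : ℂ) * (A₁ x * A₂ x - A₃ x * A₄ x)‖ ≤ ε * (310 * 106 + 3 * 3) := by
      rw [norm_mul, hε1]
      gcongr
      refine (norm_sub_le _ _).trans ?_
      rw [norm_mul, norm_mul]
      gcongr
    -- The limits are A₁ → -z - z⁻¹ - 2δ, A₂ → z⁻¹ - z - 4 and A₃, A₄ → 2; they reproduce the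
    -- polynomial exactly, and only the deviations from them and the term with factor ε remain.
    have key : 2 * x.1 * (-A₂ x / 2 - 2 * A₁ x - A₃ x - A₄ x
        + ε * (A₁ x * A₂ x - A₃ x * A₄ x)) - resonancePoly x =
        2 * x.1 * (-((A₂ x - (x.1⁻¹ - x.1 - 4)) / 2 + 2 * (A₁ x - (evansCoeff x - 4)) +
          (A₃ x - 2) + (A₄ x - 2)) + ε * (A₁ x * A₂ x - A₃ x * A₄ x)) := by
      unfold resonancePoly evansCoeff
      field_simp
      ring
    rw [key, norm_mul, norm_mul, n2']
    have k1 : ‖(A₂ x - (x.1⁻¹ - x.1 - 4)) / 2‖ ≤ 17 * 10 ^ 9 * ε / 2 := by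
      rw [norm_div, n2']; gcongr
    have k2 : ‖2 * (A₁ x - (evansCoeff x - 4))‖ ≤ 2 * (29 * ε) := by
      rw [norm_mul, n2']; gcongr
    have k3 := norm_add_le (-((A₂ x - (x.1⁻¹ - x.1 - 4)) / 2 + 2 * (A₁ x - (evansCoeff x - 4)) +
          (A₃ x - 2) + (A₄ x - 2))) (ε * (A₁ x * A₂ x - A₃ x * A₄ x))
    rw [norm_neg] at k3
    have k4 := norm_add_le ((A₂ x - (x.1⁻¹ - x.1 - 4)) / 2 + 2 * (A₁ x - (evansCoeff x - 4)) +
          (A₃ x - 2)) (A₄ x - 2)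
    have k5 := norm_add_le ((A₂ x - (x.1⁻¹ - x.1 - 4)) / 2 + 2 * (A₁ x - (evansCoeff x - 4)))
          (A₃ x - 2)
    have k6 := norm_add_le ((A₂ x - (x.1⁻¹ - x.1 - 4)) / 2) (2 * (A₁ x - (evansCoeff x - 4)))
    calc _ ≤ 2 * 1 * (10 ^ 10 * ε) := by
          gcongr
          linarith
      _ ≤ _ := by nlinarith
  · intro x hx
    obtain ⟨u1, -⟩ := nonresonantOp_spec hε hε' hR hRs hb hx
    obtain ⟨u2, -⟩ := resonantOp_spec hε hε' hR hRs hb hx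
    have h0 : x.1 ≠ 0 := by
      rw [← norm_pos_iff]; linarith [hx.1]
    have hε0 : (ε : ℂ) ≠ 0 := by exact_mod_cast hε.ne'
    have V1 : ∀ y, nonresonantOp ε R Rs b x (V x y) = y := fun y => by
      rw [← mul_apply_eq_comp, Ring.mul_inverse_cancel _ u1,
        one_apply_eq_self]
    have V2 : ∀ y, V x (nonresonantOp ε R Rs b x y) = y := fun y => by
      rw [← mul_apply_eq_comp, Ring.inverse_mul_cancel _ u1,
        one_apply_eq_self]
    have W1 : ∀ y, resonantOp ε R Rs b x (W x y) = y := fun y => by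
      rw [← mul_apply_eq_comp, Ring.mul_inverse_cancel _ u2,
        one_apply_eq_self]
    have W2 : ∀ y, W x (resonantOp ε R Rs b x y) = y := fun y => by
      rw [← mul_apply_eq_comp, Ring.inverse_mul_cancel _ u2,
        one_apply_eq_self]
    have hB2 : ∀ y, resonantOp ε R Rs b x y = resonantOp₀ R Rs x y
        - (ε * x.1) • b ((2 : ℂ) • y + (ε : ℂ) ^ 2 • V x (b y)) := fun y => by
      simp [resonantOp, hV]
    -- the solution outside the central site
    have hsol : ∀ X₀ Y₀ : ℂ, ∀ X Y : H,
        (nonresonantOp ε R Rs b x X = ((ε : ℂ) ^ 2) • b Y + (ε * X₀) • e ∧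
          resonantOp₀ R Rs x Y - (ε * x.1) • b (X + (2 : ℂ) • Y) = (x.1 * Y₀) • e) ↔
        (X = V x (((ε : ℂ) ^ 2) • b Y + (ε * X₀) • e) ∧
          Y = W x ((x.1 * Y₀) • e + (ε ^ 2 * x.1 * X₀) • b (V x e))) := by
      intro X₀ Y₀ X Y
      constructor
      · rintro ⟨h1, h2⟩
        have hX : X = V x (((ε : ℂ) ^ 2) • b Y + (ε * X₀) • e) := by rw [← h1, V2]
        refine ⟨hX, ?_⟩
        rw [← W2 Y]
        congr 1
        rw [hB2, ← h2, hX]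
        simp only [map_add, map_smul, smul_add, smul_smul]
        module
      · rintro ⟨h1, h2⟩
        refine ⟨by rw [h1, V1], ?_⟩
        have h3 : resonantOp ε R Rs b x Y = (x.1 * Y₀) • e + (ε ^ 2 * x.1 * X₀) • b (V x e) := by
          rw [h2, W1]
        rw [hB2] at h3
        rw [h1, ← add_sub_cancel_right ((x.1 * Y₀) • e) ((ε ^ 2 * x.1 * X₀) • b (V x e)), ← h3]
        simp only [map_add, map_smul, smul_add, smul_smul]
        module
    have hlX : ∀ X₀ Y₀ : ℂ, ∀ X Y : H, X = V x (((ε : ℂ) ^ 2) • b Y + (ε * X₀) • e) →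
          Y = W x ((x.1 * Y₀) • e + (ε ^ 2 * x.1 * X₀) • b (V x e)) →
          l X = m₁₁ x * X₀ + m₁₂ x * Y₀ ∧ l Y = m₂₁ x * X₀ + m₂₂ x * Y₀ := by
      intro X₀ Y₀ X Y h1 h2
      constructor
      · rw [h1, h2]
        simp only [map_add, map_smul, hm₁₁, hm₁₂, smul_eq_mul, mul_apply_eq_comp]
        ring
      · rw [h2]
        simp only [map_add, map_smul, hm₂₁, hm₂₂, smul_eq_mul, mul_apply_eq_comp]
        ring
    have hdet : (2 * x.1 * (-A₂ x / 2 - 2 * A₁ x - A₃ x - A₄ x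
        + ε * (A₁ x * A₂ x - A₃ x * A₄ x)) = 0) ↔
        (-1 / 2 + ε * A₁ x) * (-2 + ε * A₂ x) - (1 + ε * A₃ x) * (1 + ε * A₄ x) = 0 := by
      have h1 : (-1 / 2 + ε * A₁ x) * (-2 + ε * A₂ x) - (1 + ε * A₃ x) * (1 + ε * A₄ x) =
        ε * (-A₂ x / 2 - 2 * A₁ x - A₃ x - A₄ x + ε * (A₁ x * A₂ x - A₃ x * A₄ x)) := by ring
      rw [h1]
      simp [h0, hε0]
    have hs1 : ∀ X₀ Y₀ : ℂ, ((3 / 2 + ε * evansCoeff x - 2 * a₀) * X₀ - a₀ * Y₀ =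
        ε * (m₁₁ x * X₀ + m₁₂ x * Y₀)) ↔
        (-1 / 2 + ε * A₁ x) * X₀ - (1 + ε * A₃ x) * Y₀ = 0 := by
      intro X₀ Y₀
      rw [← sub_eq_zero, ha₀]
      simp only [hA₁, hA₃]
      constructor <;> intro h <;> linear_combination h
    have hs2 : ∀ X₀ Y₀ : ℂ, ((ε * (x.1 + x.1⁻¹) - 2 * a₀) * Y₀ - a₀ * X₀ =
        ε * (m₂₁ x * X₀ + m₂₂ x * Y₀)) ↔
        (-2 + ε * A₂ x) * Y₀ - (1 + ε * A₄ x) * X₀ = 0 := by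
      intro X₀ Y₀
      rw [← sub_eq_zero, ha₀]
      simp only [hA₂, hA₄]
      constructor <;> intro h <;> linear_combination h
    rw [hdet]
    constructor
    · intro hF
      obtain ⟨X₀, Y₀, hne, k1, k2⟩ : ∃ X₀ Y₀ : ℂ, (X₀ ≠ 0 ∨ Y₀ ≠ 0) ∧
          (-1 / 2 + ε * A₁ x) * X₀ - (1 + ε * A₃ x) * Y₀ = 0 ∧
          (-2 + ε * A₂ x) * Y₀ - (1 + ε * A₄ x) * X₀ = 0 := by
        -- A kernel vector of the singular matrix is read off from its first row, unless that row
        -- vanishes.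
        by_cases hz : (-1 / 2 + ε * A₁ x) = 0 ∧ (1 + ε * A₃ x) = 0
        · by_cases hz' : (-2 + ε * A₂ x) = 0
          · exact ⟨0, 1, by simp, by simp [hz.2], by simp [hz']⟩
          · exact ⟨-2 + ε * A₂ x, 1 + ε * A₄ x, Or.inl hz', by simp [hz.1, hz.2], by ring⟩
        · refine ⟨1 + ε * A₃ x, -1 / 2 + ε * A₁ x, ?_, by ring, by linear_combination hF⟩
          by_contra hcon
          push Not at hcon
          exact hz ⟨hcon.2, hcon.1⟩
      obtain ⟨h1, h2⟩ := (hsol X₀ Y₀ _ _).2 ⟨rfl, rfl⟩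
      obtain ⟨h3, h4⟩ := hlX X₀ Y₀ _ _ rfl rfl
      refine ⟨X₀, Y₀, _, _, hne, h1, h2, ?_, ?_⟩
      · rw [h3]; exact (hs1 _ _).2 k1
      · rw [h4]; exact (hs2 _ _).2 k2
    · rintro ⟨X₀, Y₀, X, Y, hne, h1, h2, h3, h4⟩
      obtain ⟨g1, g2⟩ := (hsol X₀ Y₀ _ _).1 ⟨h1, h2⟩
      obtain ⟨f1, f2⟩ := hlX X₀ Y₀ _ _ g1 g2
      rw [f1] at h3
      rw [f2] at h4
      have k1 := (hs1 _ _).1 h3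
      have k2 := (hs2 _ _).1 h4
      rcases hne with hne | hne
      · refine mul_right_cancel₀ hne ?_
        linear_combination (-2 + ε * A₂ x) * k1 + (1 + ε * A₃ x) * k2
      · refine mul_right_cancel₀ hne ?_
        linear_combination (-1 / 2 + ε * A₁ x) * k2 + (1 + ε * A₄ x) * k1

end Evans

/-! ### Size of the soliton at and off the centre. -/

/-- Quantitative properties of the fundamental soliton for small `ε`. -/
structure SolitonBounds (ε : ℝ) (ψ : ℤ → ℝ) : Prop where
  eq : ∀ m : ℤ, ε * (ψ (m + 1) + ψ (m - 1) - 2 * ψ m) - ψ m + ψ m ^ 3 = 0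
  pos : ∀ m, 0 < ψ m
  off_center : ∀ m, m ≠ 0 → ψ m ≤ 3 * ε
  center : |ψ 0 ^ 2 - (1 + 2 * ε)| ≤ 10 * ε ^ 2
  sum_sq_le : ∀ s : Finset ℤ, ∑ m ∈ s, ψ m ^ 2 ≤ 2 ^ 2

/-- Convergence in ℓ² only gives smallness without a rate. The stationary equation upgrades it: off
the centre the coefficient of ψ_m is near 1, so ψ_m is bounded by ε times its neighbours. -/
theorem IsFundamentalLineSoliton.eventually_solitonBounds {ψ : ℝ → lp (fun _ : ℤ => ℝ) 2}
    (hψ : IsFundamentalLineSoliton ψ) : ∀ᶠ ε in 𝓝[>] (0 : ℝ), SolitonBounds ε (ψ ε) := by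
  obtain ⟨h1, h2⟩ := hψ
  have h3 := h2 (Metric.ball_mem_nhds _ (show (0 : ℝ) < 1 / 10 by norm_num))
  have h4 : ∀ᶠ ε in 𝓝[>] (0 : ℝ), ε < 1 / 100 :=
    eventually_nhdsWithin_of_eventually_nhds (eventually_lt_nhds (by norm_num))
  filter_upwards [h1, h3, h4, self_mem_nhdsWithin] with ε hε hball hε1 hε0
  obtain ⟨heq, hpos⟩ := hε
  have hε0 : 0 < ε := hε0
  rw [Set.mem_preimage, mem_ball_iff_norm] at hball
  have hcoord : ∀ m, |ψ ε m - (lp.single 2 (0 : ℤ) (1 : ℝ) : lp (fun _ : ℤ => ℝ) 2) m| < 1 / 10 := by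
    intro m
    have := lp.norm_apply_le_norm (p := 2) (by norm_num) (ψ ε - lp.single 2 (0 : ℤ) (1 : ℝ)) m
    rw [lp.coeFn_sub, Pi.sub_apply, Real.norm_eq_abs] at this
    linarith
  have h0 : |ψ ε 0 - 1| < 1 / 10 := by
    have := hcoord 0
    rwa [lp.single_apply_self] at this
  have hm : ∀ m, m ≠ 0 → |ψ ε m| < 1 / 10 := by
    intro m hm
    have := hcoord m
    rwa [lp.single_apply_ne _ _ _ hm, sub_zero] at this
  rw [abs_lt] at h0
  have hall : ∀ m, ψ ε m ≤ 11 / 10 := by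
    intro m
    rcases eq_or_ne m 0 with rfl | h
    · linarith
    · have := (abs_lt.1 (hm m h)).2
      linarith
  have hoff : ∀ m, m ≠ 0 → ψ ε m ≤ 3 * ε := by
    intro m h
    have g1 := heq m
    have g2 := hall (m + 1)
    have g3 := hall (m - 1)
    have g4 := (abs_lt.1 (hm m h)).2
    have g5 := hpos m
    -- The bracket is at least 99/100 and each neighbour at most 11/10, so 3ε has room to spare.
    have g6 : ψ ε m * (1 + 2 * ε - ψ ε m ^ 2) = ε * (ψ ε (m + 1) + ψ ε (m - 1)) := by
      linear_combination -g1
    have g7 : ψ ε m ^ 2 ≤ 1 / 100 := by nlinarith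
    have g8 : ψ ε m * (99 / 100) ≤ ψ ε m * (1 + 2 * ε - ψ ε m ^ 2) := by
      gcongr; linarith
    nlinarith
  refine ⟨heq, hpos, hoff, ?_, ?_⟩
  · have g1 := heq 0
    have g2 := hoff (0 + 1) (by norm_num)
    have g3 := hoff (0 - 1) (by norm_num)
    have g4 := hpos (0 + 1)
    have g5 := hpos (0 - 1)
    -- The right-hand side lies between 0 and 6ε² by the bound on the neighbours; dividing by ψ_0 ≥
    -- 9/10 gives the bound 10ε².
    have g6 : ψ ε 0 * ((1 + 2 * ε) - ψ ε 0 ^ 2) = ε * (ψ ε (0 + 1) + ψ ε (0 - 1)) := by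
      linear_combination -g1
    have g7 : (9 : ℝ) / 10 ≤ ψ ε 0 := by linarith
    have g8 : 0 ≤ ε * (ψ ε (0 + 1) + ψ ε (0 - 1)) := by positivity
    have g9 : ε * (ψ ε (0 + 1) + ψ ε (0 - 1)) ≤ ε * (6 * ε) := by gcongr; linarith
    have g10 : 0 ≤ (1 + 2 * ε) - ψ ε 0 ^ 2 := by
      by_contra hc
      push Not at hc
      nlinarith
    rw [abs_le]
    constructor <;> nlinarith
  · intro s
    have hs := lp.sum_rpow_le_norm_rpow (p := 2) (by norm_num) (ψ ε) s
    simp only [ENNReal.toReal_ofNat, Real.rpow_ofNat, Real.norm_eq_abs, sq_abs] at hs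
    have hn : ‖ψ ε‖ ≤ 2 := by
      have g1 := norm_add_le (ψ ε - lp.single 2 (0 : ℤ) (1 : ℝ)) (lp.single 2 (0 : ℤ) (1 : ℝ))
      rw [sub_add_cancel, lp.norm_single (by norm_num)] at g1
      rw [norm_one] at g1
      linarith
    calc _ ≤ ‖ψ ε‖ ^ 2 := hs
      _ ≤ 2 ^ 2 := by gcongr

/-! ### Factored form of the stability problem. -/

/-- The stability problem in the variables `X = U + i W`, `Y = U - i W`, with `q = 1 - p²` and
`lam = i ω`. -/
structure IsFactoredSolution (ε q : ℝ) (ω : ℂ) (ψ : ℤ → ℝ) (X Y : Ell2) : Prop where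
  left : ∀ m, -(ε : ℂ) * (X (m + 1) + X (m - 1)) + (2 * ε + q + ω - 2 * (ψ m : ℂ) ^ 2) * X m
    = (ψ m : ℂ) ^ 2 * Y m
  right : ∀ m, -(ε : ℂ) * (Y (m + 1) + Y (m - 1)) + (2 * ε + q - ω - 2 * (ψ m : ℂ) ^ 2) * Y m
    = (ψ m : ℂ) ^ 2 * X m

theorem mem_stabilityEigenspace_iff {ε p : ℝ} {ψ : ℤ → ℝ} {ω : ℂ} {U W : Ell2} :
    (U, W) ∈ stabilityEigenspace (-1) ε p ψ (Complex.I * ω) ↔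
      IsFactoredSolution ε (1 - p ^ 2) ω ψ (U + Complex.I • W) (U - Complex.I • W) := by
  have hI := Complex.I_mul_I
  have hU : ∀ m, (U + Complex.I • W) m = U m + Complex.I * W m := fun m => rfl
  have hW : ∀ m, (U - Complex.I • W) m = U m - Complex.I * W m := fun m => rfl
  change ((∀ m, Lplus (-1) ε p ψ U m = -(Complex.I * ω) * W m) ∧
    (∀ m, Lminus (-1) ε p ψ W m = Complex.I * ω * U m)) ↔ _
  constructor
  · rintro ⟨h1, h2⟩
    constructor <;> intro m <;> have k1 := h1 m <;> have k2 := h2 m <;>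
      simp only [Lplus, Lminus] at k1 k2 <;> simp only [hU, hW] <;> push_cast at k1 k2 ⊢
    · linear_combination k1 + Complex.I * k2 + ω * U m * hI
    · linear_combination k1 - Complex.I * k2 - ω * U m * hI
  · rintro ⟨h1, h2⟩
    constructor <;> intro m <;> have k1 := h1 m <;> have k2 := h2 m <;>
      simp only [Lplus, Lminus] <;> simp only [hU, hW] at k1 k2 <;> push_cast at k1 k2 ⊢
    · linear_combination (k1 + k2) / 2
    · linear_combination -Complex.I * (k1 - k2) / 2 + (
        -(ε : ℂ) * (W (m + 1) + W (m - 1) - 2 * W m) + (1 - (p : ℂ) ^ 2) * W m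
          - (ψ m : ℂ) ^ 2 * W m) * hI

theorem isStabilityEigenvalue_iff {ε p : ℝ} {ψ : ℤ → ℝ} {ω : ℂ} :
    IsStabilityEigenvalue (-1) ε p ψ (Complex.I * ω) ↔
      ∃ X Y : Ell2, (X ≠ 0 ∨ Y ≠ 0) ∧ IsFactoredSolution ε (1 - p ^ 2) ω ψ X Y := by
  unfold IsStabilityEigenvalue
  rw [Submodule.ne_bot_iff]
  constructor
  · rintro ⟨⟨U, W⟩, h1, h2⟩
    refine ⟨_, _, ?_, mem_stabilityEigenspace_iff.1 h1⟩
    by_contra hc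
    push Not at hc
    obtain ⟨g1, g2⟩ := hc
    have hU : (2 : ℂ) • U = 0 := by
      have : (2 : ℂ) • U = (U + Complex.I • W) + (U - Complex.I • W) := by module
      rw [this, g1, g2, add_zero]
    have hU' : U = 0 := by simpa using hU
    subst hU'
    have hW : W = 0 := by simpa using g1
    exact h2 (by rw [hW]; rfl)
  · rintro ⟨X, Y, hne, h⟩
    have hI := Complex.I_mul_I
    refine ⟨((1 / 2 : ℂ) • (X + Y), (-Complex.I / 2) • (X - Y)), ?_, ?_⟩
    · rw [mem_stabilityEigenspace_iff]
      convert h using 1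
      · rw [smul_smul, show Complex.I * (-Complex.I / 2) = 1 / 2 by linear_combination -hI / 2]
        module
      · rw [smul_smul, show Complex.I * (-Complex.I / 2) = 1 / 2 by linear_combination -hI / 2]
        module
    · intro h0
      rw [Prod.mk_eq_zero] at h0
      have g1 : X + Y = 0 := (smul_eq_zero.1 h0.1).resolve_left (by norm_num)
      have g2 : X - Y = 0 :=
        (smul_eq_zero.1 h0.2).resolve_left (by simp [Complex.I_ne_zero])
      have gX : (2 : ℂ) • X = 0 := by
        have : (2 : ℂ) • X = (X + Y) + (X - Y) := by module
        rw [this, g1, g2, add_zero]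
      have gY : (2 : ℂ) • Y = 0 := by
        have : (2 : ℂ) • Y = (X + Y) - (X - Y) := by module
        rw [this, g1, g2, sub_zero]
      have gX' : X = 0 := by simpa using gX
      have gY' : Y = 0 := by simpa using gY
      exact hne.elim (fun h => h gX') (fun h => h gY')

/-! ### Realization of the reduced problem on ℓ²(ℤ). -/

/-- The shift away from the central site, with vanishing boundary values. -/
theorem Ell2.exists_shiftOut : ∃ R : Ell2 →L[ℂ] Ell2, ‖R‖ ≤ 1 ∧ ∀ (x : Ell2) (m : ℤ),
    R x m = if m = 0 ∨ m = 1 ∨ m = -1 then 0 else if 0 < m then x (m - 1) else x (m + 1) := by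
  obtain ⟨R, h1, h2⟩ := Ell2.exists_weightedComp (fun m => if m = 0 ∨ m = 1 ∨ m = -1 then 0 else 1)
    (fun m => if 0 < m then m - 1 else m + 1) zero_le_one
    (fun m => by split_ifs <;> simp) (by
      intro i hi j hj hij
      have hi' : ¬(i = 0 ∨ i = 1 ∨ i = -1) := fun h => hi (if_pos h)
      have hj' : ¬(j = 0 ∨ j = 1 ∨ j = -1) := fun h => hj (if_pos h)
      simp only at hij
      split_ifs at hij <;> omega)
  refine ⟨R, h2, fun x m => ?_⟩
  rw [h1]
  by_cases h : 0 < m <;> simp [h]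

/-- The shift towards the central site, which removes the neighbours of the centre. -/
theorem Ell2.exists_shiftIn : ∃ R : Ell2 →L[ℂ] Ell2, ‖R‖ ≤ 1 ∧ ∀ (x : Ell2) (m : ℤ),
    R x m = if m = 0 then 0 else if 0 < m then x (m + 1) else x (m - 1) := by
  obtain ⟨R, h1, h2⟩ := Ell2.exists_weightedComp (fun m => if m = 0 then 0 else 1)
    (fun m => if 0 < m then m + 1 else m - 1) zero_le_one
    (fun m => by split_ifs <;> simp) (by
      intro i hi j hj hij
      have hi' : ¬(i = 0) := fun h => hi (if_pos h)
      have hj' : ¬(j = 0) := fun h => hj (if_pos h)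
      simp only at hij
      split_ifs at hij <;> omega)
  refine ⟨R, h2, fun x m => ?_⟩
  rw [h1]
  by_cases h : 0 < m <;> simp [h]

/-- Multiplication by a bounded sequence outside the central site. -/
theorem Ell2.exists_mulOff (c : ℤ → ℂ) {B : ℝ} (hB : 0 ≤ B) (hc : ∀ m, m ≠ 0 → ‖c m‖ ≤ B) :
    ∃ T : Ell2 →L[ℂ] Ell2, ‖T‖ ≤ B ∧ ∀ (x : Ell2) (m : ℤ),
      T x m = if m = 0 then 0 else c m * x m := by
  obtain ⟨T, h1, h2⟩ := Ell2.exists_weightedComp (fun m => if m = 0 then 0 else c m) id hB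
    (fun m => by
      split_ifs with h
      · simpa using hB
      · exact hc m h) (fun i _ j _ h => h)
  refine ⟨T, h2, fun x m => ?_⟩
  rw [h1]
  split_ifs <;> simp

/-- The indicator of the two neighbours of the central site. -/
noncomputable def neighbours : Ell2 := lp.single 2 1 1 + lp.single 2 (-1) 1

theorem neighbours_apply (m : ℤ) : neighbours m = if m = 1 ∨ m = -1 then 1 else 0 := by
  have : neighbours m = (lp.single 2 1 1 : Ell2) m + (lp.single 2 (-1) 1 : Ell2) m := rfl
  rw [this, lp.single_apply, lp.single_apply]
  by_cases h : m = 1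
  · subst h; simp
  · by_cases h' : m = -1
    · subst h'; simp
    · simp [h, h']

theorem norm_neighbours_le : ‖neighbours‖ ≤ 2 := by
  refine (norm_add_le _ _).trans ?_
  rw [lp.norm_single (by norm_num), lp.norm_single (by norm_num), norm_one]
  norm_num

/-- Summation over the two neighbours of the central site. -/
noncomputable def sumNeighbours : Ell2 →L[ℂ] ℂ :=
  lp.evalCLM ℂ (fun _ : ℤ => ℂ) 2 1 + lp.evalCLM ℂ (fun _ : ℤ => ℂ) 2 (-1)

theorem sumNeighbours_apply (x : Ell2) : sumNeighbours x = x 1 + x (-1) := rfl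

theorem norm_sumNeighbours_le : ‖sumNeighbours‖ ≤ 2 := by
  refine ContinuousLinearMap.opNorm_le_bound _ (by norm_num) fun x => ?_
  rw [sumNeighbours_apply]
  linarith [norm_add_le (x 1) (x (-1)), Ell2.norm_apply_le x 1, Ell2.norm_apply_le x (-1)]

section

variable {ε : ℝ} {ψ : ℤ → ℝ} {R Rs b : Ell2 →L[ℂ] Ell2}

theorem resonantOp₀_apply_center (hR : ∀ (x : Ell2) (m : ℤ),
      R x m = if m = 0 ∨ m = 1 ∨ m = -1 then 0 else if 0 < m then x (m - 1) else x (m + 1))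
    (hRs : ∀ (x : Ell2) (m : ℤ), Rs x m = if m = 0 then 0 else if 0 < m then x (m + 1) else x (m - 1))
    (x : ℂ × ℂ) (Z : Ell2) : resonantOp₀ R Rs x Z 0 = Z 0 := by
  have h : resonantOp₀ R Rs x Z 0 =
      (Z 0 - x.1 * R Z 0) - x.1 * Rs ((1 - x.1 • R) Z) 0 := rfl
  rw [h, hR, hRs]
  simp

/-- `Rs` composed after `R` is the identity off the centre, while the reverse composition loses the
two neighbours of the centre; hence the order of the factors. That `R` vanishes at ±1 encodes the
boundary value Z 0 = 0. -/
theorem resonantOp₀_apply_off (hR : ∀ (x : Ell2) (m : ℤ),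
      R x m = if m = 0 ∨ m = 1 ∨ m = -1 then 0 else if 0 < m then x (m - 1) else x (m + 1))
    (hRs : ∀ (x : Ell2) (m : ℤ), Rs x m = if m = 0 then 0 else if 0 < m then x (m + 1) else x (m - 1))
    (x : ℂ × ℂ) {Z : Ell2} (hZ : Z 0 = 0) {m : ℤ} (hm : m ≠ 0) :
    resonantOp₀ R Rs x Z m = (1 + x.1 ^ 2) * Z m - x.1 * (Z (m + 1) + Z (m - 1)) := by
  have h : resonantOp₀ R Rs x Z m =
      (Z m - x.1 * R Z m) - x.1 * Rs ((1 - x.1 • R) Z) m := rfl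
  have h' : ∀ k, ((1 - x.1 • R) Z) k = Z k - x.1 * R Z k := fun k => rfl
  rw [h, hRs, if_neg hm, h', h', hR, hR, hR]
  rcases lt_or_gt_of_ne hm with hlt | hgt
  · have c1 : ¬ (0 < m) := by omega
    have c2 : ¬ (m - 1 = 0 ∨ m - 1 = 1 ∨ m - 1 = -1) := by omega
    have c3 : ¬ (0 < m - 1) := by omega
    rw [if_neg c1, if_neg c1, if_neg c2, if_neg c3, sub_add_cancel]
    by_cases c4 : m = -1
    · subst c4
      simp [hZ]; ring
    · rw [if_neg (by omega)]; ring
  · have c2 : ¬ (m + 1 = 0 ∨ m + 1 = 1 ∨ m + 1 = -1) := by omega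
    have c3 : 0 < m + 1 := by omega
    rw [if_pos hgt, if_pos hgt, if_neg c2, if_pos c3, add_sub_cancel_right]
    by_cases c4 : m = 1
    · subst c4
      simp [hZ]; ring
    · rw [if_neg (by omega)]; ring

theorem nonresonantOp_apply_center (hR : ∀ (x : Ell2) (m : ℤ),
      R x m = if m = 0 ∨ m = 1 ∨ m = -1 then 0 else if 0 < m then x (m - 1) else x (m + 1))
    (hRs : ∀ (x : Ell2) (m : ℤ), Rs x m = if m = 0 then 0 else if 0 < m then x (m + 1) else x (m - 1))
    {c : ℤ → ℂ} (hb : ∀ (x : Ell2) (m : ℤ), b x m = if m = 0 then 0 else c m * x m)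
    (x : ℂ × ℂ) (Z : Ell2) :
    nonresonantOp ε R Rs b x Z 0 = (3 / 2 + ε * evansCoeff x) * Z 0 := by
  have h : nonresonantOp ε R Rs b x Z 0 = (3 / 2 + ε * evansCoeff x) * Z 0
      - ε * (R Z 0 + Rs Z 0) - (2 * ε ^ 2) * b Z 0 := rfl
  rw [h, hR, hRs, hb]
  simp

theorem nonresonantOp_apply_off (hR : ∀ (x : Ell2) (m : ℤ),
      R x m = if m = 0 ∨ m = 1 ∨ m = -1 then 0 else if 0 < m then x (m - 1) else x (m + 1))
    (hRs : ∀ (x : Ell2) (m : ℤ), Rs x m = if m = 0 then 0 else if 0 < m then x (m + 1) else x (m - 1))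
    {c : ℤ → ℂ} (hb : ∀ (x : Ell2) (m : ℤ), b x m = if m = 0 then 0 else c m * x m)
    (x : ℂ × ℂ) {Z : Ell2} (hZ : Z 0 = 0) {m : ℤ} (hm : m ≠ 0) :
    nonresonantOp ε R Rs b x Z m = (3 / 2 + ε * evansCoeff x) * Z m
      - ε * (Z (m + 1) + Z (m - 1)) - 2 * ε ^ 2 * c m * Z m := by
  have h : nonresonantOp ε R Rs b x Z m = (3 / 2 + ε * evansCoeff x) * Z m
      - ε * (R Z m + Rs Z m) - (2 * ε ^ 2) * b Z m := rfl
  rw [h, hR, hRs, hb, if_neg hm, if_neg hm]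
  rcases lt_or_gt_of_ne hm with hlt | hgt
  · have c1 : ¬ (0 < m) := by omega
    rw [if_neg c1, if_neg c1]
    by_cases c4 : m = -1
    · subst c4
      simp [hZ]; ring
    · rw [if_neg (by omega)]; ring
  · rw [if_pos hgt, if_pos hgt]
    by_cases c4 : m = 1
    · subst c4
      simp [hZ]; ring
    · rw [if_neg (by omega)]; ring

/-- The characteristic function of the eigenvalue problem near the resonance. -/
theorem SolitonBounds.exists_evansFunction (hψ : SolitonBounds ε ψ) (hε : 0 < ε)
    (hε' : ε ≤ 1 / 10 ^ 12) :
    ∃ F : ℂ × ℂ → ℂ, DifferentiableOn ℂ F evansDomain ∧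
      (∀ x ∈ evansDomain, ‖F x - resonancePoly x‖ ≤ 10 ^ 11 * ε) ∧
      ∀ (z : ℂ) (δ p : ℝ), (z, (δ : ℂ)) ∈ evansDomain → p ^ 2 = 1 / 4 + ε * δ →
        (F (z, δ) = 0 ↔ IsStabilityEigenvalue (-1) ε p ψ
          (Complex.I * (3 / 4 + ε * (2 - z - z⁻¹ - δ)))) := by
  have hε0 : (ε : ℂ) ≠ 0 := by exact_mod_cast hε.ne'
  set c : ℤ → ℂ := fun m => (ψ m : ℂ) ^ 2 / (ε : ℂ) ^ 2 with hc
  have hcε : ∀ m, (ε : ℂ) ^ 2 * c m = (ψ m : ℂ) ^ 2 := fun m => by simp only [hc]; field_simp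
  obtain ⟨R, nR, hR⟩ := Ell2.exists_shiftOut
  obtain ⟨Rs, nRs, hRs⟩ := Ell2.exists_shiftIn
  obtain ⟨b, nb, hb⟩ := Ell2.exists_mulOff c (B := 9) (by norm_num) (by
    intro m hm
    simp only [hc]
    rw [norm_div, norm_pow, norm_pow, Complex.norm_of_nonneg (hψ.pos m).le,
      Complex.norm_of_nonneg hε.le, div_le_iff₀ (by positivity)]
    have h1 := hψ.off_center m hm
    have h2 := hψ.pos m
    nlinarith)
  set b₀ : ℂ := (((ψ 0 ^ 2 - (1 + 2 * ε)) / ε ^ 2 : ℝ) : ℂ) with hb₀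
  have hb₀' : ‖b₀‖ ≤ 10 := by
    rw [hb₀, Complex.norm_real, Real.norm_eq_abs, abs_div, abs_of_pos (by positivity : 0 < ε ^ 2),
      div_le_iff₀ (by positivity)]
    exact hψ.center
  have ha₀ : (ψ 0 : ℂ) ^ 2 = 1 + 2 * ε + ε ^ 2 * b₀ := by
    rw [hb₀]
    push_cast
    field_simp
    ring
  obtain ⟨F, F1, F2, F3⟩ := _root_.exists_evansFunction (e := neighbours) (l := sumNeighbours)
    hε hε' nR nRs nb norm_sumNeighbours_le
    norm_neighbours_le (fun y => by rw [sumNeighbours_apply, hR, hR]; simp)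
    (by
      apply lp.ext
      funext m
      change Rs neighbours m = 0
      rw [hRs, neighbours_apply, neighbours_apply]
      split_ifs <;> first | rfl | omega)
    (by
      rw [sumNeighbours_apply, neighbours_apply, neighbours_apply]
      norm_num) hb₀' ha₀
  refine ⟨F, F1, F2, fun z δ p hx hp => ?_⟩
  have hz : z ≠ 0 := by
    rw [← norm_pos_iff]; linarith [hx.1]
  have hp' : ((1 - p ^ 2 : ℝ) : ℂ) = 3 / 4 - ε * δ := by
    rw [hp]; push_cast; ring
  rw [F3 _ hx, isStabilityEigenvalue_iff]
  have hcoef : evansCoeff (z, (δ : ℂ)) = 4 - z - z⁻¹ - 2 * δ := rfl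
  constructor
  · rintro ⟨X₀, Y₀, X, Y, hne, h1, h2, h3, h4⟩
    have k1 : ∀ m, nonresonantOp ε R Rs b (z, (δ : ℂ)) X m
        = (ε : ℂ) ^ 2 * b Y m + (ε * X₀) * neighbours m := fun m => by rw [h1]; rfl
    have k2 : ∀ m, resonantOp₀ R Rs (z, (δ : ℂ)) Y m - (ε * z) * b (X + (2 : ℂ) • Y) m
        = (z * Y₀) * neighbours m := fun m => by
      change (resonantOp₀ R Rs (z, (δ : ℂ)) Y - (ε * z) • b (X + (2 : ℂ) • Y)) m = _
      rw [h2]; rfl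
    -- The operators act on all of ℓ²(ℤ) with the central coordinate decoupled, so this coordinate
    -- must be shown to vanish before the central amplitude is inserted there.
    have hX : X 0 = 0 := by
      have k := k1 0
      rw [nonresonantOp_apply_center hR hRs hb, hb, neighbours_apply] at k
      have k' : (3 / 2 + ε * evansCoeff (z, (δ : ℂ))) * X 0 = 0 := by
        rw [k]; norm_num
      refine (mul_eq_zero.1 k').resolve_left fun h0 => ?_
      have n1 : ‖(ε : ℂ) * evansCoeff (z, (δ : ℂ))‖ ≤ ε * 305 := by
        rw [norm_mul, Complex.norm_of_nonneg hε.le]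
        gcongr
        exact norm_evansCoeff_le hx
      rw [show (ε : ℂ) * evansCoeff (z, (δ : ℂ)) = -(3 / 2) by linear_combination h0] at n1
      have n2 : ‖(-(3 / 2) : ℂ)‖ = 3 / 2 := by simp
      rw [n2] at n1
      linarith
    have hY : Y 0 = 0 := by
      have k := k2 0
      rw [resonantOp₀_apply_center hR hRs, hb, neighbours_apply] at k
      simpa using k
    set X' : Ell2 := X + lp.single 2 0 X₀ with hX'
    set Y' : Ell2 := Y + lp.single 2 0 Y₀ with hY'
    have x0 : X' 0 = X₀ := by
      change X 0 + (lp.single 2 0 X₀ : Ell2) 0 = X₀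
      rw [hX, lp.single_apply_self, zero_add]
    have y0 : Y' 0 = Y₀ := by
      change Y 0 + (lp.single 2 0 Y₀ : Ell2) 0 = Y₀
      rw [hY, lp.single_apply_self, zero_add]
    have xm : ∀ m, m ≠ 0 → X' m = X m := fun m hm => by
      change X m + (lp.single 2 0 X₀ : Ell2) m = X m
      rw [lp.single_apply_ne _ _ _ hm, add_zero]
    have ym : ∀ m, m ≠ 0 → Y' m = Y m := fun m hm => by
      change Y m + (lp.single 2 0 Y₀ : Ell2) m = Y m
      rw [lp.single_apply_ne _ _ _ hm, add_zero]
    have xs : ∀ m, m ≠ 0 → X' (m + 1) + X' (m - 1) = X (m + 1) + X (m - 1)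
        + X₀ * neighbours m := fun m hm => by
      rw [neighbours_apply]
      by_cases c1 : m = 1
      · subst c1
        rw [xm _ (by norm_num), show (1 : ℤ) - 1 = 0 from rfl, x0, hX]
        simp
      · by_cases c2 : m = -1
        · subst c2
          rw [xm (-1 - 1) (by norm_num), show (-1 : ℤ) + 1 = 0 from rfl, x0, hX]
          simp
          ring
        · rw [xm _ (by omega), xm _ (by omega), if_neg (by omega)]
          ring
    have ys : ∀ m, m ≠ 0 → Y' (m + 1) + Y' (m - 1) = Y (m + 1) + Y (m - 1)
        + Y₀ * neighbours m := fun m hm => by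
      rw [neighbours_apply]
      by_cases c1 : m = 1
      · subst c1
        rw [ym _ (by norm_num), show (1 : ℤ) - 1 = 0 from rfl, y0, hY]
        simp
      · by_cases c2 : m = -1
        · subst c2
          rw [ym (-1 - 1) (by norm_num), show (-1 : ℤ) + 1 = 0 from rfl, y0, hY]
          simp
          ring
        · rw [ym _ (by omega), ym _ (by omega), if_neg (by omega)]
          ring
    refine ⟨X', Y', ?_, ?_, ?_⟩
    · rcases hne with h | h
      · exact Or.inl fun h0 => h (by rw [← x0, h0]; rfl)
      · exact Or.inr fun h0 => h (by rw [← y0, h0]; rfl)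
    · intro m
      rw [hp']
      by_cases hm : m = 0
      · subst hm
        rw [x0, y0, show (0 : ℤ) + 1 = 1 from rfl, show (0 : ℤ) - 1 = -1 from rfl,
          xm _ (by norm_num), xm _ (by norm_num)]
        rw [sumNeighbours_apply, hcoef] at h3
        linear_combination h3
      · rw [xm _ hm, ym _ hm, xs m hm]
        have k := k1 m
        rw [nonresonantOp_apply_off hR hRs hb _ hX hm, hb, if_neg hm, hcoef] at k
        linear_combination k + (Y m + 2 * X m) * hcε m
    · intro m
      rw [hp']
      by_cases hm : m = 0
      · subst hm
        rw [x0, y0, show (0 : ℤ) + 1 = 1 from rfl, show (0 : ℤ) - 1 = -1 from rfl,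
          ym _ (by norm_num), ym _ (by norm_num)]
        rw [sumNeighbours_apply] at h4
        linear_combination h4
      · rw [xm _ hm, ym _ hm, ys m hm]
        have k := k2 m
        rw [resonantOp₀_apply_off hR hRs _ hY hm, hb, if_neg hm] at k
        have e1 : (X + (2 : ℂ) • Y) m = X m + 2 * Y m := rfl
        rw [e1] at k
        have hzz : z * z⁻¹ = 1 := mul_inv_cancel₀ hz
        -- The resonant equation of the reduced problem is the Y equation multiplied by z/ε.
        refine mul_left_cancel₀ hz ?_
        linear_combination ε * k + z * (X m + 2 * Y m) * hcε m + ε * Y m * hzz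
  · rintro ⟨X, Y, hne, h1, h2⟩
    set X' : Ell2 := X - lp.single 2 0 (X 0) with hX'
    set Y' : Ell2 := Y - lp.single 2 0 (Y 0) with hY'
    have x0 : X' 0 = 0 := by
      change X 0 - (lp.single 2 0 (X 0) : Ell2) 0 = 0
      rw [lp.single_apply_self, sub_self]
    have y0 : Y' 0 = 0 := by
      change Y 0 - (lp.single 2 0 (Y 0) : Ell2) 0 = 0
      rw [lp.single_apply_self, sub_self]
    have xm : ∀ m, m ≠ 0 → X' m = X m := fun m hm => by
      change X m - (lp.single 2 0 (X 0) : Ell2) m = X m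
      rw [lp.single_apply_ne _ _ _ hm, sub_zero]
    have ym : ∀ m, m ≠ 0 → Y' m = Y m := fun m hm => by
      change Y m - (lp.single 2 0 (Y 0) : Ell2) m = Y m
      rw [lp.single_apply_ne _ _ _ hm, sub_zero]
    have xs : ∀ m, m ≠ 0 → X (m + 1) + X (m - 1) = X' (m + 1) + X' (m - 1)
        + X 0 * neighbours m := fun m hm => by
      rw [neighbours_apply]
      by_cases c1 : m = 1
      · subst c1
        rw [xm _ (by norm_num), show (1 : ℤ) - 1 = 0 from rfl, x0]
        simp
      · by_cases c2 : m = -1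
        · subst c2
          rw [xm (-1 - 1) (by norm_num), show (-1 : ℤ) + 1 = 0 from rfl, x0]
          simp
          ring
        · rw [xm _ (by omega), xm _ (by omega), if_neg (by omega)]
          ring
    have ys : ∀ m, m ≠ 0 → Y (m + 1) + Y (m - 1) = Y' (m + 1) + Y' (m - 1)
        + Y 0 * neighbours m := fun m hm => by
      rw [neighbours_apply]
      by_cases c1 : m = 1
      · subst c1
        rw [ym _ (by norm_num), show (1 : ℤ) - 1 = 0 from rfl, y0]
        simp
      · by_cases c2 : m = -1
        · subst c2
          rw [ym (-1 - 1) (by norm_num), show (-1 : ℤ) + 1 = 0 from rfl, y0]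
          simp
          ring
        · rw [ym _ (by omega), ym _ (by omega), if_neg (by omega)]
          ring
    have hzz : z * z⁻¹ = 1 := mul_inv_cancel₀ hz
    have e1 : nonresonantOp ε R Rs b (z, (δ : ℂ)) X'
        = ((ε : ℂ) ^ 2) • b Y' + (ε * X 0) • neighbours := by
      apply lp.ext
      funext m
      change nonresonantOp ε R Rs b (z, (δ : ℂ)) X' m
        = (ε : ℂ) ^ 2 * b Y' m + (ε * X 0) * neighbours m
      by_cases hm : m = 0
      · subst hm
        rw [nonresonantOp_apply_center hR hRs hb, hb, neighbours_apply, x0]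
        norm_num
      · rw [nonresonantOp_apply_off hR hRs hb _ x0 hm, hb, if_neg hm, hcoef]
        have k := h1 m
        rw [hp', xs m hm, ← xm m hm, ← ym m hm] at k
        linear_combination k - (Y' m + 2 * X' m) * hcε m
    have e2 : resonantOp₀ R Rs (z, (δ : ℂ)) Y' - (ε * z) • b (X' + (2 : ℂ) • Y')
        = (z * Y 0) • neighbours := by
      apply lp.ext
      funext m
      change resonantOp₀ R Rs (z, (δ : ℂ)) Y' m - (ε * z) * b (X' + (2 : ℂ) • Y') m
        = (z * Y 0) * neighbours m
      by_cases hm : m = 0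
      · subst hm
        rw [resonantOp₀_apply_center hR hRs, hb, neighbours_apply, y0]
        norm_num
      · rw [resonantOp₀_apply_off hR hRs _ y0 hm, hb, if_neg hm]
        have e1 : (X' + (2 : ℂ) • Y') m = X' m + 2 * Y' m := rfl
        rw [e1]
        have k := h2 m
        rw [hp', ys m hm, ← xm m hm, ← ym m hm] at k
        refine mul_left_cancel₀ hε0 ?_
        linear_combination z * k - z * (X' m + 2 * Y' m) * hcε m - ε * Y' m * hzz
    have e3 : (3 / 2 + ε * evansCoeff (z, (δ : ℂ)) - 2 * (ψ 0 : ℂ) ^ 2) * X 0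
        - (ψ 0 : ℂ) ^ 2 * Y 0 = ε * sumNeighbours X' := by
      rw [sumNeighbours_apply, hcoef, xm _ (by norm_num), xm _ (by norm_num)]
      have k := h1 0
      rw [hp', show (0 : ℤ) + 1 = 1 from rfl, show (0 : ℤ) - 1 = -1 from rfl] at k
      linear_combination k
    have e4 : (ε * (z + z⁻¹) - 2 * (ψ 0 : ℂ) ^ 2) * Y 0
        - (ψ 0 : ℂ) ^ 2 * X 0 = ε * sumNeighbours Y' := by
      rw [sumNeighbours_apply, ym _ (by norm_num), ym _ (by norm_num)]
      have k := h2 0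
      rw [hp', show (0 : ℤ) + 1 = 1 from rfl, show (0 : ℤ) - 1 = -1 from rfl] at k
      linear_combination k
    refine ⟨X 0, Y 0, X', Y', ?_, e1, e2, e3, e4⟩
    -- An eigenvector vanishing at the centre solves the homogeneous problem off the centre, whose
    -- operators are invertible, so it is zero.
    by_contra hcon
    push Not at hcon
    obtain ⟨hX0, hY0⟩ := hcon
    obtain ⟨u1, -⟩ := nonresonantOp_spec hε hε' nR nRs nb hx
    obtain ⟨u2, -⟩ := resonantOp_spec hε hε' nR nRs nb hx
    set V := Ring.inverse (nonresonantOp ε R Rs b (z, (δ : ℂ))) with hV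
    have g1 : X' = (ε : ℂ) ^ 2 • V (b Y') := by
      have : V (nonresonantOp ε R Rs b (z, (δ : ℂ)) X') = X' := by
        rw [hV, ← mul_apply_eq_comp, Ring.inverse_mul_cancel _ u1, one_apply_eq_self]
      rw [← this, e1, hX0]
      simp
    have g2 : resonantOp ε R Rs b (z, (δ : ℂ)) Y' = 0 := by
      have : resonantOp ε R Rs b (z, (δ : ℂ)) Y' = resonantOp₀ R Rs (z, (δ : ℂ)) Y'
          - (ε * z) • b ((2 : ℂ) • Y' + (ε : ℂ) ^ 2 • V (b Y')) := by
        simp [resonantOp, hV]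
      rw [this, ← g1, add_comm, e2, hY0]
      simp
    have g3 : Y' = 0 := by
      have : Ring.inverse (resonantOp ε R Rs b (z, (δ : ℂ)))
          (resonantOp ε R Rs b (z, (δ : ℂ)) Y') = Y' := by
        rw [← mul_apply_eq_comp, Ring.inverse_mul_cancel _ u2, one_apply_eq_self]
      rw [← this, g2, map_zero]
    have g4 : X' = 0 := by rw [g1, g3]; simp
    have g5 : X = 0 := by
      rw [hX', hX0, lp.single_zero, sub_zero] at g4; exact g4
    have g6 : Y = 0 := by
      rw [hY', hY0, lp.single_zero, sub_zero] at g3; exact g3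
    exact hne.elim (fun h => h g5) (fun h => h g6)

end

/-! ### Self-adjoint operators and energy identities. -/

/-- The restriction of a sequence to the complement of the central site. -/
noncomputable def Ell2.off (x : Ell2) : Ell2 := x - lp.single 2 0 (x 0)

theorem Ell2.off_apply (x : Ell2) (m : ℤ) : x.off m = if m = 0 then 0 else x m := by
  change x m - (lp.single 2 0 (x 0) : Ell2) m = _
  by_cases h : m = 0
  · subst h; rw [lp.single_apply_self]; simp
  · rw [lp.single_apply_ne _ _ _ h]; simp [h]

theorem Ell2.norm_sq_eq (x : Ell2) : ‖x‖ ^ 2 = ‖x 0‖ ^ 2 + ‖x.off‖ ^ 2 := by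
  have h := lp.norm_sub_norm_compl_sub_single (p := 2) (by norm_num) x {0}
  simp only [ENNReal.toReal_ofNat, Real.rpow_ofNat, Finset.sum_singleton] at h
  have h' : x - lp.single 2 0 (x 0) = x.off := rfl
  rw [h'] at h
  linarith

theorem Ell2.norm_off_le (x : Ell2) : ‖x.off‖ ≤ ‖x‖ := by
  refine le_of_sq_le_sq ?_ (norm_nonneg x)
  rw [x.norm_sq_eq]
  nlinarith [norm_nonneg (x 0)]

theorem Ell2.inner_eq_add_off (x y : Ell2) :
    inner ℂ x y = conj (x 0) * y 0 + inner ℂ x y.off := by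
  have h : y = lp.single 2 0 (y 0) + y.off := by simp [Ell2.off]
  conv_lhs => rw [h, inner_add_right, lp.inner_single_right]
  rw [RCLike.inner_apply, mul_comm]

theorem Ell2.exists_mulReal (c : ℤ → ℝ) {B : ℝ} (hB : 0 ≤ B) (hc : ∀ m, |c m| ≤ B) :
    ∃ T : Ell2 →L[ℂ] Ell2, ‖T‖ ≤ B ∧ (∀ (x : Ell2) (m : ℤ), T x m = c m * x m) ∧
      ∀ x y, inner ℂ (T x) y = inner ℂ x (T y) := by
  obtain ⟨T, h1, h2⟩ := Ell2.exists_weightedComp (fun m => (c m : ℂ)) id hB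
    (fun m => by rw [Complex.norm_real]; exact hc m) (fun i _ j _ h => h)
  refine ⟨T, h2, h1, fun x y => ?_⟩
  rw [lp.inner_eq_tsum, lp.inner_eq_tsum]
  refine tsum_congr fun m => ?_
  rw [h1, h1]
  simp only [RCLike.inner_apply, id, map_mul, Complex.conj_ofReal]
  ring

theorem Ell2.exists_laplacian :
    ∃ D : Ell2 →L[ℂ] Ell2, ‖D‖ ≤ 4 ∧
      (∀ (x : Ell2) (m : ℤ), D x m = x (m + 1) + x (m - 1) - 2 * x m) ∧
      ∀ x y, inner ℂ (D x) y = inner ℂ x (D y) := by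
  obtain ⟨S, h1, h2⟩ := Ell2.exists_weightedComp (fun _ => 1) (fun m => m + 1) zero_le_one
    (fun m => by simp) (fun i _ j _ h => by simpa using h)
  obtain ⟨T, h3, h4⟩ := Ell2.exists_weightedComp (fun _ => 1) (fun m => m - 1) zero_le_one
    (fun m => by simp) (fun i _ j _ h => by simpa using h)
  have hST : ∀ x y, inner ℂ (S x) y = inner ℂ x (T y) := fun x y => by
    rw [lp.inner_eq_tsum, lp.inner_eq_tsum, ← (Equiv.addRight (1 : ℤ)).tsum_eq
      (fun m => inner ℂ (x m) (T y m))]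
    refine tsum_congr fun m => ?_
    rw [h1, h3]
    simp
  have hTS : ∀ x y, inner ℂ (T x) y = inner ℂ x (S y) := fun x y => by
    rw [← inner_conj_symm, ← hST, inner_conj_symm]
  refine ⟨S + T - (2 : ℂ) • 1, ?_, fun x m => ?_, fun x y => ?_⟩
  · have h5 : ‖(2 : ℂ) • (1 : Ell2 →L[ℂ] Ell2)‖ ≤ 2 := by
      rw [norm_smul, Complex.norm_ofNat]
      linarith [ContinuousLinearMap.norm_one_le' (H := Ell2)]
    linarith [norm_sub_le (S + T) ((2 : ℂ) • (1 : Ell2 →L[ℂ] Ell2)), norm_add_le S T]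
  · change S x m + T x m - 2 * x m = _
    rw [h1, h3]
    simp
  · change inner ℂ (S x + T x - (2 : ℂ) • x) y = inner ℂ x (S y + T y - (2 : ℂ) • y)
    rw [inner_sub_left, inner_add_left, inner_sub_right, inner_add_right, hST, hTS,
      inner_smul_left, inner_smul_right]
    simp only [map_ofNat]
    ring

theorem im_inner_eq_zero_of_symm {E : Type*} [NormedAddCommGroup E] [InnerProductSpace ℂ E]
    {T : E →L[ℂ] E} (hT : ∀ x y, inner ℂ (T x) y = inner ℂ x (T y)) (x : E) :
    (inner ℂ x (T x)).im = 0 := by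
  rw [← Complex.conj_eq_iff_im, inner_conj_symm, hT]

/-- The operators entering the stability problem of the soliton. -/
structure IsSolitonOps (ε : ℝ) (ψ : ℤ → ℝ) (D M M' : Ell2 →L[ℂ] Ell2) : Prop where
  norm_laplacian : ‖D‖ ≤ 4
  laplacian_apply : ∀ (x : Ell2) (m : ℤ), D x m = x (m + 1) + x (m - 1) - 2 * x m
  laplacian_symm : ∀ x y, inner ℂ (D x) y = inner ℂ x (D y)
  norm_potential : ‖M‖ ≤ 11 / 10
  potential_apply : ∀ (x : Ell2) (m : ℤ), M x m = (ψ m : ℂ) ^ 2 * x m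
  potential_symm : ∀ x y, inner ℂ (M x) y = inner ℂ x (M y)
  norm_off : ‖M'‖ ≤ 9 * ε ^ 2
  off_potential : ∀ x, (M x).off = M' x

section

variable {ε : ℝ} {ψ : ℤ → ℝ} {D M M' : Ell2 →L[ℂ] Ell2}

theorem SolitonBounds.exists_ops (hψ : SolitonBounds ε ψ) (hε : 0 < ε) (hε' : ε ≤ 1 / 10 ^ 12) :
    ∃ D M M' : Ell2 →L[ℂ] Ell2, IsSolitonOps ε ψ D M M' := by
  obtain ⟨D, d1, d2, d3⟩ := Ell2.exists_laplacian
  have hoff : ∀ m, m ≠ 0 → ψ m ^ 2 ≤ 9 * ε ^ 2 := fun m hm => by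
    have h1 := hψ.off_center m hm
    have h2 := hψ.pos m
    nlinarith
  obtain ⟨M, m1, m2, m3⟩ := Ell2.exists_mulReal (fun m => ψ m ^ 2) (B := 11 / 10) (by norm_num)
    (fun m => by
      rw [abs_of_nonneg (sq_nonneg _)]
      by_cases hm : m = 0
      · subst hm
        have := (abs_le.1 hψ.center).2
        nlinarith
      · have := hoff m hm
        nlinarith)
  obtain ⟨M', n1, n2⟩ := Ell2.exists_mulOff (fun m => (ψ m : ℂ) ^ 2) (B := 9 * ε ^ 2)
    (by positivity) (fun m hm => by
      rw [norm_pow, Complex.norm_of_nonneg (hψ.pos m).le]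
      exact hoff m hm)
  refine ⟨D, M, M', d1, d2, d3, m1, fun x m => by rw [m2]; push_cast; rfl, m3, n1, fun x => ?_⟩
  apply lp.ext
  funext m
  rw [Ell2.off_apply, n2, m2]
  push_cast
  rfl

theorem IsSolitonOps.norm_off_apply_le (h : IsSolitonOps ε ψ D M M') (x : Ell2) :
    ‖M' x‖ ≤ 9 * ε ^ 2 * ‖x‖ :=
  (M'.le_opNorm x).trans (by gcongr; exact h.norm_off)

theorem IsSolitonOps.inner_potential (h : IsSolitonOps ε ψ D M M') (x y : Ell2) :
    inner ℂ x (M y) = (ψ 0 : ℂ) ^ 2 * (conj (x 0) * y 0) + inner ℂ x (M' y) := by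
  rw [Ell2.inner_eq_add_off, h.potential_apply, h.off_potential]
  ring

theorem IsSolitonOps.norm_inner_off_le (h : IsSolitonOps ε ψ D M M') (x y : Ell2) :
    ‖inner ℂ x (M' y)‖ ≤ 9 * ε ^ 2 * ‖x‖ * ‖y‖ :=
  calc ‖inner ℂ x (M' y)‖ ≤ ‖x‖ * ‖M' y‖ := norm_inner_le_norm _ _
    _ ≤ ‖x‖ * (9 * ε ^ 2 * ‖y‖) := by gcongr; exact h.norm_off_apply_le y
    _ = _ := by ring

theorem SolitonBounds.abs_center_sub_one_le (hψ : SolitonBounds ε ψ) (hε : 0 < ε)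
    (hε' : ε ≤ 1 / 10 ^ 12) : |ψ 0 ^ 2 - 1| ≤ 3 * ε := by
  have h := abs_le.1 hψ.center
  rw [abs_le]
  constructor <;> nlinarith

theorem IsFactoredSolution.vector_left (h : IsSolitonOps ε ψ D M M') {q : ℝ} {ω : ℂ} {X Y : Ell2}
    (hs : IsFactoredSolution ε q ω ψ X Y) :
    (q + ω) • X = (ε : ℂ) • D X + M ((2 : ℂ) • X + Y) := by
  apply lp.ext
  funext m
  change (q + ω) * X m = ε * D X m + M ((2 : ℂ) • X + Y) m
  rw [h.laplacian_apply, h.potential_apply]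
  change _ = _ + (ψ m : ℂ) ^ 2 * (2 * X m + Y m)
  linear_combination hs.left m

/-- This symmetry lets each estimate of the first component serve for the second, with q - ω in
place of q + ω. -/
theorem IsFactoredSolution.swap {q : ℝ} {ω : ℂ} {X Y : Ell2}
    (hs : IsFactoredSolution ε q ω ψ X Y) : IsFactoredSolution ε q (-ω) ψ Y X :=
  ⟨fun m => by linear_combination hs.right m, fun m => by linear_combination hs.left m⟩

/-- Pair the first equation with X and take imaginary parts: the self-adjoint terms drop out and
only the coupling to Y can produce growth. -/
theorem IsFactoredSolution.im_mul_norm_sq (h : IsSolitonOps ε ψ D M M') {q : ℝ} {ω : ℂ}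
    {X Y : Ell2} (hs : IsFactoredSolution ε q ω ψ X Y) :
    ω.im * ‖X‖ ^ 2 = (inner ℂ X (M Y)).im := by
  have h1 := congrArg (fun v => (inner ℂ X v).im) (hs.vector_left h)
  simp only [map_add, map_smul, inner_add_right, inner_smul_right, Complex.add_im,
    inner_self_eq_norm_sq_to_K] at h1
  have h2 := im_inner_eq_zero_of_symm h.laplacian_symm X
  have h3 := im_inner_eq_zero_of_symm h.potential_symm X
  have h4 : ((ε : ℂ) * inner ℂ X (D X)).im = 0 := by
    simp [Complex.mul_im, h2]
  have h5 : ((2 : ℂ) * inner ℂ X (M X)).im = 0 := by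
    simp [Complex.mul_im, h3]
  have h6 : (((q : ℂ) + ω) * ((‖X‖ : ℂ)) ^ 2).im = ω.im * ‖X‖ ^ 2 := by
    rw [← Complex.ofReal_pow, Complex.im_mul_ofReal]
    simp
  rw [h4, h5, zero_add, zero_add] at h1
  rw [← h1, ← h6]
  rfl

/-- Off the centre the potential is O(ε²) and the hopping term O(ε), so mass there is possible only
if q + ω is small. -/
theorem IsFactoredSolution.norm_off_le (h : IsSolitonOps ε ψ D M M') (hε : 0 < ε)
    (hε' : ε ≤ 1 / 10 ^ 12) {q : ℝ} {ω : ℂ} {X Y : Ell2}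
    (hs : IsFactoredSolution ε q ω ψ X Y) (hXY : ‖Y‖ ≤ ‖X‖) :
    ‖(q : ℂ) + ω‖ * ‖X.off‖ ≤ 5 * ε * ‖X‖ := by
  have h1 : (q + ω) • X.off = (ε : ℂ) • (D X).off + M' ((2 : ℂ) • X + Y) := by
    rw [← h.off_potential]
    have h2 := hs.vector_left h
    apply lp.ext
    funext m
    have h3 : (q + ω) * X m = ε * D X m + M ((2 : ℂ) • X + Y) m := by
      have := congrArg (fun v : Ell2 => v m) h2
      exact this
    change (q + ω) * X.off m = ε * (D X).off m + (M ((2 : ℂ) • X + Y)).off m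
    rw [Ell2.off_apply, Ell2.off_apply, Ell2.off_apply]
    split_ifs
    · simp
    · exact h3
  rw [← norm_smul, h1]
  have h2 : ‖(ε : ℂ) • (D X).off‖ ≤ ε * (4 * ‖X‖) := by
    rw [norm_smul, Complex.norm_of_nonneg hε.le]
    gcongr
    exact (Ell2.norm_off_le _).trans ((D.le_opNorm X).trans (by gcongr; exact h.norm_laplacian))
  have h3 : ‖(2 : ℂ) • X + Y‖ ≤ 3 * ‖X‖ := by
    refine (norm_add_le _ _).trans ?_
    rw [norm_smul, Complex.norm_ofNat]
    linarith
  have h4 := h.norm_off_apply_le ((2 : ℂ) • X + Y)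
  have h5 : 9 * ε ^ 2 * ‖(2 : ℂ) • X + Y‖ ≤ 9 * ε ^ 2 * (3 * ‖X‖) := by gcongr
  have h6 : ε * ε * ‖X‖ ≤ 1 / 10 ^ 12 * ε * ‖X‖ := by gcongr
  refine (norm_add_le _ _).trans ?_
  nlinarith [norm_nonneg X, mul_nonneg hε.le (norm_nonneg X)]

end

/-! ### Eigenvectors close to the resonance. -/

section

variable {ε : ℝ} {ψ : ℤ → ℝ}

/-- The equal norms of the two components of an eigenvector off the imaginary axis. -/
theorem IsFactoredSolution.norm_eq_norm {D M M' : Ell2 →L[ℂ] Ell2} (h : IsSolitonOps ε ψ D M M')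
    {q : ℝ} {ω : ℂ} {X Y : Ell2} (hs : IsFactoredSolution ε q ω ψ X Y) (hω : ω.im ≠ 0) :
    ‖X‖ = ‖Y‖ := by
  have h1 := hs.im_mul_norm_sq h
  have h2 := hs.swap.im_mul_norm_sq h
  -- Exchanging X and Y changes the sign of ω and conjugates the coupling term, so both squared
  -- norms satisfy the same identity.
  rw [← h.potential_symm, ← inner_conj_symm, Complex.conj_im, ← h1, Complex.neg_im] at h2
  have h3 : ‖X‖ ^ 2 = ‖Y‖ ^ 2 := by
    have : ω.im * ‖X‖ ^ 2 = ω.im * ‖Y‖ ^ 2 := by linarith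
    exact mul_left_cancel₀ hω this
  exact (sq_eq_sq₀ (norm_nonneg X) (norm_nonneg Y)).1 h3

set_option maxHeartbeats 1000000 in
/-- An eigenvector with growth rate at least `ε / 2`, one of whose components is near resonance
with the continuous spectrum, only occurs in an `ε`-neighbourhood of `q = 3 / 4`, `ω = 3 / 4`. -/
theorem SolitonBounds.resonance_localization (hψ : SolitonBounds ε ψ) (hε : 0 < ε)
    (hε' : ε ≤ 1 / 10 ^ 12) {q : ℝ} {ω : ℂ} {X Y : Ell2} (hs : IsFactoredSolution ε q ω ψ X Y)
    (hne : X ≠ 0 ∨ Y ≠ 0) (hq : |q| ≤ 1) (hω : ε / 2 ≤ |ω.im|) (hr : ‖(q : ℂ) - ω‖ ≤ 1 / 100) :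
    ‖(q : ℂ) - ω‖ ≤ 10 * ε ∧ |q - 3 / 4| ≤ 20 * ε := by
  obtain ⟨D, M, M', h⟩ := hψ.exists_ops hε hε'
  have hω0 : ω.im ≠ 0 := by
    intro h0; rw [h0, abs_zero] at hω; linarith
  have hN := hs.norm_eq_norm h hω0
  set N := ‖X‖ with hNdef
  have hNpos : 0 < N := by
    rcases hne with h0 | h0
    · exact norm_pos_iff.2 h0
    · rw [hN]; exact norm_pos_iff.2 h0
  set a : ℝ := ψ 0 ^ 2 with ha
  have ha1 := hψ.abs_center_sub_one_le hε hε'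
  rw [← ha] at ha1
  have ha2 := abs_le.1 ha1
  set θ : ℂ := q - ω with hθ
  set f : ℂ := ε * (X 1 + X (-1)) with hf
  set g : ℂ := ε * (Y 1 + Y (-1)) with hg
  have hf1 : ‖f‖ ≤ 2 * ε * N := by
    rw [hf, norm_mul, Complex.norm_of_nonneg hε.le]
    have := norm_add_le (X 1) (X (-1))
    have h1 := Ell2.norm_apply_le X 1
    have h2 := Ell2.norm_apply_le X (-1)
    calc _ ≤ ε * (2 * N) := by gcongr; linarith
      _ = _ := by ring
  have hg1 : ‖g‖ ≤ 2 * ε * N := by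
    rw [hg, norm_mul, Complex.norm_of_nonneg hε.le]
    have := norm_add_le (Y 1) (Y (-1))
    have h1 := Ell2.norm_apply_le Y 1
    have h2 := Ell2.norm_apply_le Y (-1)
    calc _ ≤ ε * (2 * N) := by gcongr; linarith
      _ = _ := by ring
  -- `P = -2 + θ + η`, `S = 2 q - 2 + η - θ`
  set η : ℂ := ((2 * ε + 2 - 2 * a : ℝ) : ℂ) with hη
  have hη1 : ‖η‖ ≤ 8 * ε := by
    rw [hη, Complex.norm_real, Real.norm_eq_abs, abs_le]
    constructor <;> linarith
  have e1 : (((2 * q - 2 : ℝ) : ℂ) + (η - θ)) * X 0 - a * Y 0 = f := by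
    have := hs.left 0
    rw [show (0 : ℤ) + 1 = 1 from rfl, show (0 : ℤ) - 1 = -1 from rfl] at this
    simp only [hη, hθ, hf, ha]
    push_cast
    linear_combination this
  have e2 : (-2 + (θ + η)) * Y 0 - a * X 0 = g := by
    have := hs.right 0
    rw [show (0 : ℤ) + 1 = 1 from rfl, show (0 : ℤ) - 1 = -1 from rfl] at this
    simp only [hη, hθ, hg, ha]
    push_cast
    linear_combination this
  set S : ℂ := ((2 * q - 2 : ℝ) : ℂ) + (η - θ) with hS
  set P : ℂ := -2 + (θ + η) with hP
  have n2 : ‖(-2 : ℂ)‖ = 2 := by simp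
  clear_value f g
  have hθη : ‖θ + η‖ ≤ ‖θ‖ + 8 * ε := (norm_add_le _ _).trans (by linarith)
  have hηθ : ‖η - θ‖ ≤ ‖θ‖ + 8 * ε := (norm_sub_le _ _).trans (by linarith)
  have hPn : ‖P‖ ≤ 2 + (‖θ‖ + 8 * ε) := (norm_add_le _ _).trans (by linarith)
  have hSn : ‖S‖ ≤ |2 * q - 2| + (‖θ‖ + 8 * ε) := by
    refine (norm_add_le _ _).trans ?_
    rw [Complex.norm_real, Real.norm_eq_abs]
    linarith
  have hq2 := abs_le.1 hq
  have hq3 : |2 * q - 2| ≤ 4 := by rw [abs_le]; constructor <;> linarith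
  have han : ‖(a : ℂ)‖ ≤ 11 / 10 := by
    rw [Complex.norm_real, Real.norm_eq_abs, abs_le]; constructor <;> linarith
  -- Cramer's rule: the central amplitudes times the determinant are O(εN), because the neighbours
  -- enter with the factor ε.
  set Dt : ℂ := P * S - a ^ 2 with hDt
  have d1 : Dt * X 0 = P * f + a * g := by
    rw [← e1, ← e2]; ring
  have d2 : Dt * Y 0 = S * g + a * f := by
    rw [← e1, ← e2]; ring
  have d1' : ‖Dt‖ * ‖X 0‖ ≤ 7 * ε * N := by
    rw [← norm_mul, d1]
    refine (norm_add_le _ _).trans ?_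
    rw [norm_mul, norm_mul]
    have hP3 : ‖P‖ ≤ 23 / 10 := by linarith
    calc ‖P‖ * ‖f‖ + ‖(a : ℂ)‖ * ‖g‖ ≤ 23 / 10 * (2 * ε * N) + 11 / 10 * (2 * ε * N) := by gcongr
      _ ≤ 7 * ε * N := by linarith [mul_pos hε hNpos]
  have d2' : ‖Dt‖ * ‖Y 0‖ ≤ 11 * ε * N := by
    rw [← norm_mul, d2]
    refine (norm_add_le _ _).trans ?_
    rw [norm_mul, norm_mul]
    have hS3 : ‖S‖ ≤ 44 / 10 := by linarith
    calc ‖S‖ * ‖g‖ + ‖(a : ℂ)‖ * ‖f‖ ≤ 44 / 10 * (2 * ε * N) + 11 / 10 * (2 * ε * N) := by gcongr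
      _ ≤ 11 * ε * N := by linarith [mul_pos hε hNpos]
  -- the growth rate bounds the central amplitudes from below
  have hgrow : ε / 2 * N ^ 2 ≤ 11 / 10 * (‖X 0‖ * ‖Y 0‖) + 9 * ε ^ 2 * N ^ 2 := by
    have k1 := hs.im_mul_norm_sq h
    have k2 : ε / 2 * N ^ 2 ≤ |ω.im * ‖X‖ ^ 2| := by
      rw [abs_mul, abs_of_nonneg (sq_nonneg ‖X‖)]
      gcongr
    rw [k1] at k2
    have k3 := Complex.abs_im_le_norm (inner ℂ X (M Y))
    rw [h.inner_potential] at k3 k2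
    have k4 := norm_add_le ((ψ 0 : ℂ) ^ 2 * (conj (X 0) * Y 0)) (inner ℂ X (M' Y))
    have k5 := h.norm_inner_off_le X Y
    rw [← hN] at k5
    have k6 : ‖(ψ 0 : ℂ) ^ 2 * (conj (X 0) * Y 0)‖ ≤ 11 / 10 * (‖X 0‖ * ‖Y 0‖) := by
      have : (ψ 0 : ℂ) ^ 2 = (a : ℂ) := by rw [ha]; push_cast; rfl
      rw [norm_mul, norm_mul, RCLike.norm_conj, this]
      gcongr
    have k7 : 9 * ε ^ 2 * N * N = 9 * ε ^ 2 * N ^ 2 := by ring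
    linarith
  have hεε : ε ^ 2 ≤ 1 / 10 ^ 12 * ε := by nlinarith
  -- The product of the two Cramer bounds is O(ε²N²), whereas `hgrow` bounds |X 0||Y 0| below by a
  -- multiple of εN². So |Dt|² = O(ε), a crude bound improved to |Dt| = O(ε) once X is known to
  -- concentrate.
  have hD2 : ‖Dt‖ ^ 2 ≤ 1 / 10 ^ 6 := by
    have k1 : ‖Dt‖ ^ 2 * (‖X 0‖ * ‖Y 0‖) ≤ (7 * ε * N) * (11 * ε * N) := by
      calc ‖Dt‖ ^ 2 * (‖X 0‖ * ‖Y 0‖) = (‖Dt‖ * ‖X 0‖) * (‖Dt‖ * ‖Y 0‖) := by ring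
        _ ≤ _ := by gcongr
    have k2 : ‖Dt‖ ^ 2 * (ε / 2 * N ^ 2)
        ≤ ‖Dt‖ ^ 2 * (11 / 10 * (‖X 0‖ * ‖Y 0‖) + 9 * ε ^ 2 * N ^ 2) := by
      gcongr
    have k3 : ‖Dt‖ ^ 2 * (9 * ε ^ 2 * N ^ 2) ≤ ‖Dt‖ ^ 2 * (1 / 10 * ε * N ^ 2) := by
      have : 9 * ε ^ 2 ≤ 1 / 10 * ε := by linarith
      gcongr
    have k4 : ‖Dt‖ ^ 2 * (4 / 10) * (ε * N ^ 2) ≤ 85 * ε * (ε * N ^ 2) := by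
      have : 0 ≤ ε * (ε * N ^ 2) := by positivity
      linarith
    have k5 := le_of_mul_le_mul_right k4 (by positivity)
    linarith
  have hDn : ‖Dt‖ ≤ 1 / 10 ^ 3 := by
    refine le_of_sq_le_sq ?_ (by norm_num)
    refine hD2.trans (by norm_num)
  -- comparison of the determinant with `3 - 4 q`
  have hcmp : ‖Dt - ((3 - 4 * q : ℝ) : ℂ)‖ ≤
      (2 + |2 * q - 2|) * (‖θ‖ + 8 * ε) + (‖θ‖ + 8 * ε) * (‖θ‖ + 8 * ε) + 7 * ε := by
    have k1 : Dt - ((3 - 4 * q : ℝ) : ℂ) = -2 * (η - θ) + ((2 * q - 2 : ℝ) : ℂ) * (θ + η)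
        + (θ + η) * (η - θ) + ((1 - a ^ 2 : ℝ) : ℂ) := by
      simp only [hDt, hP, hS]; push_cast; ring
    have k2 : ‖((1 - a ^ 2 : ℝ) : ℂ)‖ ≤ 7 * ε := by
      rw [Complex.norm_real, Real.norm_eq_abs, abs_le]
      have k3 : (1 - a ^ 2) = -((a - 1) * (a + 1)) := by ring
      rw [← abs_le, k3, abs_neg, abs_mul]
      have k4 : |a + 1| ≤ 7 / 3 := by rw [abs_le]; constructor <;> linarith
      calc |a - 1| * |a + 1| ≤ 3 * ε * (7 / 3) := by gcongr
        _ = 7 * ε := by ring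
    rw [k1]
    refine (norm_add_le _ _).trans (add_le_add ?_ k2)
    refine (norm_add_le _ _).trans (add_le_add ?_ ?_)
    · refine (norm_add_le _ _).trans ?_
      rw [norm_mul, norm_mul, n2, Complex.norm_real, Real.norm_eq_abs, add_mul]
      gcongr
    · rw [norm_mul]; gcongr
  have hq34 : |3 - 4 * q| ≤ ‖Dt‖ + ‖Dt - ((3 - 4 * q : ℝ) : ℂ)‖ := by
    have := norm_sub_le Dt (Dt - ((3 - 4 * q : ℝ) : ℂ))
    rwa [sub_sub_cancel, Complex.norm_real, Real.norm_eq_abs] at this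
  have hθ0 := norm_nonneg θ
  have hq4 : |3 - 4 * q| ≤ 8 / 100 := by
    have : (2 + |2 * q - 2|) * (‖θ‖ + 8 * ε) + (‖θ‖ + 8 * ε) * (‖θ‖ + 8 * ε) + 7 * ε ≤ 75 / 1000 := by
      have k : ‖θ‖ + 8 * ε ≤ 101 / 10000 := by linarith
      calc _ ≤ (2 + 4) * (101 / 10000) + (101 / 10000) * (101 / 10000) + 7 * (1 / 10 ^ 12 : ℝ) := by
            gcongr
        _ ≤ _ := by norm_num
    linarith
  have hq5 := abs_le.1 hq4
  have hX := hs.norm_off_le h hε hε' hN.ge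
  -- With q near 3/4 and ω near q, the sum is near 3/2; hence X sits at the centre up to O(ε).
  have hsum : (14 / 10 : ℝ) ≤ ‖(q : ℂ) + ω‖ := by
    have k1 : (q : ℂ) + ω = ((2 * q : ℝ) : ℂ) - θ := by rw [hθ]; push_cast; ring
    have k2 := norm_sub_norm_le ((2 * q : ℝ) : ℂ) θ
    rw [k1]
    rw [Complex.norm_real, Real.norm_eq_abs, abs_of_nonneg (by linarith)] at k2
    linarith
  have hXoff : ‖X.off‖ ≤ 4 * ε * N := by
    have : (14 / 10 : ℝ) * ‖X.off‖ ≤ 5 * ε * N :=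
      (mul_le_mul_of_nonneg_right hsum (norm_nonneg _)).trans hX
    linarith [mul_pos hε hNpos]
  have hX0 : 99 / 100 * N ≤ ‖X 0‖ := by
    refine le_of_sq_le_sq ?_ (norm_nonneg _)
    have k1 := X.norm_sq_eq
    have k2 : ‖X.off‖ ^ 2 ≤ (1 / 100 * N) ^ 2 := by
      gcongr
      refine hXoff.trans ?_
      gcongr
      linarith
    rw [mul_pow] at k2 ⊢
    linarith [sq_nonneg N]
  have hDε : ‖Dt‖ ≤ 8 * ε := by
    have k1 : ‖Dt‖ * (99 / 100 * N) ≤ 7 * ε * N := (by gcongr : _ ≤ ‖Dt‖ * ‖X 0‖).trans d1'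
    have k2 : (‖Dt‖ * (99 / 100)) * N ≤ (7 * ε) * N := by linarith
    have k3 := le_of_mul_le_mul_right k2 hNpos
    linarith
  have hq6 : |2 * q - 2| ≤ 54 / 100 := by rw [abs_le]; constructor <;> linarith
  -- Here S is near -1/2, so |Y 0| is about half of |X 0|. Since the total norms agree, a fixed part
  -- of Y lies off the centre, which requires q - ω = O(ε).
  have hY0 : ‖Y 0‖ ≤ 6 / 10 * N := by
    have k1 : (a : ℂ) * Y 0 = S * X 0 - f := by rw [← e1]; ring
    have k2 : ‖(a : ℂ) * Y 0‖ ≤ 56 / 100 * N + 2 * ε * N := by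
      rw [k1]
      refine (norm_sub_le _ _).trans ?_
      rw [norm_mul]
      have := Ell2.norm_apply_le X 0
      have hS4 : ‖S‖ ≤ 56 / 100 := by linarith
      gcongr
    have k3 : 99 / 100 * ‖Y 0‖ ≤ ‖(a : ℂ) * Y 0‖ := by
      rw [norm_mul, Complex.norm_real, Real.norm_eq_abs, abs_of_nonneg (by linarith)]
      gcongr
      linarith
    have k4 : ε * N ≤ 1 / 10 ^ 12 * N := by gcongr
    linarith
  have hYoff : 8 / 10 * N ≤ ‖Y.off‖ := by
    refine le_of_sq_le_sq ?_ (norm_nonneg _)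
    have k1 := Y.norm_sq_eq
    rw [← hN] at k1
    have k2 : ‖Y 0‖ ^ 2 ≤ (6 / 10 * N) ^ 2 := by gcongr
    rw [mul_pow] at k2 ⊢
    linarith
  have hθε : ‖θ‖ ≤ 7 * ε := by
    have k1 := hs.swap.norm_off_le h hε hε' hN.le
    rw [← sub_eq_add_neg, ← hN] at k1
    have k2 : ‖θ‖ * (8 / 10 * N) ≤ 5 * ε * N := (by gcongr : _ ≤ ‖θ‖ * ‖Y.off‖).trans k1
    have k3 : (‖θ‖ * (8 / 10)) * N ≤ (5 * ε) * N := by linarith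
    have k4 := le_of_mul_le_mul_right k3 hNpos
    linarith
  refine ⟨by linarith, ?_⟩
  have hfin : (2 + |2 * q - 2|) * (‖θ‖ + 8 * ε) + (‖θ‖ + 8 * ε) * (‖θ‖ + 8 * ε) + 7 * ε
      ≤ (2 + 54 / 100) * (15 * ε) + (15 * ε) * (15 * ε) + 7 * ε := by
    have k : ‖θ‖ + 8 * ε ≤ 15 * ε := by linarith
    gcongr
  have hfin2 : |3 - 4 * q| ≤ 55 * ε := by linarith
  rw [abs_le] at hfin2 ⊢
  constructor <;> linarith

end

/-! ### No growth away from the resonance. -/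

section

variable {ε p : ℝ} {ψ : ℤ → ℝ} {D M M' : Ell2 →L[ℂ] Ell2} {ν : ℂ} {U W : Ell2}

theorem IsSolitonOps.vector_Lplus (h : IsSolitonOps ε ψ D M M')
    (hs : (U, W) ∈ stabilityEigenspace (-1) ε p ψ ν) :
    ν • W = (ε : ℂ) • D U - ((1 - p ^ 2 : ℝ) : ℂ) • U + (3 : ℂ) • M U := by
  apply lp.ext
  funext m
  change ν * W m = ε * D U m - ((1 - p ^ 2 : ℝ) : ℂ) * U m + 3 * M U m
  have h1 := hs.1 m
  simp only [Lplus] at h1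
  rw [h.laplacian_apply, h.potential_apply]
  push_cast at h1 ⊢
  linear_combination h1

theorem IsSolitonOps.vector_Lminus (h : IsSolitonOps ε ψ D M M')
    (hs : (U, W) ∈ stabilityEigenspace (-1) ε p ψ ν) :
    ν • U = -((ε : ℂ) • D W) + ((1 - p ^ 2 : ℝ) : ℂ) • W - M W := by
  apply lp.ext
  funext m
  change ν * U m = -(ε * D W m) + ((1 - p ^ 2 : ℝ) : ℂ) * W m - M W m
  have h1 := hs.2 m
  simp only [Lminus] at h1
  rw [h.laplacian_apply, h.potential_apply]
  push_cast at h1 ⊢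
  linear_combination -h1

theorem IsSolitonOps.abs_re_inner_laplacian_le (h : IsSolitonOps ε ψ D M M') (x : Ell2) :
    |(inner ℂ x (D x)).re| ≤ 4 * ‖x‖ ^ 2 := by
  refine (Complex.abs_re_le_norm _).trans ((norm_inner_le_norm _ _).trans ?_)
  have := (D.le_opNorm x).trans (mul_le_mul_of_nonneg_right h.norm_laplacian (norm_nonneg x))
  calc ‖x‖ * ‖D x‖ ≤ ‖x‖ * (4 * ‖x‖) := by gcongr
    _ = _ := by ring

theorem IsSolitonOps.re_inner_potential_ge (h : IsSolitonOps ε ψ D M M') (x : Ell2) :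
    ψ 0 ^ 2 * ‖x 0‖ ^ 2 - 9 * ε ^ 2 * ‖x‖ ^ 2 ≤ (inner ℂ x (M x)).re := by
  rw [h.inner_potential, Complex.add_re]
  have h1 := (abs_le.1 ((Complex.abs_re_le_norm _).trans (h.norm_inner_off_le x x))).1
  have h2 : ((ψ 0 : ℂ) ^ 2 * (conj (x 0) * x 0)).re = ψ 0 ^ 2 * ‖x 0‖ ^ 2 := by
    rw [mul_comm (conj (x 0)), Complex.mul_conj, Complex.normSq_eq_norm_sq]
    rw [← Complex.ofReal_pow, ← Complex.ofReal_mul, Complex.ofReal_re]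
  rw [h2]
  nlinarith

theorem inner_self_eq_ofReal_norm_sq (x : Ell2) : (inner ℂ x x : ℂ) = ((‖x‖ ^ 2 : ℝ) : ℂ) := by
  rw [inner_self_eq_norm_sq_to_K]; push_cast; rfl

/-- An unstable eigenvector of negative energy forces a real eigenvalue and a sign of the
energy of the second component. -/
theorem IsSolitonOps.real_of_energy_neg (h : IsSolitonOps ε ψ D M M')
    (hs : (U, W) ∈ stabilityEigenspace (-1) ε p ψ ν) (hν : 0 < ν.re)
    (hA : 0 < ε * (inner ℂ U (D U)).re - (1 - p ^ 2) * ‖U‖ ^ 2 + 3 * (inner ℂ U (M U)).re) :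
    ν.im = 0 ∧ (inner ℂ U W).im = 0 ∧ 0 < (inner ℂ U W).re ∧
      0 < -(ε * (inner ℂ W (D W)).re) + (1 - p ^ 2) * ‖W‖ ^ 2 - (inner ℂ W (M W)).re := by
  have h1 := congrArg (fun v => inner ℂ U v) (h.vector_Lplus hs)
  have h2 := congrArg (fun v => inner ℂ W v) (h.vector_Lminus hs)
  simp only [inner_add_right, inner_sub_right, inner_smul_right, inner_neg_right,
    inner_self_eq_ofReal_norm_sq] at h1 h2
  have r1 := im_inner_eq_zero_of_symm h.laplacian_symm U
  have r2 := im_inner_eq_zero_of_symm h.potential_symm U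
  have r3 := im_inner_eq_zero_of_symm h.laplacian_symm W
  have r4 := im_inner_eq_zero_of_symm h.potential_symm W
  rw [← inner_conj_symm W U] at h2
  set ζ : ℂ := inner ℂ U W with hζ
  have a1 := congrArg Complex.re h1
  have a2 := congrArg Complex.im h1
  have b1 := congrArg Complex.re h2
  have b2 := congrArg Complex.im h2
  simp only [Complex.add_re, Complex.sub_re, Complex.add_im, Complex.sub_im, Complex.mul_re,
    Complex.mul_im, Complex.neg_re, Complex.neg_im, Complex.ofReal_re, Complex.ofReal_im,
    Complex.conj_re, Complex.conj_im, Complex.re_ofNat, Complex.im_ofNat, r1, r2, r3, r4] at a1 a2 b1 b2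
  -- The two pairings show that νζ and ν times the conjugate of ζ are both real, and that νζ is
  -- positive.
  have c1 : ν.re * ζ.im = 0 := by linarith
  have c2 : ζ.im = 0 := (mul_eq_zero.1 c1).resolve_left hν.ne'
  rw [c2] at a1 a2 b1 b2
  have c3 : 0 < ν.re * ζ.re := by linarith
  have c4 : 0 < ζ.re := (pos_iff_pos_of_mul_pos c3).1 hν
  have c5 : ν.im * ζ.re = 0 := by linarith
  have c6 : ν.im = 0 := (mul_eq_zero.1 c5).resolve_right c4.ne'
  rw [c6] at b1
  exact ⟨c6, c2, c4, by linarith⟩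

/-- There are no unstable eigenvalues for large transverse wavenumbers. -/
theorem SolitonBounds.not_unstable_of_large (hψ : SolitonBounds ε ψ) (hε : 0 < ε)
    (hε' : ε ≤ 1 / 10 ^ 12) (hs : (U, W) ∈ stabilityEigenspace (-1) ε p ψ ν) (hU : U ≠ 0)
    (hν : 0 < ν.re) : -(5 * ε) ≤ 1 - p ^ 2 := by
  by_contra hq
  push Not at hq
  obtain ⟨D, M, M', h⟩ := hψ.exists_ops hε hε'
  have hUpos : 0 < ‖U‖ ^ 2 := by have := norm_pos_iff.2 hU; positivity
  have hεε : ε ^ 2 ≤ 1 / 10 ^ 12 * ε := by nlinarith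
  have u1 := mul_le_mul_of_nonneg_left (abs_le.1 (h.abs_re_inner_laplacian_le U)).1 hε.le
  have u2 := h.re_inner_potential_ge U
  have w1 := mul_le_mul_of_nonneg_left (abs_le.1 (h.abs_re_inner_laplacian_le W)).1 hε.le
  have w2 := h.re_inner_potential_ge W
  have u3 : 0 ≤ ψ 0 ^ 2 * ‖U 0‖ ^ 2 := by positivity
  have w3 : 0 ≤ ψ 0 ^ 2 * ‖W 0‖ ^ 2 := by positivity
  have u4 := mul_lt_mul_of_pos_right hq hUpos
  have w4 := mul_le_mul_of_nonneg_right hq.le (sq_nonneg ‖W‖)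
  have u5 := mul_le_mul_of_nonneg_right hεε hUpos.le
  have w5 := mul_le_mul_of_nonneg_right hεε (sq_nonneg ‖W‖)
  have u6 : 0 < ε * ‖U‖ ^ 2 := by positivity
  have w6 : 0 ≤ ε * ‖W‖ ^ 2 := by positivity
  -- Below -5ε the Laplacian cannot compensate q, so both quadratic forms have the negative sign;
  -- the first sign forces the opposite of the second.
  obtain ⟨-, -, -, h4⟩ := h.real_of_energy_neg hs hν (by linarith)
  linarith

set_option maxHeartbeats 1000000 in
/-- There are no unstable eigenvalues away from the resonances. -/
theorem SolitonBounds.not_unstable_of_nonresonant (hψ : SolitonBounds ε ψ) (hε : 0 < ε)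
    (hε' : ε ≤ 1 / 10 ^ 12) (hs : (U, W) ∈ stabilityEigenspace (-1) ε p ψ ν) (hU : U ≠ 0)
    (hν : 0 < ν.re) : ‖((1 - p ^ 2 : ℝ) : ℂ) ^ 2 + ν ^ 2‖ < 1 / 10 ^ 4 := by
  by_contra hres
  push Not at hres
  have hlarge := hψ.not_unstable_of_large hε hε' hs hU hν
  obtain ⟨D, M, M', h⟩ := hψ.exists_ops hε hε'
  set q : ℝ := 1 - p ^ 2 with hq
  have hq1 : |q| ≤ 1 := by
    rw [abs_le]; constructor <;> nlinarith
  have hqn : ‖(q : ℂ)‖ ≤ 1 := by rw [Complex.norm_real]; exact hq1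
  have ν0 : ν ≠ 0 := fun h0 => by simp [h0] at hν
  have hUpos := norm_pos_iff.2 hU
  have hεε : ε ^ 2 ≤ 1 / 10 ^ 12 * ε := by nlinarith
  have vU := h.vector_Lplus hs
  have vW := h.vector_Lminus hs
  rw [← hq] at vU vW
  have nD : ∀ x, ‖(ε : ℂ) • D x‖ ≤ 4 * ε * ‖x‖ := fun x => by
    rw [norm_smul, Complex.norm_of_nonneg hε.le]
    calc ε * ‖D x‖ ≤ ε * (4 * ‖x‖) := by
          gcongr
          exact (D.le_opNorm x).trans (by gcongr; exact h.norm_laplacian)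
      _ = _ := by ring
  have nM : ∀ x, ‖M x‖ ≤ 11 / 10 * ‖x‖ := fun x =>
    (M.le_opNorm x).trans (by gcongr; exact h.norm_potential)
  have nq : ∀ x : Ell2, ‖(q : ℂ) • x‖ ≤ ‖x‖ := fun x => by
    rw [norm_smul]; nlinarith [norm_nonneg x]
  have bW : ‖ν‖ * ‖W‖ ≤ 5 * ‖U‖ := by
    rw [← norm_smul, vU]
    have k1 := norm_add_le ((ε : ℂ) • D U - (q : ℂ) • U) ((3 : ℂ) • M U)
    have k2 := norm_sub_le ((ε : ℂ) • D U) ((q : ℂ) • U)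
    rw [norm_smul (3 : ℂ), Complex.norm_ofNat] at k1
    have k3 := nD U
    have k4 := nM U
    have k5 := nq U
    have k6 : 4 * ε * ‖U‖ ≤ 1 / 10 * ‖U‖ := by gcongr; linarith
    linarith
  have bU : ‖ν‖ * ‖U‖ ≤ 5 * ‖W‖ := by
    rw [← norm_smul, vW]
    have k1 := norm_sub_le (-((ε : ℂ) • D W) + (q : ℂ) • W) (M W)
    have k2 := norm_add_le (-((ε : ℂ) • D W)) ((q : ℂ) • W)
    rw [norm_neg] at k2
    have k3 := nD W
    have k4 := nM W
    have k5 := nq W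
    have k6 : 4 * ε * ‖W‖ ≤ 1 / 10 * ‖W‖ := by gcongr; linarith
    linarith [norm_nonneg W]
  have hWpos : 0 < ‖W‖ := by
    have : 0 < ‖ν‖ * ‖U‖ := mul_pos (norm_pos_iff.2 ν0) hUpos
    linarith
  -- localization of both components at the central site
  set r₁ : Ell2 := (ε : ℂ) • (D U).off + (3 : ℂ) • M' U with hr₁
  set r₂ : Ell2 := (ε : ℂ) • (D W).off + M' W with hr₂
  have o1 : (q : ℂ) • U.off + ν • W.off = r₁ := by
    rw [hr₁, ← h.off_potential]
    apply lp.ext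
    funext m
    change (q : ℂ) * U.off m + ν * W.off m = ε * (D U).off m + 3 * (M U).off m
    have k : ν * W m = ε * D U m - (q : ℂ) * U m + 3 * M U m :=
      congrArg (fun v : Ell2 => v m) vU
    rw [Ell2.off_apply, Ell2.off_apply, Ell2.off_apply, Ell2.off_apply]
    split_ifs
    · simp
    · linear_combination k
  have o2 : (q : ℂ) • W.off - ν • U.off = r₂ := by
    rw [hr₂, ← h.off_potential]
    apply lp.ext
    funext m
    change (q : ℂ) * W.off m - ν * U.off m = ε * (D W).off m + (M W).off m
    have k : ν * U m = -(ε * D W m) + (q : ℂ) * W m - M W m :=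
      congrArg (fun v : Ell2 => v m) vW
    rw [Ell2.off_apply, Ell2.off_apply, Ell2.off_apply, Ell2.off_apply]
    split_ifs
    · simp
    · linear_combination -k
  have nDo : ∀ x, ‖(ε : ℂ) • (D x).off‖ ≤ 4 * ε * ‖x‖ := fun x => by
    refine le_trans ?_ (nD x)
    rw [norm_smul, norm_smul]
    gcongr
    exact Ell2.norm_off_le _
  have nr₁ : ‖r₁‖ ≤ 5 * ε * ‖U‖ := by
    have k1 := norm_add_le ((ε : ℂ) • (D U).off) ((3 : ℂ) • M' U)
    rw [norm_smul (3 : ℂ), Complex.norm_ofNat] at k1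
    have k2 := h.norm_off_apply_le U
    have k3 := mul_le_mul_of_nonneg_right hεε (norm_nonneg U)
    have k4 : 0 ≤ ε * ‖U‖ := by positivity
    linarith [nDo U]
  have nr₂ : ‖r₂‖ ≤ 5 * ε * ‖W‖ := by
    have k1 := norm_add_le ((ε : ℂ) • (D W).off) (M' W)
    have k2 := h.norm_off_apply_le W
    have k3 := mul_le_mul_of_nonneg_right hεε (norm_nonneg W)
    have k4 : 0 ≤ ε * ‖W‖ := by positivity
    linarith [nDo W]
  have lU : ‖U.off‖ ≤ 1 / 10 ^ 6 * ‖U‖ := by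
    -- Off the centre the unperturbed 2×2 system for (U, W) has determinant q² + ν², which is
    -- bounded below by `hres`.
    have k1 : ((q : ℂ) ^ 2 + ν ^ 2) • U.off = (q : ℂ) • r₁ - ν • r₂ := by
      rw [← o1, ← o2]; module
    have k2 : ‖((q : ℂ) ^ 2 + ν ^ 2) • U.off‖ ≤ 5 * ε * ‖U‖ + 5 * ε * (5 * ‖U‖) := by
      rw [k1]
      refine (norm_sub_le _ _).trans (add_le_add ((nq r₁).trans nr₁) ?_)
      rw [norm_smul]
      calc ‖ν‖ * ‖r₂‖ ≤ ‖ν‖ * (5 * ε * ‖W‖) := by gcongr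
        _ = 5 * ε * (‖ν‖ * ‖W‖) := by ring
        _ ≤ _ := by gcongr
    rw [norm_smul] at k2
    have k3 := mul_le_mul_of_nonneg_right hres (norm_nonneg U.off)
    have k4 : ε * ‖U‖ ≤ 1 / 10 ^ 12 * ‖U‖ := by gcongr
    linarith
  have lW : ‖W.off‖ ≤ 1 / 10 ^ 6 * ‖W‖ := by
    have k1 : ((q : ℂ) ^ 2 + ν ^ 2) • W.off = (q : ℂ) • r₂ + ν • r₁ := by
      rw [← o1, ← o2]; module
    have k2 : ‖((q : ℂ) ^ 2 + ν ^ 2) • W.off‖ ≤ 5 * ε * ‖W‖ + 5 * ε * (5 * ‖W‖) := by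
      rw [k1]
      refine (norm_add_le _ _).trans (add_le_add ((nq r₂).trans nr₂) ?_)
      rw [norm_smul]
      calc ‖ν‖ * ‖r₁‖ ≤ ‖ν‖ * (5 * ε * ‖U‖) := by gcongr
        _ = 5 * ε * (‖ν‖ * ‖U‖) := by ring
        _ ≤ _ := by gcongr
    rw [norm_smul] at k2
    have k3 := mul_le_mul_of_nonneg_right hres (norm_nonneg W.off)
    have k4 : ε * ‖W‖ ≤ 1 / 10 ^ 12 * ‖W‖ := by gcongr
    linarith
  have center : ∀ x : Ell2, ‖x.off‖ ≤ 1 / 10 ^ 6 * ‖x‖ → 99 / 100 * ‖x‖ ≤ ‖x 0‖ := fun x hx => by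
    refine le_of_sq_le_sq ?_ (norm_nonneg _)
    have k1 := x.norm_sq_eq
    have k2 : ‖x.off‖ ^ 2 ≤ (1 / 10 ^ 6 * ‖x‖) ^ 2 := by gcongr
    rw [mul_pow] at k2 ⊢
    linarith [sq_nonneg ‖x‖]
  have cU := center U lU
  have cW := center W lW
  have ha2 := abs_le.1 (hψ.abs_center_sub_one_le hε hε')
  -- negative energy
  obtain ⟨νim, ζim, ζre, -⟩ := h.real_of_energy_neg hs hν (by
    have u1 := mul_le_mul_of_nonneg_left (abs_le.1 (h.abs_re_inner_laplacian_le U)).1 hε.le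
    have u2 := h.re_inner_potential_ge U
    have u3 : 9 / 10 * (9 / 10 * ‖U‖ ^ 2) ≤ ψ 0 ^ 2 * ‖U 0‖ ^ 2 := by
      gcongr
      · linarith
      · have : (99 / 100 * ‖U‖) ^ 2 ≤ ‖U 0‖ ^ 2 := by gcongr
        rw [mul_pow] at this
        linarith [sq_nonneg ‖U‖]
    have u4 := mul_le_mul_of_nonneg_right (abs_le.1 hq1).2 (sq_nonneg ‖U‖)
    have u5 := mul_le_mul_of_nonneg_right hεε (sq_nonneg ‖U‖)
    have u6 := mul_le_mul_of_nonneg_right hε' (sq_nonneg ‖U‖)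
    have u7 : 0 < ‖U‖ ^ 2 := by positivity
    rw [← hq]
    linarith)
  -- the sign of the central amplitudes
  set η : ℂ := inner ℂ U W.off with hη
  have nη : ‖η‖ ≤ 1 / 10 ^ 6 * (‖U‖ * ‖W‖) := by
    refine (norm_inner_le_norm _ _).trans ?_
    calc ‖U‖ * ‖W.off‖ ≤ ‖U‖ * (1 / 10 ^ 6 * ‖W‖) := by gcongr
      _ = _ := by ring
  have hUW : conj (U 0) * W 0 = inner ℂ U W - η := by
    rw [Ell2.inner_eq_add_off U W]; ring
  have hcross : 8 / 10 * (‖U‖ * ‖W‖) ≤ (conj (U 0) * W 0).re := by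
    have k1 : 9 / 10 * (‖U‖ * ‖W‖) ≤ ‖conj (U 0) * W 0‖ := by
      rw [norm_mul, RCLike.norm_conj]
      have : (99 / 100 * ‖U‖) * (99 / 100 * ‖W‖) ≤ ‖U 0‖ * ‖W 0‖ := by gcongr
      have k : 0 ≤ ‖U‖ * ‖W‖ := by positivity
      linarith
    have k2 := Complex.norm_le_abs_re_add_abs_im (conj (U 0) * W 0)
    have k3 : |(conj (U 0) * W 0).im| ≤ 1 / 10 ^ 6 * (‖U‖ * ‖W‖) := by
      rw [hUW, Complex.sub_im, ζim, zero_sub, abs_neg]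
      exact (Complex.abs_im_le_norm η).trans nη
    have k4 : -(1 / 10 ^ 6 * (‖U‖ * ‖W‖)) ≤ (conj (U 0) * W 0).re := by
      rw [hUW, Complex.sub_re]
      have := (abs_le.1 ((Complex.abs_re_le_norm η).trans nη)).2
      linarith
    have k : 0 < ‖U‖ * ‖W‖ := by positivity
    rcases abs_cases (conj (U 0) * W 0).re with ⟨h1, -⟩ | ⟨h1, -⟩ <;> linarith
  -- projection onto the kernel of the unperturbed operator
  set Ψ : Ell2 := ⟨fun m => (ψ m : ℂ), Ell2.memℓp_of_sum_sq_le (C := 2 ^ 2) fun s => by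
    refine le_trans (le_of_eq (Finset.sum_congr rfl fun m _ => ?_)) (hψ.sum_sq_le s)
    rw [Complex.norm_real, Real.norm_eq_abs, sq_abs]⟩ with hΨ
  have Ψm : ∀ m, Ψ m = (ψ m : ℂ) := fun m => rfl
  have nΨ : ‖Ψ‖ ≤ 2 := by
    refine Ell2.norm_le_of_sum_sq_le (by norm_num) fun s => ?_
    refine le_trans (le_of_eq (Finset.sum_congr rfl fun m _ => ?_)) (hψ.sum_sq_le s)
    rw [Ψm, Complex.norm_real, Real.norm_eq_abs, sq_abs]
  have kerΨ : (ε : ℂ) • D Ψ + M Ψ = Ψ := by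
    apply lp.ext
    funext m
    change ε * D Ψ m + M Ψ m = Ψ m
    rw [h.laplacian_apply, h.potential_apply, Ψm, Ψm, Ψm]
    have := congrArg (fun t : ℝ => (t : ℂ)) (hψ.eq m)
    push_cast at this
    linear_combination this
  -- The soliton equation says L₋(0)ψ = 0, hence L₋(p)ψ = -p²ψ; now pair the second eigenvalue
  -- equation with ψ.
  have hproj : ν * inner ℂ Ψ U = -((p ^ 2 : ℝ) : ℂ) * inner ℂ Ψ W := by
    have k1 := congrArg (fun v => inner ℂ Ψ v) vW
    simp only [inner_add_right, inner_sub_right, inner_smul_right, inner_neg_right] at k1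
    have k2 := congrArg (fun v => inner ℂ v W) kerΨ
    simp only [inner_add_left, inner_smul_left, Complex.conj_ofReal] at k2
    rw [h.laplacian_symm, h.potential_symm] at k2
    rw [k1, hq]
    push_cast
    linear_combination -k2
  rw [Ell2.inner_eq_add_off Ψ U, Ell2.inner_eq_add_off Ψ W, Ψm, Complex.conj_ofReal] at hproj
  have nΨU : ‖inner ℂ Ψ U.off‖ ≤ 1 / 10 ^ 5 * ‖U‖ := by
    refine (norm_inner_le_norm _ _).trans ?_
    calc ‖Ψ‖ * ‖U.off‖ ≤ 2 * (1 / 10 ^ 6 * ‖U‖) := by gcongr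
      _ ≤ _ := by linarith
  have nΨW : ‖inner ℂ Ψ W.off‖ ≤ 1 / 10 ^ 5 * ‖W‖ := by
    refine (norm_inner_le_norm _ _).trans ?_
    calc ‖Ψ‖ * ‖W.off‖ ≤ 2 * (1 / 10 ^ 6 * ‖W‖) := by gcongr
      _ ≤ _ := by linarith
  set ρ : ℝ := ν.re with hρ
  have νρ : ν = (ρ : ℂ) := by
    apply Complex.ext <;> simp [hρ, νim]
  have hψ0 : 9 / 10 ≤ ψ 0 := by
    have := hψ.pos 0
    nlinarith
  -- After multiplication by the conjugate of U 0, both leading terms have nonnegative real part,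
  -- the first strictly positive, by the sign in `hcross`. The off-centre remainder is too small to
  -- balance them.
  have key : ((ρ * ψ 0 * ‖U 0‖ ^ 2 : ℝ) : ℂ) + ((p ^ 2 * ψ 0 : ℝ) : ℂ) * (conj (U 0) * W 0)
      = -(conj (U 0) * ((ρ : ℂ) * inner ℂ Ψ U.off + ((p ^ 2 : ℝ) : ℂ) * inner ℂ Ψ W.off)) := by
    have : ((‖U 0‖ ^ 2 : ℝ) : ℂ) = conj (U 0) * U 0 := by
      rw [mul_comm, Complex.mul_conj, Complex.normSq_eq_norm_sq]
    rw [Complex.ofReal_mul (ρ * ψ 0), this]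
    rw [νρ] at hproj
    push_cast at hproj ⊢
    linear_combination conj (U 0) * hproj
  have keyre := congrArg Complex.re key
  rw [Complex.add_re, Complex.ofReal_re, Complex.re_ofReal_mul] at keyre
  have hp2 : 0 ≤ p ^ 2 := sq_nonneg p
  have rhs : ‖-(conj (U 0) * ((ρ : ℂ) * inner ℂ Ψ U.off + ((p ^ 2 : ℝ) : ℂ) * inner ℂ Ψ W.off))‖
      ≤ ‖U‖ * (ρ * (1 / 10 ^ 5 * ‖U‖) + p ^ 2 * (1 / 10 ^ 5 * ‖W‖)) := by
    rw [norm_neg, norm_mul, RCLike.norm_conj]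
    gcongr
    · exact Ell2.norm_apply_le U 0
    · refine (norm_add_le _ _).trans ?_
      rw [norm_mul, norm_mul, Complex.norm_of_nonneg hν.le, Complex.norm_of_nonneg hp2]
      gcongr
  have rhs' := (abs_le.1 ((Complex.abs_re_le_norm _).trans rhs)).2
  rw [← keyre] at rhs'
  have l1 : ρ * (9 / 10) * (9 / 10 * ‖U‖ ^ 2) ≤ ρ * ψ 0 * ‖U 0‖ ^ 2 := by
    have : (99 / 100 * ‖U‖) ^ 2 ≤ ‖U 0‖ ^ 2 := by gcongr
    rw [mul_pow] at this
    gcongr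
    linarith [sq_nonneg ‖U‖]
  have l2 : p ^ 2 * (9 / 10) * (8 / 10 * (‖U‖ * ‖W‖)) ≤ p ^ 2 * ψ 0 * (conj (U 0) * W 0).re := by
    gcongr
  have l3 : 0 < ρ * ‖U‖ ^ 2 := by positivity
  have l4 : 0 ≤ p ^ 2 * (‖U‖ * ‖W‖) := by positivity
  linarith

/-- A priori localization of the eigenvalues with growth rate at least `ε / 2`. -/
theorem SolitonBounds.eigenvalue_localization (hψ : SolitonBounds ε ψ) (hε : 0 < ε)
    (hε' : ε ≤ 1 / 10 ^ 12) (hs : IsStabilityEigenvalue (-1) ε p ψ ν) (hν : ε / 2 ≤ ν.re) :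
    |p ^ 2 - 1 / 4| ≤ 20 * ε ∧ (‖((1 - p ^ 2 : ℝ) : ℂ) + Complex.I * ν‖ ≤ 10 * ε ∨
      ‖((1 - p ^ 2 : ℝ) : ℂ) - Complex.I * ν‖ ≤ 10 * ε) := by
  have hI := Complex.I_mul_I
  have hν0 : 0 < ν.re := by linarith
  have ν0 : ν ≠ 0 := fun h0 => by simp [h0] at hν0
  obtain ⟨ω, rfl⟩ : ∃ ω, ν = Complex.I * ω := ⟨-Complex.I * ν, by linear_combination ν * hI⟩
  obtain ⟨⟨U, W⟩, hUW, hne⟩ := (Submodule.ne_bot_iff _).1 hs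
  obtain ⟨X, Y, hXY, hf⟩ := isStabilityEigenvalue_iff.1 hs
  have hU : U ≠ 0 := by
    rintro rfl
    refine hne ?_
    rw [Prod.mk_eq_zero]
    refine ⟨rfl, ?_⟩
    obtain ⟨D, M, M', h⟩ := hψ.exists_ops hε hε'
    have := h.vector_Lplus hUW
    simp only [map_zero, smul_zero, sub_zero, add_zero] at this
    exact (smul_eq_zero.1 this).resolve_left ν0
  have hq1 := hψ.not_unstable_of_large hε hε' hUW hU hν0
  have hq2 := hψ.not_unstable_of_nonresonant hε hε' hUW hU hν0
  set q : ℝ := 1 - p ^ 2 with hq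
  have hqa : |q| ≤ 1 := by rw [abs_le]; constructor <;> nlinarith
  have e1 : (q : ℂ) + Complex.I * (Complex.I * ω) = q - ω := by linear_combination ω * hI
  have e2 : (q : ℂ) - Complex.I * (Complex.I * ω) = q + ω := by linear_combination -ω * hI
  have e3 : (q : ℂ) ^ 2 + (Complex.I * ω) ^ 2 = (q - ω) * (q + ω) := by
    linear_combination ω ^ 2 * hI
  rw [e1, e2]
  rw [e3, norm_mul] at hq2
  have him : (Complex.I * ω).re = -ω.im := by simp
  rw [him] at hν
  have e4 : p ^ 2 - 1 / 4 = -(q - 3 / 4) := by rw [hq]; ring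
  rw [e4, abs_neg]
  -- A product below 10⁻⁴ has a factor at most 10⁻². The case of q + ω reduces to that of q - ω by
  -- exchanging X and Y.
  rcases le_or_gt ‖(q : ℂ) - ω‖ (1 / 100) with h1 | h1
  · obtain ⟨g1, g2⟩ := hψ.resonance_localization hε hε' hf hXY hqa
      (hν.trans (neg_le_abs _)) h1
    exact ⟨g2, Or.inl g1⟩
  · have h2 : ‖(q : ℂ) + ω‖ ≤ 1 / 100 := by
      by_contra hc
      push Not at hc
      have : (1 / 100 : ℝ) * (1 / 100) ≤ ‖(q : ℂ) - ω‖ * ‖(q : ℂ) + ω‖ := by gcongr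
      linarith
    obtain ⟨g1, g2⟩ := hψ.resonance_localization hε hε' hf.swap hXY.symm hqa
      (by rw [Complex.neg_im]; exact hν.trans (le_abs_self _)) (by rw [sub_neg_eq_add]; exact h2)
    rw [sub_neg_eq_add] at g1
    exact ⟨g2, Or.inr g1⟩

end

/-! ### The decoupled problem at ε = 0. -/

section AntiContinuum

variable {p : ℝ} {lam : ℂ} {x : Ell2 × Ell2}

theorem Lplus_zero_singleSite (U : ℤ → ℂ) (m : ℤ) :
    Lplus (-1) 0 p singleSite U m = ((1 - p ^ 2 - if m = 0 then 3 else 0 : ℝ) : ℂ) * U m := by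
  unfold Lplus singleSite
  by_cases h : m = 0
  · subst h; simp; ring
  · simp [h]; left; ring

theorem Lminus_zero_singleSite (W : ℤ → ℂ) (m : ℤ) :
    Lminus (-1) 0 p singleSite W m = ((1 - p ^ 2 - if m = 0 then 1 else 0 : ℝ) : ℂ) * W m := by
  unfold Lminus singleSite
  by_cases h : m = 0
  · subst h; simp; ring
  · simp [h]; left; ring

/-- Without hopping the sites decouple: the central 2×2 block gives λ² = -p²(2 + p²), every other
site gives λ² = -(1 - p²)². -/
theorem mem_stabilityEigenspace_zero_iff :
    x ∈ stabilityEigenspace (-1) 0 p singleSite lam ↔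
      (-((2 + p ^ 2 : ℝ) : ℂ) * x.1 0 = -lam * x.2 0 ∧ -((p ^ 2 : ℝ) : ℂ) * x.2 0 = lam * x.1 0) ∧
      ∀ m ≠ 0, ((1 - p ^ 2 : ℝ) : ℂ) * x.1 m = -lam * x.2 m ∧
        ((1 - p ^ 2 : ℝ) : ℂ) * x.2 m = lam * x.1 m := by
  change ((∀ m, _ = _) ∧ (∀ m, _ = _)) ↔ _
  simp only [Lplus_zero_singleSite, Lminus_zero_singleSite]
  constructor
  · rintro ⟨h1, h2⟩
    refine ⟨⟨?_, ?_⟩, fun m hm => ⟨?_, ?_⟩⟩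
    · have := h1 0
      push_cast at this ⊢
      linear_combination this
    · have := h2 0
      push_cast at this ⊢
      linear_combination this
    · simpa [hm] using h1 m
    · simpa [hm] using h2 m
  · rintro ⟨⟨h1, h2⟩, h3⟩
    constructor <;> intro m <;> by_cases hm : m = 0
    · subst hm
      push_cast at h1 ⊢
      linear_combination h1
    · simpa [hm] using (h3 m hm).1
    · subst hm
      push_cast at h2 ⊢
      linear_combination h2
    · simpa [hm] using (h3 m hm).2

theorem off_center_eq_zero (h : x ∈ stabilityEigenspace (-1) 0 p singleSite lam)
    (hq : ((1 - p ^ 2 : ℝ) : ℂ) ≠ 0) (hl : ((1 - p ^ 2 : ℝ) : ℂ) ^ 2 + lam ^ 2 ≠ 0) {m : ℤ}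
    (hm : m ≠ 0) : x.1 m = 0 ∧ x.2 m = 0 := by
  obtain ⟨h1, h2⟩ := (mem_stabilityEigenspace_zero_iff.1 h).2 m hm
  have h3 : x.1 m = 0 := by
    refine (mul_eq_zero.1 (?_ : (((1 - p ^ 2 : ℝ) : ℂ) ^ 2 + lam ^ 2) * x.1 m = 0)).resolve_left hl
    linear_combination ((1 - p ^ 2 : ℝ) : ℂ) * h1 - lam * h2
  refine ⟨h3, (mul_eq_zero.1 (?_ : ((1 - p ^ 2 : ℝ) : ℂ) * x.2 m = 0)).resolve_left hq⟩
  rw [h2, h3, mul_zero]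

theorem Ell2.eq_single_of_off {u : Ell2} (h : ∀ m ≠ 0, u m = 0) : u = lp.single 2 0 (u 0) := by
  apply lp.ext
  funext m
  by_cases hm : m = 0
  · subst hm; rw [lp.single_apply_self]
  · rw [lp.single_apply_ne _ _ _ hm, h m hm]

theorem stabilityEigenspace_zero_eq_span (hq : ((1 - p ^ 2 : ℝ) : ℂ) ≠ 0)
    (hl : ((1 - p ^ 2 : ℝ) : ℂ) ^ 2 + lam ^ 2 ≠ 0)
    (hlam : lam ^ 2 = -((p ^ 2 * (2 + p ^ 2) : ℝ) : ℂ)) :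
    stabilityEigenspace (-1) 0 p singleSite lam =
      Submodule.span ℂ {((lp.single 2 0 lam : Ell2), (lp.single 2 0 ((2 + p ^ 2 : ℝ) : ℂ) : Ell2))} := by
  have h2p : ((2 + p ^ 2 : ℝ) : ℂ) ≠ 0 := by
    have : (0 : ℝ) < 2 + p ^ 2 := by positivity
    exact_mod_cast this.ne'
  apply le_antisymm
  · intro x hx
    rw [Submodule.mem_span_singleton]
    have hoff := fun m hm => off_center_eq_zero hx hq hl (m := m) hm
    obtain ⟨h1, -⟩ := (mem_stabilityEigenspace_zero_iff.1 hx).1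
    refine ⟨x.2 0 / ((2 + p ^ 2 : ℝ) : ℂ), ?_⟩
    have e1 := Ell2.eq_single_of_off fun m hm => (hoff m hm).1
    have e2 := Ell2.eq_single_of_off fun m hm => (hoff m hm).2
    refine Prod.ext ?_ ?_
    · change (x.2 0 / ((2 + p ^ 2 : ℝ) : ℂ)) • (lp.single 2 0 lam : Ell2) = x.1
      rw [e1, ← lp.single_smul]
      congr 1
      rw [smul_eq_mul, div_mul_eq_mul_div, div_eq_iff h2p]
      linear_combination h1
    · change (x.2 0 / ((2 + p ^ 2 : ℝ) : ℂ)) • (lp.single 2 0 ((2 + p ^ 2 : ℝ) : ℂ) : Ell2) = x.2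
      conv_rhs => rw [e2]
      rw [← lp.single_smul]
      congr 1
      rw [smul_eq_mul, div_mul_cancel₀ _ h2p]
  · rw [Submodule.span_singleton_le_iff_mem, mem_stabilityEigenspace_zero_iff]
    dsimp only
    refine ⟨⟨?_, ?_⟩, fun m hm => ?_⟩
    · rw [lp.single_apply_self, lp.single_apply_self]; ring
    · rw [lp.single_apply_self, lp.single_apply_self]
      push_cast at hlam ⊢
      linear_combination -hlam
    · rw [lp.single_apply_ne _ _ _ hm, lp.single_apply_ne _ _ _ hm]
      simp

theorem finrank_stabilityEigenspace_zero (hq : ((1 - p ^ 2 : ℝ) : ℂ) ≠ 0)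
    (hl : ((1 - p ^ 2 : ℝ) : ℂ) ^ 2 + lam ^ 2 ≠ 0)
    (hlam : lam ^ 2 = -((p ^ 2 * (2 + p ^ 2) : ℝ) : ℂ)) (h0 : lam ≠ 0) :
    Module.finrank ℂ (stabilityEigenspace (-1) 0 p singleSite lam) = 1 := by
  rw [stabilityEigenspace_zero_eq_span hq hl hlam]
  refine finrank_span_singleton fun h => h0 ?_
  have h1 := congrArg (fun v : Ell2 × Ell2 => v.1 0) h
  simpa using h1

theorem kreinEnergy_neg (hq : ((1 - p ^ 2 : ℝ) : ℂ) ≠ 0)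
    (hl : ((1 - p ^ 2 : ℝ) : ℂ) ^ 2 + lam ^ 2 ≠ 0) (h0 : lam ≠ 0)
    (hx : x ∈ stabilityEigenspace (-1) 0 p singleSite lam) (hne : x ≠ 0) :
    kreinEnergy (-1) 0 p singleSite x.1 < 0 := by
  have hoff := fun m hm => off_center_eq_zero hx hq hl (m := m) hm
  obtain ⟨h1, -⟩ := (mem_stabilityEigenspace_zero_iff.1 hx).1
  have hU : x.1 0 ≠ 0 := by
    intro hU
    rw [hU, mul_zero] at h1
    have hW : x.2 0 = 0 := by
      have : lam * x.2 0 = 0 := by linear_combination h1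
      exact (mul_eq_zero.1 this).resolve_left h0
    refine hne (Prod.ext ?_ ?_)
    · rw [Ell2.eq_single_of_off fun m hm => (hoff m hm).1, hU, lp.single_zero]; rfl
    · rw [Ell2.eq_single_of_off fun m hm => (hoff m hm).2, hW, lp.single_zero]; rfl
  unfold kreinEnergy
  rw [tsum_eq_single 0 (fun m hm => by rw [(hoff m hm).1]; simp)]
  rw [Lplus_zero_singleSite, mul_assoc, Complex.mul_conj, Complex.normSq_eq_norm_sq,
    ← Complex.ofReal_mul, Complex.ofReal_re, if_pos rfl]
  have : 0 < ‖x.1 0‖ ^ 2 := by have := norm_pos_iff.2 hU; positivity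
  nlinarith [sq_nonneg p]

theorem center_eq_zero (hx : x ∈ stabilityEigenspace (-1) 0 p singleSite lam)
    (hp : ((p ^ 2 : ℝ) : ℂ) ≠ 0) (hl : lam ^ 2 + ((p ^ 2 * (2 + p ^ 2) : ℝ) : ℂ) ≠ 0) :
    x.1 0 = 0 ∧ x.2 0 = 0 := by
  obtain ⟨h1, h2⟩ := (mem_stabilityEigenspace_zero_iff.1 hx).1
  have h3 : x.1 0 = 0 := by
    refine (mul_eq_zero.1 (?_ : (lam ^ 2 + ((p ^ 2 * (2 + p ^ 2) : ℝ) : ℂ)) * x.1 0 = 0)).resolve_left hl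
    push_cast at h1 h2 ⊢
    linear_combination -(p : ℂ) ^ 2 * h1 - lam * h2
  refine ⟨h3, ?_⟩
  rw [h3, mul_zero, neg_mul, neg_eq_zero] at h2
  exact (mul_eq_zero.1 h2).resolve_left hp

theorem kreinEnergy_pos (hq : 0 < 1 - p ^ 2) (hp : ((p ^ 2 : ℝ) : ℂ) ≠ 0)
    (hl : lam ^ 2 + ((p ^ 2 * (2 + p ^ 2) : ℝ) : ℂ) ≠ 0)
    (hx : x ∈ stabilityEigenspace (-1) 0 p singleSite lam) (hne : x ≠ 0) :
    0 < kreinEnergy (-1) 0 p singleSite x.1 := by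
  obtain ⟨hU, hW⟩ := center_eq_zero hx hp hl
  have hqc : ((1 - p ^ 2 : ℝ) : ℂ) ≠ 0 := by exact_mod_cast hq.ne'
  have hterm : ∀ m, (Lplus (-1) 0 p singleSite x.1 m * conj (x.1 m)).re
      = (1 - p ^ 2) * ‖x.1 m‖ ^ 2 := fun m => by
    rw [Lplus_zero_singleSite, mul_assoc, Complex.mul_conj, Complex.normSq_eq_norm_sq,
      ← Complex.ofReal_mul, Complex.ofReal_re]
    by_cases hm : m = 0
    · subst hm; rw [hU]; simp
    · rw [if_neg hm, sub_zero]
  unfold kreinEnergy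
  simp only [hterm]
  rw [tsum_mul_left]
  refine mul_pos hq ?_
  have hsum : Summable fun m => ‖x.1 m‖ ^ 2 := by
    have := (lp.memℓp x.1).summable (by norm_num)
    simpa using this
  have hex : ∃ m, x.1 m ≠ 0 := by
    by_contra hc
    push Not at hc
    refine hne (Prod.ext (lp.ext (funext fun m => hc m)) (lp.ext (funext fun m => ?_)))
    by_cases hm : m = 0
    · subst hm; exact hW
    · obtain ⟨-, h2⟩ := (mem_stabilityEigenspace_zero_iff.1 hx).2 m hm
      rw [hc m, mul_zero] at h2
      exact (mul_eq_zero.1 h2).resolve_left hqc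
  obtain ⟨m, hm⟩ := hex
  exact hsum.tsum_pos (fun _ => by positivity) m (by have := norm_pos_iff.2 hm; positivity)

/-- Each site j + 1 ≥ 1 carries its own eigenvector, with U = δ and W = iδ at that site. -/
theorem not_finiteDimensional_stabilityEigenspace_zero :
    ¬ FiniteDimensional ℂ (stabilityEigenspace (-1) 0 p singleSite
      (Complex.I * ((1 - p ^ 2 : ℝ) : ℂ))) := by
  intro hfd
  have hI := Complex.I_mul_I
  let v : ℕ → stabilityEigenspace (-1) 0 p singleSite (Complex.I * ((1 - p ^ 2 : ℝ) : ℂ)) :=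
    fun j => ⟨((lp.single 2 ((j : ℤ) + 1) 1 : Ell2), Complex.I • (lp.single 2 ((j : ℤ) + 1) 1 : Ell2)), by
      rw [mem_stabilityEigenspace_zero_iff]
      dsimp only
      have hs : ∀ m, (Complex.I • (lp.single 2 ((j : ℤ) + 1) 1 : Ell2)) m =
        Complex.I * (lp.single 2 ((j : ℤ) + 1) 1 : Ell2) m := fun m => rfl
      refine ⟨?_, fun m _ => ⟨?_, ?_⟩⟩
      · have : (0 : ℤ) ≠ (j : ℤ) + 1 := by omega
        rw [hs, lp.single_apply_ne _ _ _ this]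
        simp
      · rw [hs]
        linear_combination ((1 - p ^ 2 : ℝ) : ℂ) * (lp.single 2 ((j : ℤ) + 1) 1 : Ell2) m * hI
      · rw [hs]
        ring⟩
  have hv : LinearIndependent ℂ v := by
    rw [linearIndependent_iff']
    intro s g hg i hi
    have h1 := congrArg (fun y => ((lp.evalCLM ℂ (fun _ : ℤ => ℂ) 2 ((i : ℤ) + 1)).toLinearMap.comp
      ((LinearMap.fst ℂ Ell2 Ell2).comp (Submodule.subtype _))) y) hg
    simp only [map_sum, map_smul, map_zero] at h1
    rw [Finset.sum_eq_single i] at h1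
    · have h2 : (lp.single 2 ((i : ℤ) + 1) 1 : Ell2) ((i : ℤ) + 1) = 1 := lp.single_apply_self _ _ _
      change g i * (lp.single 2 ((i : ℤ) + 1) 1 : Ell2) ((i : ℤ) + 1) = 0 at h1
      rwa [h2, mul_one] at h1
    · intro j _ hj
      have h2 : (lp.single 2 ((j : ℤ) + 1) 1 : Ell2) ((i : ℤ) + 1) = 0 :=
        lp.single_apply_ne _ _ _ (by omega)
      change g j * (lp.single 2 ((j : ℤ) + 1) 1 : Ell2) ((i : ℤ) + 1) = 0
      rw [h2, mul_zero]
    · intro h; exact absurd hi h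
  exact not_finite_iff_infinite.2 (inferInstance : Infinite ℕ) hv.finite

/-- Both sides are nonnegative, and the difference of their squares is 1 - 4p² up to sign. -/
theorem resonance_iff (hp : |p| < 1) : |p| * √(2 + p ^ 2) = 1 - p ^ 2 ↔ |p| = 1 / 2 := by
  have h0 := abs_nonneg p
  have h2 : p ^ 2 = |p| ^ 2 := (sq_abs p).symm
  have hq : 0 ≤ 1 - p ^ 2 := by rw [h2]; nlinarith
  have h3 : (|p| * √(2 + p ^ 2)) ^ 2 = p ^ 2 * (2 + p ^ 2) := by
    rw [mul_pow, Real.sq_sqrt (by positivity), sq_abs]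
  rw [← sq_eq_sq₀ (by positivity) hq, h3]
  constructor
  · intro h
    have : |p| ^ 2 = (1 / 2) ^ 2 := by rw [← h2]; linarith
    exact (sq_eq_sq₀ h0 (by norm_num)).1 this
  · intro h
    rw [h2, h]; norm_num

/-- The spectrum at the anti-continuum limit. -/
theorem antiContinuum_spectrum (p : ℝ) (hp0 : 0 < |p|) (hp1 : |p| < 1) :
    (|p| ≠ 1 / 2 →
      Module.finrank ℂ (stabilityEigenspace (-1) 0 p singleSite
        (Complex.I * ((|p| * Real.sqrt (2 + p ^ 2) : ℝ) : ℂ))) = 1 ∧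
      (∀ x ∈ stabilityEigenspace (-1) 0 p singleSite
        (Complex.I * ((|p| * Real.sqrt (2 + p ^ 2) : ℝ) : ℂ)),
        x ≠ 0 → kreinEnergy (-1) 0 p singleSite x.1 < 0) ∧
      ¬ FiniteDimensional ℂ (stabilityEigenspace (-1) 0 p singleSite
        (Complex.I * ((1 - p ^ 2 : ℝ) : ℂ))) ∧
      (∀ x ∈ stabilityEigenspace (-1) 0 p singleSite (Complex.I * ((1 - p ^ 2 : ℝ) : ℂ)),
        x ≠ 0 → 0 < kreinEnergy (-1) 0 p singleSite x.1)) ∧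
    (|p| * Real.sqrt (2 + p ^ 2) = 1 - p ^ 2 ↔ |p| = 1 / 2) := by
  refine ⟨fun hne => ?_, resonance_iff hp1⟩
  have h2 : p ^ 2 = |p| ^ 2 := (sq_abs p).symm
  have hq : 0 < 1 - p ^ 2 := by rw [h2]; nlinarith
  have hqc : ((1 - p ^ 2 : ℝ) : ℂ) ≠ 0 := by exact_mod_cast hq.ne'
  have hpc : ((p ^ 2 : ℝ) : ℂ) ≠ 0 := by
    have : 0 < p ^ 2 := by rw [h2]; positivity
    exact_mod_cast this.ne'
  have hI := Complex.I_sq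
  have hk : (Complex.I * ((|p| * √(2 + p ^ 2) : ℝ) : ℂ)) ^ 2
      = -((p ^ 2 * (2 + p ^ 2) : ℝ) : ℂ) := by
    rw [mul_pow, hI, ← Complex.ofReal_pow, mul_pow, Real.sq_sqrt (by positivity), sq_abs]
    ring
  have hdiff : (1 - p ^ 2) ^ 2 - p ^ 2 * (2 + p ^ 2) ≠ 0 := by
    intro h
    refine hne ((sq_eq_sq₀ (abs_nonneg p) (by norm_num)).1 ?_)
    rw [← h2]
    linarith
  have hl : ((1 - p ^ 2 : ℝ) : ℂ) ^ 2 + (Complex.I * ((|p| * √(2 + p ^ 2) : ℝ) : ℂ)) ^ 2 ≠ 0 := by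
    rw [hk]
    intro h
    exact hdiff (by exact_mod_cast (by push_cast at h ⊢; linear_combination h :
      (((1 - p ^ 2) ^ 2 - p ^ 2 * (2 + p ^ 2) : ℝ) : ℂ) = 0))
  have hl' : (Complex.I * ((1 - p ^ 2 : ℝ) : ℂ)) ^ 2 + ((p ^ 2 * (2 + p ^ 2) : ℝ) : ℂ) ≠ 0 := by
    rw [mul_pow, hI]
    intro h
    exact hdiff (by exact_mod_cast (by push_cast at h ⊢; linear_combination -h :
      (((1 - p ^ 2) ^ 2 - p ^ 2 * (2 + p ^ 2) : ℝ) : ℂ) = 0))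
  have h0 : Complex.I * ((|p| * √(2 + p ^ 2) : ℝ) : ℂ) ≠ 0 := by
    have : 0 < |p| * √(2 + p ^ 2) := by positivity
    exact mul_ne_zero Complex.I_ne_zero (by exact_mod_cast this.ne')
  exact ⟨finrank_stabilityEigenspace_zero hqc hl hk h0,
    fun x hx hne => kreinEnergy_neg hqc hl h0 hx hne,
    not_finiteDimensional_stabilityEigenspace_zero,
    fun x hx hne => kreinEnergy_pos hq hpc hl' hx hne⟩

end AntiContinuum

/-! ### Zeros of perturbations of the limiting quadratic. -/

/-- A holomorphic function which is smaller at the centre of a disc than on its boundary has a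
zero in the disc. -/
theorem exists_zero_of_norm_lt {f : ℂ → ℂ} {c : ℂ} {r C : ℝ} (hr : 0 < r)
    (hf : ∀ z ∈ Metric.closedBall c r, DifferentiableAt ℂ f z)
    (hb : ∀ z ∈ Metric.sphere c r, C ≤ ‖f z‖) (hc : ‖f c‖ < C) :
    ∃ z ∈ Metric.closedBall c r, f z = 0 := by
  by_contra hcon
  push Not at hcon
  have hC : 0 < C := (norm_nonneg _).trans_lt hc
  -- Without a zero the reciprocal is holomorphic, and the maximum principle bounds it at the centre
  -- by its boundary values.
  have hd : DiffContOnCl ℂ (fun z => (f z)⁻¹) (Metric.ball c r) := by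
    refine DifferentiableOn.diffContOnCl fun z hz => ?_
    rw [closure_ball c hr.ne'] at hz
    exact ((hf z hz).inv (hcon z hz)).differentiableWithinAt
  have h := Complex.norm_le_of_forall_mem_frontier_norm_le Metric.isBounded_ball hd (C := C⁻¹)
    (fun z hz => by
      rw [frontier_ball c hr.ne'] at hz
      rw [norm_inv]
      exact inv_anti₀ hC (hb z hz)) (subset_closure (Metric.mem_ball_self hr))
  rw [norm_inv] at h
  have h1 : 0 < ‖f c‖ := norm_pos_iff.2 (hcon c (Metric.mem_closedBall_self hr.le))
  exact absurd ((inv_le_inv₀ h1 hC).1 h) (not_le.2 hc)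

/-- The discriminant `15 - 4 (1 - 2 δ)²` of the limiting characteristic polynomial. -/
noncomputable def resonanceDisc (δ : ℝ) : ℝ := 15 - 4 * (1 - 2 * δ) ^ 2

/-- The root in the lower half plane of the limiting characteristic polynomial. -/
noncomputable def resonanceRoot (δ : ℝ) : ℂ := ⟨2 * (1 - 2 * δ) / 5, -(√(resonanceDisc δ) / 5)⟩

theorem resonancePoly_eq {δ : ℝ} (hδ : 0 ≤ resonanceDisc δ) (z : ℂ) :
    resonancePoly (z, (δ : ℂ)) = 5 * ((z - resonanceRoot δ) * (z - conj (resonanceRoot δ))) := by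
  have h : ((√(resonanceDisc δ) : ℝ) : ℂ) ^ 2 = 15 - 4 * (1 - 2 * δ) ^ 2 := by
    rw [← Complex.ofReal_pow, Real.sq_sqrt hδ, resonanceDisc]; push_cast; ring
  have h1 : resonanceRoot δ = ((2 * (1 - 2 * δ) / 5 : ℝ) : ℂ)
      - ((√(resonanceDisc δ) / 5 : ℝ) : ℂ) * Complex.I := by
    apply Complex.ext <;> simp [resonanceRoot]
  rw [h1]
  simp only [map_sub, map_mul, Complex.conj_ofReal, Complex.conj_I]
  unfold resonancePoly
  push_cast
  linear_combination (-(1 / 5 : ℂ)) * h + ((√(resonanceDisc δ) : ℝ) : ℂ) ^ 2 / 5 * Complex.I_sq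

theorem norm_sq_resonanceRoot {δ : ℝ} (hδ : 0 ≤ resonanceDisc δ) :
    ‖resonanceRoot δ‖ ^ 2 = 3 / 5 := by
  rw [← Complex.normSq_eq_norm_sq, Complex.normSq_apply]
  simp only [resonanceRoot]
  have := Real.sq_sqrt hδ
  unfold resonanceDisc at *
  nlinarith

/-- Only existence is claimed, with a tolerance that does not degrade as the two limiting roots
merge; this allows wavenumbers up to the edges of the interval. -/
theorem exists_zero_near_resonance {F : ℂ × ℂ → ℂ} {κ δ : ℝ}
    (hF : DifferentiableOn ℂ F evansDomain)
    (hκ : ∀ x ∈ evansDomain, ‖F x - resonancePoly x‖ ≤ κ) (hκ' : κ ≤ 1 / 100)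
    (hδ : |δ| < 100) (hG : 0 ≤ resonanceDisc δ) :
    ∃ z, (z, (δ : ℂ)) ∈ evansDomain ∧ F (z, δ) = 0 := by
  have hdisc : ∀ (c : ℂ) (r C : ℝ), 0 < r → 1 / 100 < ‖c‖ - r → ‖c‖ + r < 99 / 100 →
      (∀ z ∈ Metric.sphere c r, C + κ ≤ ‖resonancePoly (z, (δ : ℂ))‖) →
      ‖resonancePoly (c, (δ : ℂ))‖ + κ < C → ∃ z, (z, (δ : ℂ)) ∈ evansDomain ∧ F (z, δ) = 0 := by
    intro c r C hr h1 h2 h3 h4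
    have hdom : ∀ z ∈ Metric.closedBall c r, (z, (δ : ℂ)) ∈ evansDomain := fun z hz => by
      rw [mem_closedBall_iff_norm] at hz
      have k1 := norm_sub_norm_le c z
      have k2 := norm_sub_norm_le z c
      rw [norm_sub_rev] at k1
      refine ⟨by dsimp only; linarith, by dsimp only; linarith, ?_⟩
      dsimp only
      rw [Complex.norm_real]
      exact hδ
    obtain ⟨z, hz, hz0⟩ := exists_zero_of_norm_lt (f := fun z => F (z, (δ : ℂ))) (C := C) hr
      (fun z hz => by
        have hd : DifferentiableAt ℂ F (z, (δ : ℂ)) :=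
          hF.differentiableAt (isOpen_evansDomain.mem_nhds (hdom z hz))
        exact DifferentiableAt.comp z hd (differentiableAt_id.prodMk (differentiableAt_const _)))
      (fun z hz => by
        have k1 := hκ _ (hdom z (Metric.sphere_subset_closedBall hz))
        have k2 := norm_sub_norm_le (resonancePoly (z, (δ : ℂ))) (F (z, (δ : ℂ)))
        rw [norm_sub_rev] at k2
        linarith [h3 z hz])
      (by
        have k1 := hκ _ (hdom c (Metric.mem_closedBall_self hr.le))
        have k2 := norm_sub_norm_le (F (c, (δ : ℂ))) (resonancePoly (c, (δ : ℂ)))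
        linarith)
    exact ⟨z, hdom z hz, hz0⟩
  set h : ℝ := √(resonanceDisc δ) / 5 with hh
  have hh0 : 0 ≤ h := by positivity
  set m : ℝ := 2 * (1 - 2 * δ) / 5 with hm
  have hmh : m ^ 2 + h ^ 2 = 3 / 5 := by
    rw [hm, hh, div_pow (√_), Real.sq_sqrt hG, resonanceDisc]; ring
  have hroot : resonanceRoot δ = ((m : ℝ) : ℂ) - (h : ℂ) * Complex.I := by
    apply Complex.ext <;> simp [resonanceRoot, hm, hh]
  have hroot' : conj (resonanceRoot δ) = ((m : ℝ) : ℂ) + (h : ℂ) * Complex.I := by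
    rw [hroot]; simp
  have nhI : ‖(h : ℂ) * Complex.I‖ = h := by
    rw [norm_mul, Complex.norm_I, mul_one, Complex.norm_of_nonneg hh0]
  have n5 : ‖(5 : ℂ)‖ = 5 := Complex.norm_ofNat 5
  -- The limiting roots are m ± ih. When they nearly coincide, a disc around the midpoint contains
  -- both; otherwise a disc around the lower root stays away from the other one.
  rcases le_or_gt h (1 / 10) with hsmall | hlarge
  · have hm1 : |m| ≤ 78 / 100 := by
      refine abs_le_of_sq_le_sq ?_ (by norm_num)
      nlinarith
    have hm2 : 76 / 100 ≤ |m| := by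
      refine le_of_sq_le_sq ?_ (abs_nonneg m)
      rw [sq_abs]
      nlinarith
    have nm : ‖(m : ℂ)‖ = |m| := by rw [Complex.norm_real, Real.norm_eq_abs]
    have hpoly : ∀ z : ℂ, resonancePoly (z, (δ : ℂ)) = 5 * ((z - m) ^ 2 + ((h ^ 2 : ℝ) : ℂ)) := by
      intro z
      rw [resonancePoly_eq hG, hroot', hroot]
      push_cast
      linear_combination -5 * (h : ℂ) ^ 2 * Complex.I_sq
    have nh2 : ‖((h ^ 2 : ℝ) : ℂ)‖ ≤ 1 / 100 := by
      rw [Complex.norm_of_nonneg (sq_nonneg h)]; nlinarith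
    refine hdisc m (2 / 10) (13 / 100) (by norm_num) (by rw [nm]; linarith) (by rw [nm]; linarith)
      (fun z hz => ?_) ?_
    · rw [mem_sphere_iff_norm] at hz
      rw [hpoly, norm_mul, n5]
      have k := norm_sub_norm_le ((z - m) ^ 2) (-((h ^ 2 : ℝ) : ℂ))
      rw [norm_neg, sub_neg_eq_add, norm_pow, hz] at k
      linarith
    · rw [hpoly, norm_mul, n5, sub_self]
      have : ‖(0 : ℂ) ^ 2 + ((h ^ 2 : ℝ) : ℂ)‖ ≤ 1 / 100 := by simpa using nh2
      linarith
  · have nr := norm_sq_resonanceRoot hG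
    have nr0 := norm_nonneg (resonanceRoot δ)
    refine hdisc (resonanceRoot δ) (1 / 10) (3 / 100) (by norm_num) (by nlinarith) (by nlinarith)
      (fun z hz => ?_) ?_
    · rw [mem_sphere_iff_norm] at hz
      rw [resonancePoly_eq hG, norm_mul, norm_mul, n5, hz]
      have k : 2 * h - 1 / 10 ≤ ‖z - conj (resonanceRoot δ)‖ := by
        have e : z - conj (resonanceRoot δ)
            = (z - resonanceRoot δ) - (2 : ℂ) * ((h : ℂ) * Complex.I) := by
          rw [hroot', hroot]; ring
        have k1 := norm_sub_norm_le ((2 : ℂ) * ((h : ℂ) * Complex.I)) (z - resonanceRoot δ)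
        rw [norm_mul, nhI, Complex.norm_ofNat, hz, norm_sub_rev, ← e] at k1
        exact k1
      linarith
    · rw [resonancePoly_eq hG, sub_self, zero_mul, mul_zero, norm_zero]
      linarith

/-- On the real axis the polynomial is a completed square plus a fifth of the discriminant. It
serves to exclude real zeros of F. -/
theorem resonanceDisc_div_le_norm {δ : ℝ} (hG : 0 ≤ resonanceDisc δ) {z : ℂ} (hz : z.im = 0) :
    resonanceDisc δ / 5 ≤ ‖resonancePoly (z, (δ : ℂ))‖ := by
  have hz' : z = (z.re : ℂ) := by apply Complex.ext <;> simp [hz]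
  set t := z.re
  have : resonancePoly (z, (δ : ℂ)) =
      ((5 * (t - 2 * (1 - 2 * δ) / 5) ^ 2 + resonanceDisc δ / 5 : ℝ) : ℂ) := by
    rw [hz', resonancePoly, resonanceDisc]; push_cast; ring
  rw [this, Complex.norm_of_nonneg (by positivity)]
  nlinarith [sq_nonneg (t - 2 * (1 - 2 * δ) / 5)]

/-- A zero in the lower half plane is close to the root of the limiting polynomial. -/
theorem norm_sub_resonanceRoot_le {δ κ : ℝ} (hG : 0 < resonanceDisc δ) {z : ℂ} (hz : z.im < 0)
    (h : ‖resonancePoly (z, (δ : ℂ))‖ ≤ κ) : ‖z - resonanceRoot δ‖ ≤ κ / √(resonanceDisc δ) := by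
  rw [resonancePoly_eq hG.le, norm_mul, norm_mul, Complex.norm_ofNat] at h
  have hs := Real.sqrt_pos.2 hG
  -- A point of the lower half plane is separated from the upper root by at least the height of that
  -- root, so only the lower factor can be small.
  have k : √(resonanceDisc δ) / 5 ≤ ‖z - conj (resonanceRoot δ)‖ := by
    refine le_trans ?_ (Complex.abs_im_le_norm _)
    rw [Complex.sub_im, Complex.conj_im]
    simp only [resonanceRoot]
    rw [abs_of_nonpos (by linarith)]
    linarith
  rw [le_div_iff₀ hs]
  have := mul_le_mul_of_nonneg_left k (norm_nonneg (z - resonanceRoot δ))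
  linarith

/-! ### Spectral symmetries and the growth rate in terms of z. -/

section Symmetry

variable {ε p : ℝ} {ψ : ℤ → ℝ} {ν : ℂ}

/-- Changing the sign of W reverses λ. -/
theorem IsStabilityEigenvalue.neg (h : IsStabilityEigenvalue (-1) ε p ψ ν) :
    IsStabilityEigenvalue (-1) ε p ψ (-ν) := by
  obtain ⟨⟨U, W⟩, ⟨h1, h2⟩, hne⟩ := (Submodule.ne_bot_iff _).1 h
  refine (Submodule.ne_bot_iff _).2 ⟨(U, -W), ⟨fun m => ?_, fun m => ?_⟩, fun h0 => hne ?_⟩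
  · change _ = - -ν * -(W m)
    rw [show - -ν * -(W m) = -ν * W m by ring]
    exact h1 m
  · have := h2 m
    change Lminus (-1) ε p ψ (fun m => -(W m)) m = -ν * U m
    simp only [Lminus] at this ⊢
    linear_combination -this
  · rw [Prod.mk_eq_zero] at h0 ⊢
    exact ⟨h0.1, neg_eq_zero.1 h0.2⟩

theorem IsStabilityEigenvalue.conj (h : IsStabilityEigenvalue (-1) ε p ψ ν) :
    IsStabilityEigenvalue (-1) ε p ψ (conj ν) := by
  obtain ⟨⟨U, W⟩, ⟨h1, h2⟩, hne⟩ := (Submodule.ne_bot_iff _).1 h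
  refine (Submodule.ne_bot_iff _).2 ⟨(star U, star W), ⟨fun m => ?_, fun m => ?_⟩, fun h0 => hne ?_⟩
  · have := congrArg (starRingEnd ℂ) (h1 m)
    change Lplus (-1) ε p ψ (fun m => starRingEnd ℂ (U m)) m = -(starRingEnd ℂ ν) * starRingEnd ℂ (W m)
    simp only [Lplus, map_sub, map_add, map_mul, map_neg, map_pow, Complex.conj_ofReal, map_one,
      map_ofNat] at this ⊢
    exact this
  · have := congrArg (starRingEnd ℂ) (h2 m)
    change Lminus (-1) ε p ψ (fun m => starRingEnd ℂ (W m)) m = starRingEnd ℂ ν * starRingEnd ℂ (U m)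
    simp only [Lminus, map_sub, map_add, map_mul, map_neg, map_pow, Complex.conj_ofReal, map_one,
      map_ofNat] at this ⊢
    exact this
  · rw [Prod.mk_eq_zero] at h0 ⊢
    exact ⟨star_eq_zero.1 h0.1, star_eq_zero.1 h0.2⟩

end Symmetry

/-- The eigenvalue with spectral parameter `z`, at the scaled wavenumber `δ`. -/
noncomputable def resonantValue (ε δ : ℝ) (z : ℂ) : ℂ :=
  Complex.I * (3 / 4 + ε * (2 - z - z⁻¹ - δ))

/-- Inside the unit disc the bracket is positive, so the growing modes are those with z in the lower
half plane. -/
theorem im_add_inv (z : ℂ) : (z + z⁻¹).im = -(z.im * ((‖z‖ ^ 2)⁻¹ - 1)) := by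
  rw [Complex.add_im, Complex.inv_im, Complex.normSq_eq_norm_sq]
  ring

theorem resonantValue_re (ε δ : ℝ) (z : ℂ) : (resonantValue ε δ z).re = ε * (z + z⁻¹).im := by
  unfold resonantValue
  simp only [Complex.mul_re, Complex.I_re, Complex.I_im, Complex.add_im, Complex.mul_im,
    Complex.sub_im, Complex.ofReal_re, Complex.ofReal_im, zero_mul, one_mul, Complex.im_ofNat]
  have : (3 / 4 : ℂ).im = 0 := by simp
  rw [this]
  ring

theorem norm_resonantValue_sub_le {ε δ : ℝ} (hε : 0 < ε) {z : ℂ}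
    (hz : (z, (δ : ℂ)) ∈ evansDomain) : ‖resonantValue ε δ z - 3 / 4 * Complex.I‖ ≤ 203 * ε := by
  obtain ⟨h1, h2, h3⟩ := hz
  dsimp only at h1 h2 h3
  have h4 : ‖z⁻¹‖ ≤ 100 := by
    rw [norm_inv, inv_le_comm₀ (by linarith) (by norm_num)]
    linarith
  have e : resonantValue ε δ z - 3 / 4 * Complex.I = Complex.I * (ε * (2 - z - z⁻¹ - δ)) := by
    unfold resonantValue; ring
  rw [e, norm_mul, norm_mul, Complex.norm_I, Complex.norm_of_nonneg hε.le, one_mul, mul_comm]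
  gcongr
  have h6 : ‖(2 : ℂ)‖ = 2 := Complex.norm_ofNat 2
  linarith [norm_sub_le (2 - z - z⁻¹) (δ : ℂ), norm_sub_le (2 - z) z⁻¹, norm_sub_le 2 z]

theorem norm_resonantValue_sub_resonantValue_le {ε δ : ℝ} (hε : 0 < ε) {z w : ℂ}
    (hz : 1 / 100 ≤ ‖z‖) (hw : 1 / 2 ≤ ‖w‖) :
    ‖resonantValue ε δ z - resonantValue ε δ w‖ ≤ 201 * ε * ‖z - w‖ := by
  have z0 : z ≠ 0 := by rw [← norm_pos_iff]; linarith
  have w0 : w ≠ 0 := by rw [← norm_pos_iff]; linarith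
  have e : resonantValue ε δ z - resonantValue ε δ w
      = Complex.I * (ε * ((z - w) * (z⁻¹ * w⁻¹ - 1))) := by
    unfold resonantValue; field_simp; ring
  rw [e, norm_mul, norm_mul, norm_mul, Complex.norm_I, Complex.norm_of_nonneg hε.le, one_mul]
  have h1 : ‖z⁻¹‖ ≤ 100 := by
    rw [norm_inv, inv_le_comm₀ (by linarith) (by norm_num)]
    linarith
  have h2 : ‖w⁻¹‖ ≤ 2 := by
    rw [norm_inv, inv_le_comm₀ (by linarith) (by norm_num)]
    linarith
  have h3 : ‖z⁻¹ * w⁻¹ - 1‖ ≤ 201 := by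
    refine (norm_sub_le _ _).trans ?_
    rw [norm_mul, norm_one]
    nlinarith [norm_nonneg (z⁻¹), norm_nonneg (w⁻¹)]
  calc ε * (‖z - w‖ * ‖z⁻¹ * w⁻¹ - 1‖) ≤ ε * (‖z - w‖ * 201) := by gcongr
    _ = _ := by ring

/-- The quadratic relation gives z⁻¹ = (4(1 - 2δ) - 5z)/3 at a root, so the eigenvalue is affine in
the root. -/
theorem leadingEigenvalue_eq (ε : ℝ) {δ : ℝ} (hG : 0 ≤ resonanceDisc δ) :
    leadingEigenvalue ε δ = resonantValue ε δ (resonanceRoot δ) := by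
  have h0 : resonanceRoot δ ≠ 0 := by
    intro h
    have := norm_sq_resonanceRoot hG
    rw [h] at this
    norm_num at this
  have h1 := resonancePoly_eq hG (resonanceRoot δ)
  rw [sub_self, zero_mul, mul_zero, resonancePoly] at h1
  simp only at h1
  have h2 : (resonanceRoot δ)⁻¹ = (4 * (1 - 2 * δ) - 5 * resonanceRoot δ) / 3 := by
    refine inv_eq_of_mul_eq_one_right ?_
    linear_combination -h1 / 3
  unfold resonantValue leadingEigenvalue
  rw [h2]
  have h3 : resonanceRoot δ = ((2 * (1 - 2 * δ) / 5 : ℝ) : ℂ)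
      - ((√(resonanceDisc δ) / 5 : ℝ) : ℂ) * Complex.I := by
    apply Complex.ext <;> simp [resonanceRoot]
  rw [h3]
  unfold resonanceDisc
  push_cast
  linear_combination (2 / 15 * (ε : ℂ) * (√(15 - 4 * (1 - 2 * δ) ^ 2) : ℝ)) * Complex.I_sq

/-! ### A holomorphic branch of zeros by Newton iteration. -/

section Branch

variable {F : ℂ × ℂ → ℂ} {κ : ℝ}

/-- The double-frequency root at `δ = 1 / 2`. -/
noncomputable def centralRoot : ℂ := -(Complex.I * (√(3 / 5) : ℝ))

theorem centralRoot_sq : centralRoot ^ 2 = -(3 / 5) := by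
  have h : ((√(3 / 5) : ℝ) : ℂ) ^ 2 = 3 / 5 := by
    rw [← Complex.ofReal_pow, Real.sq_sqrt (by norm_num)]; push_cast; rfl
  unfold centralRoot
  linear_combination ((√(3 / 5) : ℝ) : ℂ) ^ 2 * Complex.I_sq - h

theorem sqrt_three_fifths_bounds : 774 / 1000 ≤ √(3 / 5 : ℝ) ∧ √(3 / 5 : ℝ) ≤ 775 / 1000 :=
  ⟨Real.le_sqrt_of_sq_le (by norm_num), Real.sqrt_le_iff.2 ⟨by norm_num, by norm_num⟩⟩

theorem norm_centralRoot : ‖centralRoot‖ = √(3 / 5) := by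
  unfold centralRoot
  rw [norm_neg, norm_mul, Complex.norm_I, one_mul, Complex.norm_of_nonneg (Real.sqrt_nonneg _)]

theorem mem_evansDomain_of_near {z δ : ℂ} (hz : ‖z - centralRoot‖ ≤ 2 / 10)
    (hδ : ‖δ - 1 / 2‖ < 1 / 20) : (z, δ) ∈ evansDomain := by
  obtain ⟨s1, s2⟩ := sqrt_three_fifths_bounds
  have k1 := norm_sub_norm_le centralRoot z
  have k2 := norm_sub_norm_le z centralRoot
  rw [norm_sub_rev, norm_centralRoot] at k1
  rw [norm_centralRoot] at k2
  have k3 := norm_sub_norm_le δ (1 / 2)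
  have k4 : ‖(1 / 2 : ℂ)‖ = 1 / 2 := by simp
  refine ⟨?_, ?_, ?_⟩ <;> dsimp only <;> linarith

/-- The remainder of the characteristic function is Lipschitz near the central root. -/
theorem norm_remainder_sub_le (hF : DifferentiableOn ℂ F evansDomain)
    (hκ : ∀ x ∈ evansDomain, ‖F x - resonancePoly x‖ ≤ κ) {z w δ : ℂ}
    (hz : ‖z - centralRoot‖ ≤ 1 / 10) (hw : ‖w - centralRoot‖ ≤ 1 / 10)
    (hδ : ‖δ - 1 / 2‖ < 1 / 20) :
    ‖(F (z, δ) - resonancePoly (z, δ)) - (F (w, δ) - resonancePoly (w, δ))‖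
      ≤ 20 * κ * ‖z - w‖ := by
  set R : ℂ → ℂ := fun z => F (z, δ) - resonancePoly (z, δ) with hR
  have hd : ∀ z, ‖z - centralRoot‖ ≤ 2 / 10 → DifferentiableAt ℂ R z := fun z hz => by
    have h1 : DifferentiableAt ℂ F (z, δ) :=
      hF.differentiableAt (isOpen_evansDomain.mem_nhds (mem_evansDomain_of_near hz hδ))
    have h2 : DifferentiableAt ℂ (fun z => F (z, δ)) z :=
      DifferentiableAt.comp z h1 (differentiableAt_id.prodMk (differentiableAt_const _))
    refine h2.sub ?_
    unfold resonancePoly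
    fun_prop
  have hderiv : ∀ z ∈ Metric.closedBall centralRoot (1 / 10), ‖deriv R z‖ ≤ 20 * κ := by
    intro z hz
    rw [mem_closedBall_iff_norm] at hz
    have hsub : ∀ y, ‖y - z‖ ≤ 1 / 20 → ‖y - centralRoot‖ ≤ 2 / 10 := fun y hy => by
      have := norm_add_le (y - z) (z - centralRoot)
      rw [sub_add_sub_cancel] at this
      linarith
    have := Complex.norm_deriv_le_of_forall_mem_sphere_norm_le (f := R) (c := z) (R := 1 / 20)
      (C := κ) (by norm_num)
      (DifferentiableOn.diffContOnCl fun y hy => by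
        rw [closure_ball z (by norm_num)] at hy
        exact (hd y (hsub y (mem_closedBall_iff_norm.1 hy))).differentiableWithinAt)
      (fun y hy => hκ _ (mem_evansDomain_of_near (hsub y (mem_sphere_iff_norm.1 hy).le) hδ))
    linarith
  have := (convex_closedBall centralRoot (1 / 10 : ℝ)).norm_image_sub_le_of_norm_deriv_le
    (f := R) (fun y hy => hd y (by rw [mem_closedBall_iff_norm] at hy; linarith)) hderiv
    (mem_closedBall_iff_norm.2 hw) (mem_closedBall_iff_norm.2 hz)
  exact this

/-- The Newton map whose fixed points are the zeros of the characteristic function. -/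
noncomputable def newtonMap (F : ℂ × ℂ → ℂ) (δ z : ℂ) : ℂ := z - F (z, δ) / (10 * centralRoot)

theorem centralRoot_ne_zero : centralRoot ≠ 0 := by
  rw [← norm_pos_iff, norm_centralRoot]
  positivity

theorem newtonMap_eq_iff {δ z : ℂ} : newtonMap F δ z = z ↔ F (z, δ) = 0 := by
  have := centralRoot_ne_zero
  unfold newtonMap
  rw [sub_eq_self, div_eq_zero_iff]
  simp [this]

/-- At the central root and δ = 1/2 the z-derivative of the polynomial is 10 times that root, the
frozen slope of the iteration. Nearby its variation is at most 1.4, against a slope of modulus above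
7.7, and the remainder of F is Lipschitz with a small constant. -/
theorem norm_newtonMap_sub_le (hF : DifferentiableOn ℂ F evansDomain)
    (hκ : ∀ x ∈ evansDomain, ‖F x - resonancePoly x‖ ≤ κ) (hκ' : κ ≤ 1 / 1000) {z w δ : ℂ}
    (hz : ‖z - centralRoot‖ ≤ 1 / 10) (hw : ‖w - centralRoot‖ ≤ 1 / 10)
    (hδ : ‖δ - 1 / 2‖ < 1 / 20) :
    ‖newtonMap F δ z - newtonMap F δ w‖ ≤ 1 / 2 * ‖z - w‖ := by
  have hR := norm_remainder_sub_le hF hκ hz hw hδ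
  set r := (F (z, δ) - resonancePoly (z, δ)) - (F (w, δ) - resonancePoly (w, δ)) with hr
  have h0 := centralRoot_ne_zero
  have e : newtonMap F δ z - newtonMap F δ w =
      (-((z - w) * (5 * ((z - centralRoot) + (w - centralRoot)) + 8 * (δ - 1 / 2))) - r)
        / (10 * centralRoot) := by
    unfold newtonMap
    rw [eq_div_iff (by simpa using h0), hr]
    have : F (z, δ) / (10 * centralRoot) * (10 * centralRoot) = F (z, δ) :=
      div_mul_cancel₀ _ (by simpa using h0)
    have : F (w, δ) / (10 * centralRoot) * (10 * centralRoot) = F (w, δ) :=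
      div_mul_cancel₀ _ (by simpa using h0)
    unfold resonancePoly
    simp only
    field_simp
    ring
  have n10 : ‖10 * centralRoot‖ = 10 * √(3 / 5) := by
    rw [norm_mul, norm_centralRoot, Complex.norm_ofNat]
  rw [e, norm_div, n10, div_le_iff₀ (by positivity)]
  obtain ⟨s1, s2⟩ := sqrt_three_fifths_bounds
  have k1 : ‖5 * ((z - centralRoot) + (w - centralRoot)) + 8 * (δ - 1 / 2)‖ ≤ 14 / 10 := by
    refine (norm_add_le _ _).trans ?_
    rw [norm_mul, norm_mul, Complex.norm_ofNat, Complex.norm_ofNat]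
    linarith [norm_add_le (z - centralRoot) (w - centralRoot)]
  have k2 := norm_sub_le
    (-((z - w) * (5 * ((z - centralRoot) + (w - centralRoot)) + 8 * (δ - 1 / 2)))) r
  rw [norm_neg, norm_mul] at k2
  have k3 := mul_le_mul_of_nonneg_left k1 (norm_nonneg (z - w))
  have k4 := mul_le_mul_of_nonneg_right hκ' (norm_nonneg (z - w))
  have k5 := mul_le_mul_of_nonneg_left s1 (norm_nonneg (z - w))
  linarith [norm_nonneg (z - w)]

theorem norm_newtonMap_sub_centralRoot_le (hF : DifferentiableOn ℂ F evansDomain)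
    (hκ : ∀ x ∈ evansDomain, ‖F x - resonancePoly x‖ ≤ κ) (hκ' : κ ≤ 1 / 1000) {z δ : ℂ}
    (hz : ‖z - centralRoot‖ ≤ 1 / 10) (hδ : ‖δ - 1 / 2‖ < 1 / 20) :
    ‖newtonMap F δ z - centralRoot‖ ≤ 1 / 10 := by
  have hc : ‖centralRoot - centralRoot‖ ≤ 1 / 10 := by simp
  have h1 := norm_newtonMap_sub_le hF hκ hκ' hz hc hδ
  have h0 := centralRoot_ne_zero
  have e : newtonMap F δ centralRoot - centralRoot = -(F (centralRoot, δ)) / (10 * centralRoot) := by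
    unfold newtonMap; ring
  have n10 : ‖10 * centralRoot‖ = 10 * √(3 / 5) := by
    rw [norm_mul, norm_centralRoot, Complex.norm_ofNat]
  obtain ⟨s1, s2⟩ := sqrt_three_fifths_bounds
  have h2 : ‖newtonMap F δ centralRoot - centralRoot‖ ≤ 1 / 20 := by
    rw [e, norm_div, norm_neg, n10, div_le_iff₀ (by positivity)]
    have k1 : resonancePoly (centralRoot, δ) = 8 * (δ - 1 / 2) * centralRoot := by
      unfold resonancePoly
      simp only
      linear_combination 5 * centralRoot_sq
    have k2 := hκ _ (mem_evansDomain_of_near (z := centralRoot)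
      (by rw [sub_self, norm_zero]; norm_num) hδ)
    have k3 := norm_sub_norm_le (F (centralRoot, δ)) (resonancePoly (centralRoot, δ))
    rw [k1, norm_mul, norm_mul, norm_centralRoot, Complex.norm_ofNat] at k3
    rw [k1] at k2
    have k4 : 8 * ‖δ - 1 / 2‖ * √(3 / 5) ≤ 8 * (1 / 20) * (775 / 1000) := by gcongr
    linarith
  have h3 := norm_add_le (newtonMap F δ z - newtonMap F δ centralRoot)
    (newtonMap F δ centralRoot - centralRoot)
  rw [sub_add_sub_cancel] at h3
  linarith

/-- The holomorphic branch of zeros near the central root. -/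
theorem exists_holomorphic_branch (hF : DifferentiableOn ℂ F evansDomain)
    (hκ : ∀ x ∈ evansDomain, ‖F x - resonancePoly x‖ ≤ κ) (hκ' : κ ≤ 1 / 1000) :
    ∃ Z : ℂ → ℂ, DifferentiableOn ℂ Z (Metric.ball (1 / 2) (1 / 20)) ∧
      ∀ δ ∈ Metric.ball (1 / 2 : ℂ) (1 / 20), ‖Z δ - centralRoot‖ ≤ 1 / 10 ∧ F (Z δ, δ) = 0 ∧
        ∀ z, ‖z - centralRoot‖ ≤ 1 / 10 → F (z, δ) = 0 → z = Z δ := by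
  -- Each iterate is holomorphic in δ and the convergence is uniform on the ball, which makes the
  -- limit holomorphic in δ.
  let S : ℕ → ℂ → ℂ := fun n δ => (newtonMap F δ)^[n] centralRoot
  have hS : ∀ n δ, S (n + 1) δ = newtonMap F δ (S n δ) := fun n δ =>
    Function.iterate_succ_apply' _ _ _
  have hmem : ∀ δ ∈ Metric.ball (1 / 2 : ℂ) (1 / 20), ∀ n, ‖S n δ - centralRoot‖ ≤ 1 / 10 := by
    intro δ hδ n
    rw [mem_ball_iff_norm] at hδ
    induction n with
    | zero => simp [S]
    | succ n ih => rw [hS]; exact norm_newtonMap_sub_centralRoot_le hF hκ hκ' ih hδ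
  have hdiff : ∀ n, DifferentiableOn ℂ (S n) (Metric.ball (1 / 2) (1 / 20)) := by
    intro n
    induction n with
    | zero => exact differentiableOn_const _
    | succ n ih =>
      have : S (n + 1) = fun δ => newtonMap F δ (S n δ) := funext fun δ => hS n δ
      rw [this]
      unfold newtonMap
      refine ih.sub (DifferentiableOn.div_const ?_ _)
      refine hF.comp (ih.prodMk differentiableOn_id) fun δ hδ => ?_
      exact mem_evansDomain_of_near ((hmem δ hδ n).trans (by norm_num)) (mem_ball_iff_norm.1 hδ)
  have hstep : ∀ δ ∈ Metric.ball (1 / 2 : ℂ) (1 / 20), ∀ n,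
      dist (S n δ) (S (n + 1) δ) ≤ 1 / 5 * (1 / 2) ^ n := by
    intro δ hδ n
    induction n with
    | zero =>
      have h1 := hmem δ hδ 0
      have h2 := hmem δ hδ 1
      rw [dist_eq_norm]
      have := norm_sub_le (S 0 δ - centralRoot) (S (0 + 1) δ - centralRoot)
      rw [sub_sub_sub_cancel_right] at this
      rw [zero_add] at this ⊢
      linarith
    | succ n ih =>
      have := norm_newtonMap_sub_le hF hκ hκ' (hmem δ hδ n) (hmem δ hδ (n + 1))
        (mem_ball_iff_norm.1 hδ)
      rw [← hS, ← hS, ← dist_eq_norm, ← dist_eq_norm] at this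
      rw [pow_succ]
      linarith
  have hlim : ∀ δ ∈ Metric.ball (1 / 2 : ℂ) (1 / 20), ∃ z, Tendsto (fun n => S n δ) atTop (𝓝 z) :=
    fun δ hδ => cauchySeq_tendsto_of_complete
      (cauchySeq_of_le_geometric _ _ (by norm_num) (hstep δ hδ))
  choose! Z hZ using hlim
  refine ⟨Z, ?_, fun δ hδ => ?_⟩
  · have hunif : TendstoUniformlyOn S Z atTop (Metric.ball (1 / 2) (1 / 20)) := by
      rw [Metric.tendstoUniformlyOn_iff]
      intro η hη
      have h1 : Tendsto (fun n : ℕ => 1 / 5 * (1 / 2 : ℝ) ^ n / (1 - 1 / 2)) atTop (𝓝 0) := by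
        have := (tendsto_pow_atTop_nhds_zero_of_lt_one (r := (1 / 2 : ℝ)) (by norm_num)
          (by norm_num)).const_mul (1 / 5 : ℝ) |>.div_const (1 - 1 / 2)
        simpa using this
      filter_upwards [h1.eventually (gt_mem_nhds hη)] with n hn δ hδ
      rw [dist_comm]
      exact (dist_le_of_le_geometric_of_tendsto _ _ (by norm_num) (hstep δ hδ) (hZ δ hδ) n).trans_lt hn
    exact hunif.tendstoLocallyUniformlyOn.differentiableOn
      (Eventually.of_forall hdiff) Metric.isOpen_ball
  · have hδ' := mem_ball_iff_norm.1 hδ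
    have hZm : ‖Z δ - centralRoot‖ ≤ 1 / 10 :=
      le_of_tendsto' ((hZ δ hδ).sub_const centralRoot).norm (hmem δ hδ)
    refine ⟨hZm, ?_, fun z hz hz0 => ?_⟩
    · rw [← newtonMap_eq_iff]
      refine tendsto_nhds_unique ?_ ((tendsto_add_atTop_iff_nat 1).2 (hZ δ hδ))
      rw [tendsto_iff_norm_sub_tendsto_zero]
      have h1 : Tendsto (fun n => 1 / 2 * ‖S n δ - Z δ‖) atTop (𝓝 0) := by
        have := (tendsto_iff_norm_sub_tendsto_zero.1 (hZ δ hδ)).const_mul (1 / 2 : ℝ)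
        simpa using this
      refine squeeze_zero (fun n => norm_nonneg _) (fun n => ?_) h1
      rw [hS]
      exact norm_newtonMap_sub_le hF hκ hκ' (hmem δ hδ n) hZm hδ'
    · have h1 := newtonMap_eq_iff.2 hz0
      have h2 : newtonMap F δ (Z δ) = Z δ := by
        refine tendsto_nhds_unique ?_ ((tendsto_add_atTop_iff_nat 1).2 (hZ δ hδ))
        rw [tendsto_iff_norm_sub_tendsto_zero]
        have h1 : Tendsto (fun n => 1 / 2 * ‖S n δ - Z δ‖) atTop (𝓝 0) := by
          have := (tendsto_iff_norm_sub_tendsto_zero.1 (hZ δ hδ)).const_mul (1 / 2 : ℝ)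
          simpa using this
        refine squeeze_zero (fun n => norm_nonneg _) (fun n => ?_) h1
        rw [hS]
        exact norm_newtonMap_sub_le hF hκ hκ' (hmem δ hδ n) hZm hδ'
      have h3 := norm_newtonMap_sub_le hF hκ hκ' hz hZm hδ'
      rw [h1, h2] at h3
      have h4 : ‖z - Z δ‖ = 0 := by linarith [norm_nonneg (z - Z δ)]
      exact sub_eq_zero.1 (norm_eq_zero.1 h4)

/-- Stability of the roots of the limiting polynomial near the central root. -/
theorem norm_sub_le_of_resonancePoly {z w δ : ℂ} (hz : ‖z - centralRoot‖ ≤ 1 / 10)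
    (hw : ‖w - centralRoot‖ ≤ 1 / 10) (hδ : ‖δ - 1 / 2‖ < 1 / 20) :
    6 * ‖z - w‖ ≤ ‖resonancePoly (z, δ) - resonancePoly (w, δ)‖ := by
  have e : resonancePoly (z, δ) - resonancePoly (w, δ) = (z - w) *
      (10 * centralRoot - -(5 * ((z - centralRoot) + (w - centralRoot)) + 8 * (δ - 1 / 2))) := by
    unfold resonancePoly; simp only; ring
  rw [e, norm_mul, mul_comm]
  gcongr
  obtain ⟨s1, s2⟩ := sqrt_three_fifths_bounds
  have k1 : ‖-(5 * ((z - centralRoot) + (w - centralRoot)) + 8 * (δ - 1 / 2))‖ ≤ 14 / 10 := by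
    rw [norm_neg]
    refine (norm_add_le _ _).trans ?_
    rw [norm_mul, norm_mul, Complex.norm_ofNat, Complex.norm_ofNat]
    linarith [norm_add_le (z - centralRoot) (w - centralRoot)]
  have k2 := norm_sub_norm_le (10 * centralRoot)
    (-(5 * ((z - centralRoot) + (w - centralRoot)) + 8 * (δ - 1 / 2)))
  rw [norm_mul, norm_centralRoot, Complex.norm_ofNat] at k2
  linarith

end Branch

/-! ### Maximal growth along the branch. -/

theorem resonanceDisc_eq (δ : ℝ) : resonanceDisc δ = 15 - 16 * (δ - 1 / 2) ^ 2 := by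
  unfold resonanceDisc; ring

theorem centralRoot_re : centralRoot.re = 0 := by simp [centralRoot]

theorem centralRoot_im : centralRoot.im = -√(3 / 5) := by simp [centralRoot]

theorem sqrt_fifteen_bounds : 387 / 100 ≤ √(15 : ℝ) ∧ √(15 : ℝ) ≤ 3873 / 1000 :=
  ⟨Real.le_sqrt_of_sq_le (by norm_num), Real.sqrt_le_iff.2 ⟨by norm_num, by norm_num⟩⟩

theorem resonanceDisc_bounds {δ : ℝ} (hδ : |δ - 1 / 2| ≤ 1 / 20) :
    1496 / 100 ≤ resonanceDisc δ ∧ resonanceDisc δ ≤ 15 := by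
  rw [resonanceDisc_eq]
  have : (δ - 1 / 2) ^ 2 ≤ (1 / 20) ^ 2 := by rw [← sq_abs]; gcongr
  constructor <;> nlinarith [sq_nonneg (δ - 1 / 2)]

theorem norm_resonanceRoot_sub_centralRoot_le {δ : ℝ} (hδ : |δ - 1 / 2| ≤ 1 / 20) :
    ‖resonanceRoot δ - centralRoot‖ ≤ 9 / 100 := by
  obtain ⟨h1, h2⟩ := resonanceDisc_bounds hδ
  obtain ⟨s1, s2⟩ := sqrt_three_fifths_bounds
  have k1 : 386 / 100 ≤ √(resonanceDisc δ) := Real.le_sqrt_of_sq_le (by norm_num; linarith)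
  have k2 : √(resonanceDisc δ) ≤ 388 / 100 := Real.sqrt_le_iff.2 ⟨by norm_num, by norm_num; linarith⟩
  refine (Complex.norm_le_abs_re_add_abs_im _).trans ?_
  rw [Complex.sub_re, Complex.sub_im, centralRoot_re, centralRoot_im]
  simp only [resonanceRoot]
  rw [abs_le] at hδ
  have a1 : |2 * (1 - 2 * δ) / 5 - 0| ≤ 4 / 100 := by rw [abs_le]; constructor <;> linarith
  have a2 : |-(√(resonanceDisc δ) / 5) - -√(3 / 5)| ≤ 5 / 100 := by
    rw [abs_le]; constructor <;> linarith
  linarith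

/-- Growth rate of the limiting branch. -/
theorem im_resonanceRoot_add_inv {δ : ℝ} (hG : 0 ≤ resonanceDisc δ) :
    (resonanceRoot δ + (resonanceRoot δ)⁻¹).im = 2 / 15 * √(resonanceDisc δ) := by
  rw [im_add_inv, norm_sq_resonanceRoot hG]
  simp only [resonanceRoot]
  ring

/-- The squares of the two roots differ by 16(δ - 1/2)², and their sum is at most 8. -/
theorem sqrt_resonanceDisc_max {δ : ℝ} (hδ : |δ - 1 / 2| ≤ 1 / 20) :
    2 * (δ - 1 / 2) ^ 2 ≤ √(resonanceDisc (1 / 2)) - √(resonanceDisc δ) := by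
  obtain ⟨h1, h2⟩ := resonanceDisc_bounds hδ
  have e : resonanceDisc (1 / 2) = 15 := by rw [resonanceDisc_eq]; norm_num
  rw [e]
  obtain ⟨s1, s2⟩ := sqrt_fifteen_bounds
  have k1 : √(resonanceDisc δ) ≤ √15 := Real.sqrt_le_sqrt h2
  have q1 : √(15 : ℝ) ^ 2 = 15 := Real.sq_sqrt (by norm_num)
  have q2 : √(resonanceDisc δ) ^ 2 = 15 - 16 * (δ - 1 / 2) ^ 2 := by
    rw [Real.sq_sqrt (by linarith), resonanceDisc_eq]
  set a := √(15 : ℝ)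
  set b := √(resonanceDisc δ)
  have : (a - b) * (a + b) ≤ (a - b) * 8 :=
    mul_le_mul_of_nonneg_left (by linarith) (by linarith)
  nlinarith

/-- Quantitative concavity of the growth rate of the limiting branch. -/
theorem sqrt_resonanceDisc_concave {a b : ℝ} (ha : |a - 1 / 2| ≤ 1 / 20)
    (hb : |b - 1 / 2| ≤ 1 / 20) :
    (b - a) ^ 2 ≤ 2 * √(resonanceDisc ((a + b) / 2)) - √(resonanceDisc a) - √(resonanceDisc b) := by
  have hm : |(a + b) / 2 - 1 / 2| ≤ 1 / 20 := by
    rw [abs_le] at *; constructor <;> linarith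
  have q : ∀ {δ : ℝ}, |δ - 1 / 2| ≤ 1 / 20 →
      √(resonanceDisc δ) ^ 2 = 15 - 16 * (δ - 1 / 2) ^ 2 ∧ 0 ≤ √(resonanceDisc δ) ∧
        √(resonanceDisc δ) ≤ 388 / 100 := fun {δ} h => by
    obtain ⟨h1, h2⟩ := resonanceDisc_bounds h
    exact ⟨by rw [Real.sq_sqrt (by linarith), resonanceDisc_eq], Real.sqrt_nonneg _,
      Real.sqrt_le_iff.2 ⟨by norm_num, by norm_num; linarith⟩⟩
  obtain ⟨qa, a0, a1⟩ := q ha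
  obtain ⟨qb, b0, b1⟩ := q hb
  obtain ⟨qm, m0, m1⟩ := q hm
  set x := √(resonanceDisc a)
  set y := √(resonanceDisc b)
  set m := √(resonanceDisc ((a + b) / 2))
  have h1 : (x + y) ^ 2 + 16 * (b - a) ^ 2 ≤ (2 * m) ^ 2 := by
    have : (x + y) ^ 2 + (x - y) ^ 2 = 2 * (x ^ 2 + y ^ 2) := by ring
    have e : (2 * m) ^ 2 = 4 * m ^ 2 := by ring
    rw [e, qm]
    rw [qa, qb] at this
    nlinarith [sq_nonneg (x - y)]
  have h2 : x + y ≤ 2 * m := by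
    refine le_of_sq_le_sq ?_ (by linarith)
    linarith [sq_nonneg (b - a)]
  have h3 : (2 * m - (x + y)) * (2 * m + (x + y)) ≤ (2 * m - (x + y)) * 16 :=
    mul_le_mul_of_nonneg_left (by linarith) (by linarith)
  nlinarith

/-- Second differences of a function with a bounded second derivative. -/
theorem norm_second_difference_le {E : ℂ → ℂ} {a b : ℝ} {C : ℝ} {s : Set ℂ} (hs : IsOpen s)
    (hd : DifferentiableOn ℂ E s) (hab : a ≤ b) (hmem : ∀ x ∈ Set.Icc a b, (x : ℂ) ∈ s)
    (hC : ∀ x ∈ Set.Icc a b, ‖deriv (deriv E) x‖ ≤ C) :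
    ‖E b - 2 * E ((a + b) / 2 : ℝ) + E a‖ ≤ C * ((b - a) / 2) ^ 2 := by
  set h := (b - a) / 2 with hh
  have h0 : 0 ≤ h := by linarith
  have hd1 : ∀ x ∈ Set.Icc a b, HasDerivAt (fun t : ℝ => E t) (deriv E x) x := fun x hx =>
    ((hd.differentiableAt (hs.mem_nhds (hmem x hx))).hasDerivAt).comp_ofReal
  have hd2 : ∀ x ∈ Set.Icc a b, HasDerivAt (fun t : ℝ => deriv E t) (deriv (deriv E) x) x :=
    fun x hx => (((hd.deriv hs).differentiableAt (hs.mem_nhds (hmem x hx))).hasDerivAt).comp_ofReal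
  have hlip : ∀ x ∈ Set.Icc a (a + h), ‖deriv E ((x + h : ℝ) : ℂ) - deriv E x‖ ≤ C * h := by
    intro x hx
    have := (convex_Icc a b).norm_image_sub_le_of_norm_hasDerivWithin_le
      (f := fun t : ℝ => deriv E t) (fun t ht => (hd2 t ht).hasDerivWithinAt) hC
      (x := x) (y := x + h) ⟨hx.1, by linarith [hx.2]⟩ ⟨by linarith [hx.1], by linarith [hx.2]⟩
    rwa [add_sub_cancel_left, Real.norm_of_nonneg h0] at this
  have hdiff : ∀ x ∈ Set.Icc a (a + h), HasDerivWithinAt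
      (fun t : ℝ => E ((t + h : ℝ) : ℂ) - E t) (deriv E ((x + h : ℝ) : ℂ) - deriv E x)
      (Set.Icc a (a + h)) x := fun x hx => by
    refine HasDerivAt.hasDerivWithinAt (HasDerivAt.sub ?_ (hd1 x ⟨hx.1, by linarith [hx.2]⟩))
    exact (hd1 (x + h) ⟨by linarith [hx.1], by linarith [hx.2]⟩).comp_add_const x h
  have := (convex_Icc a (a + h)).norm_image_sub_le_of_norm_hasDerivWithin_le hdiff hlip
    (x := a) (y := a + h) ⟨le_rfl, by linarith⟩ ⟨by linarith, le_rfl⟩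
  rw [add_sub_cancel_left, Real.norm_of_nonneg h0] at this
  have e1 : a + h + h = b := by rw [hh]; ring
  have e2 : a + h = (a + b) / 2 := by rw [hh]; ring
  simp only [e1] at this
  rw [e2] at this
  calc _ = ‖E b - E ((a + b) / 2 : ℝ) - (E ((a + b) / 2 : ℝ) - E a)‖ := by congr 1; ring
    _ ≤ _ := this
    _ = _ := by ring

section GrowthMaximum

variable {F : ℂ × ℂ → ℂ} {κ : ℝ}

theorem near_centralRoot_bounds {z : ℂ} (hz : ‖z - centralRoot‖ ≤ 1 / 10) :
    67 / 100 ≤ ‖z‖ ∧ z.im < 0 := by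
  obtain ⟨s1, s2⟩ := sqrt_three_fifths_bounds
  have k1 := norm_sub_norm_le centralRoot z
  rw [norm_sub_rev, norm_centralRoot] at k1
  have k2 := (Complex.abs_im_le_norm (z - centralRoot)).trans hz
  rw [Complex.sub_im, centralRoot_im, abs_le] at k2
  constructor <;> linarith

theorem norm_inv_mul_inv_sub_one_le {z w : ℂ} (hz : 67 / 100 ≤ ‖z‖) (hw : 67 / 100 ≤ ‖w‖) :
    ‖z⁻¹ * w⁻¹ - 1‖ ≤ 4 := by
  refine (norm_sub_le _ _).trans ?_
  rw [norm_mul, norm_one, norm_inv, norm_inv]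
  have h1 : ‖z‖⁻¹ ≤ 15 / 10 := by
    rw [inv_le_comm₀ (by linarith) (by norm_num)]; norm_num; linarith
  have h2 : ‖w‖⁻¹ ≤ 15 / 10 := by
    rw [inv_le_comm₀ (by linarith) (by norm_num)]; norm_num; linarith
  have : ‖z‖⁻¹ * ‖w‖⁻¹ ≤ 15 / 10 * (15 / 10) := by gcongr
  linarith

theorem norm_add_inv_sub_add_inv_le {z w : ℂ} (hz : 67 / 100 ≤ ‖z‖) (hw : 67 / 100 ≤ ‖w‖) :
    ‖(z + z⁻¹) - (w + w⁻¹)‖ ≤ 4 * ‖z - w‖ := by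
  have z0 : z ≠ 0 := by rw [← norm_pos_iff]; linarith
  have w0 : w ≠ 0 := by rw [← norm_pos_iff]; linarith
  have e : (z + z⁻¹) - (w + w⁻¹) = -((z⁻¹ * w⁻¹ - 1) * (z - w)) := by field_simp; ring
  rw [e, norm_neg, norm_mul]
  gcongr
  exact norm_inv_mul_inv_sub_one_le hz hw

/-- The derivative of a function bounded on a ball, in a smaller concentric ball. -/
theorem norm_deriv_le_of_ball {E : ℂ → ℂ} {c : ℂ} {R r ρ C : ℝ} (hρ : 0 < ρ) (hR : r + ρ < R)
    (hd : DifferentiableOn ℂ E (Metric.ball c R)) (hC : ∀ x ∈ Metric.ball c R, ‖E x‖ ≤ C)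
    {x : ℂ} (hx : ‖x - c‖ ≤ r) : ‖deriv E x‖ ≤ C / ρ := by
  have hsub : Metric.closedBall x ρ ⊆ Metric.ball c R := by
    refine Metric.closedBall_subset_ball' ?_
    rw [dist_eq_norm]; linarith
  refine Complex.norm_deriv_le_of_forall_mem_sphere_norm_le hρ
    (DifferentiableOn.diffContOnCl ?_) fun y hy => hC y (hsub (Metric.sphere_subset_closedBall hy))
  rw [closure_ball x hρ.ne']
  exact hd.mono hsub

theorem norm_ofReal_sub_half (δ : ℝ) : ‖(δ : ℂ) - 1 / 2‖ = |δ - 1 / 2| := by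
  have : (δ : ℂ) - 1 / 2 = ((δ - 1 / 2 : ℝ) : ℂ) := by push_cast; ring
  rw [this, Complex.norm_real, Real.norm_eq_abs]

/-- The growth rate along the branch has a unique maximum near `δ = 1 / 2`. -/
theorem exists_local_growth_maximum (hF : DifferentiableOn ℂ F evansDomain)
    (hκ : ∀ x ∈ evansDomain, ‖F x - resonancePoly x‖ ≤ κ) (hκ0 : 0 ≤ κ) (hκ' : κ ≤ 1 / 10 ^ 9) :
    ∃ (Z : ℂ → ℂ) (δs : ℝ),
      (∀ δ ∈ Metric.ball (1 / 2 : ℂ) (1 / 20), ‖Z δ - centralRoot‖ ≤ 1 / 10 ∧ F (Z δ, δ) = 0 ∧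
        ∀ z, ‖z - centralRoot‖ ≤ 1 / 10 → F (z, δ) = 0 → z = Z δ) ∧
      |δs - 1 / 2| ≤ 250 * κ ∧ 51639 / 100000 ≤ (Z δs + (Z δs)⁻¹).im ∧
      ∀ δ : ℝ, |δ - 1 / 2| ≤ 1 / 50 → (Z δs + (Z δs)⁻¹).im ≤ (Z δ + (Z δ)⁻¹).im → δ = δs := by
  have hκ3 : κ ≤ 1 / 1000 := hκ'.trans (by norm_num)
  obtain ⟨Z, hZd, hZ⟩ := exists_holomorphic_branch hF hκ hκ3
  have hPd : DifferentiableOn ℂ resonancePoly evansDomain := by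
    unfold resonancePoly; fun_prop
  -- The same construction with F equal to the polynomial continues the limiting root to complex δ,
  -- so that Cauchy estimates apply to the difference.
  obtain ⟨Y, hYd, hY⟩ := exists_holomorphic_branch (F := resonancePoly) (κ := 0) hPd
    (fun x _ => by rw [sub_self, norm_zero]) (by norm_num)
  set B := Metric.ball (1 / 2 : ℂ) (1 / 20) with hB
  set E : ℂ → ℂ := fun δ => (Z δ + (Z δ)⁻¹) - (Y δ + (Y δ)⁻¹) with hE
  have ne : ∀ {z : ℂ}, ‖z - centralRoot‖ ≤ 1 / 10 → z ≠ 0 := fun h => by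
    rw [← norm_pos_iff]; linarith [(near_centralRoot_bounds h).1]
  have hEd : DifferentiableOn ℂ E B :=
    (hZd.add (hZd.inv fun δ h => ne (hZ δ h).1)).sub (hYd.add (hYd.inv fun δ h => ne (hY δ h).1))
  have hEb : ∀ δ ∈ B, ‖E δ‖ ≤ κ := by
    intro δ hδ
    obtain ⟨z1, z2, -⟩ := hZ δ hδ
    obtain ⟨y1, y2, -⟩ := hY δ hδ
    have hδ' := mem_ball_iff_norm.1 hδ
    have k1 := norm_sub_le_of_resonancePoly z1 y1 hδ'
    have k2 := hκ _ (mem_evansDomain_of_near (z1.trans (by norm_num)) hδ')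
    rw [z2, zero_sub, norm_neg] at k2
    rw [y2, sub_zero] at k1
    have k3 := norm_add_inv_sub_add_inv_le (near_centralRoot_bounds z1).1
      (near_centralRoot_bounds y1).1
    have : ‖E δ‖ ≤ 4 * ‖Z δ - Y δ‖ := k3
    linarith
  -- Two Cauchy estimates, of radii 1/60 and 1/100, while the ball shrinks from 1/20 to 32/1000 and
  -- then to 1/50.
  have hE1 : ∀ x ∈ Metric.ball (1 / 2 : ℂ) (32 / 1000), ‖deriv E x‖ ≤ 60 * κ := by
    intro x hx
    have := norm_deriv_le_of_ball (ρ := 1 / 60) (r := 32 / 1000) (by norm_num) (by norm_num) hEd hEb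
      (mem_ball_iff_norm.1 hx).le
    linarith
  have hE2 : ∀ x : ℂ, ‖x - 1 / 2‖ ≤ 1 / 50 → ‖deriv (deriv E) x‖ ≤ 6000 * κ := by
    intro x hx
    have hd : DifferentiableOn ℂ (deriv E) (Metric.ball (1 / 2 : ℂ) (32 / 1000)) :=
      (hEd.deriv Metric.isOpen_ball).mono (Metric.ball_subset_ball (by norm_num))
    have := norm_deriv_le_of_ball (ρ := 1 / 100) (r := 1 / 50) (by norm_num) (by norm_num) hd hE1 hx
    linarith
  have hmem : ∀ {δ : ℝ}, |δ - 1 / 2| ≤ 1 / 50 → (δ : ℂ) ∈ B := fun {δ} h => by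
    rw [hB, mem_ball_iff_norm, norm_ofReal_sub_half]; linarith
  have hYr : ∀ {δ : ℝ}, |δ - 1 / 2| ≤ 1 / 50 → Y δ = resonanceRoot δ := fun {δ} h => by
    have h' : |δ - 1 / 2| ≤ 1 / 20 := by linarith
    refine ((hY δ (hmem h)).2.2 _
      ((norm_resonanceRoot_sub_centralRoot_le h').trans (by norm_num)) ?_).symm
    rw [resonancePoly_eq (by linarith [(resonanceDisc_bounds h').1])]
    simp
  set f : ℝ → ℝ := fun δ => (Z δ + (Z δ)⁻¹).im with hf
  have hfe : ∀ {δ : ℝ}, |δ - 1 / 2| ≤ 1 / 50 →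
      f δ = 2 / 15 * √(resonanceDisc δ) + (E δ).im := fun {δ} h => by
    have h' : |δ - 1 / 2| ≤ 1 / 20 := by linarith
    rw [← im_resonanceRoot_add_inv (by linarith [(resonanceDisc_bounds h').1]), ← hYr h,
      ← Complex.add_im]
    simp only [hE, hf]
    congr 1
    ring
  have hIcc : ∀ {δ : ℝ}, δ ∈ Set.Icc (48 / 100 : ℝ) (52 / 100) ↔ |δ - 1 / 2| ≤ 1 / 50 := by
    intro δ
    rw [abs_le, Set.mem_Icc]
    constructor <;> rintro ⟨a, b⟩ <;> constructor <;> linarith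
  have hfc : ContinuousOn f (Set.Icc (48 / 100) (52 / 100)) := by
    have : ContinuousOn (fun δ : ℝ => Z δ) (Set.Icc (48 / 100) (52 / 100)) :=
      hZd.continuousOn.comp Complex.continuous_ofReal.continuousOn fun δ h => hmem (hIcc.1 h)
    exact Complex.continuous_im.comp_continuousOn
      (this.add (this.inv₀ fun δ h => ne (hZ δ (hmem (hIcc.1 h))).1))
  obtain ⟨δs, hs, hmax⟩ := isCompact_Icc.exists_isMaxOn (f := f)
    (Set.nonempty_Icc.2 (by norm_num)) hfc
  have hs' := hIcc.1 hs
  have hhalf : |(1 / 2 : ℝ) - 1 / 2| ≤ 1 / 50 := by norm_num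
  have hd15 : resonanceDisc (1 / 2) = 15 := by rw [resonanceDisc_eq]; norm_num
  have hm0 : f (1 / 2) ≤ f δs := hmax (hIcc.2 hhalf)
  refine ⟨Z, δs, hZ, ?_, ?_, fun δ hδ hle => ?_⟩
  · have k1 := sqrt_resonanceDisc_max (δ := δs) (by linarith)
    have k2 : ‖E δs - E ((1 / 2 : ℝ) : ℂ)‖ ≤ 60 * κ * ‖(δs : ℂ) - ((1 / 2 : ℝ) : ℂ)‖ := by
      refine (convex_ball (1 / 2 : ℂ) (32 / 1000)).norm_image_sub_le_of_norm_deriv_le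
        (fun x hx => hEd.differentiableAt (Metric.isOpen_ball.mem_nhds
          (Metric.ball_subset_ball (by norm_num) hx))) hE1 ?_ ?_
      · rw [mem_ball_iff_norm, norm_ofReal_sub_half]; norm_num
      · rw [mem_ball_iff_norm, norm_ofReal_sub_half]; linarith
    have k3 := (Complex.abs_im_le_norm _).trans k2
    rw [← Complex.ofReal_sub, Complex.norm_real, Real.norm_eq_abs, Complex.sub_im] at k3
    have k4 := (abs_le.1 k3).2
    rw [hfe hhalf, hfe hs'] at hm0
    set x := |δs - 1 / 2| with hx
    have hx0 : 0 ≤ x := abs_nonneg _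
    rw [← sq_abs] at k1
    -- Moving x = |δs - 1/2| away from 1/2 costs the limiting rate at least 4x²/15, and the
    -- perturbation regains at most 60κx; so x ≤ 225κ.
    by_contra! hcon
    have : 0 < x := lt_of_le_of_lt (by positivity) hcon
    have : 60 * κ * x < 60 / 250 * x ^ 2 := by nlinarith
    nlinarith
  · have k1 := (abs_le.1 ((Complex.abs_im_le_norm _).trans (hEb _ (hmem hhalf)))).1
    rw [hfe hhalf, hd15] at hm0
    have : 3872982 / 1000000 ≤ √(15 : ℝ) := Real.le_sqrt_of_sq_le (by norm_num)
    change _ ≤ f δs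
    linarith
  · by_contra hne
    -- Strict midpoint concavity: the limiting rate contributes at least 2(b - a)²/15, the
    -- perturbation a far smaller multiple of (b - a)². Two maximizers are then impossible.
    have key : ∀ {a b : ℝ}, |a - 1 / 2| ≤ 1 / 50 → |b - 1 / 2| ≤ 1 / 50 → a < b →
        f a + f b < 2 * f ((a + b) / 2) := by
      intro a b ha hb hab
      have hm : |(a + b) / 2 - 1 / 2| ≤ 1 / 50 := by
        rw [abs_le] at *; constructor <;> linarith
      have hin : ∀ x ∈ Set.Icc a b, |x - 1 / 2| ≤ 1 / 50 := fun x hx => by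
        rw [abs_le] at *; constructor <;> linarith [hx.1, hx.2]
      have k1 := norm_second_difference_le Metric.isOpen_ball hEd hab.le
        (fun x hx => hmem (hin x hx)) (fun x hx => hE2 x (by
          rw [norm_ofReal_sub_half]; exact hin x hx))
      have k2 := sqrt_resonanceDisc_concave (a := a) (b := b) (by linarith) (by linarith)
      have k3 := (abs_le.1 ((Complex.abs_im_le_norm _).trans k1)).2
      have e2 : (2 * E ((a + b) / 2 : ℝ)).im = 2 * (E ((a + b) / 2 : ℝ)).im := by
        rw [Complex.mul_im]; simp
      rw [Complex.add_im, Complex.sub_im, e2] at k3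
      rw [hfe ha, hfe hb, hfe hm]
      have k4 : 0 < (b - a) ^ 2 := by have := sub_pos.2 hab; positivity
      have k5 : 6000 * κ * ((b - a) / 2) ^ 2 ≤ 1 / 100 * (b - a) ^ 2 := by
        have := mul_le_mul_of_nonneg_right hκ' k4.le
        linarith
      linarith
    have hmid : |(δ + δs) / 2 - 1 / 2| ≤ 1 / 50 := by
      rw [abs_le] at *; constructor <;> linarith
    have h1 : f ((δ + δs) / 2) ≤ f δs := hmax (hIcc.2 hmid)
    have h2 : f δs ≤ f δ := hle
    rcases lt_or_gt_of_ne hne with h | h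
    · linarith [key hδ hs' h]
    · have := key hs' hδ h
      rw [add_comm δs δ] at this
      linarith

/-- A zero with large growth rate lies near the central root. -/
theorem near_centralRoot_of_growth (hκ0 : 0 ≤ κ) (hκ' : κ ≤ 1 / 10 ^ 9) {z : ℂ} {δ : ℝ}
    (hz : 1 / 100 < ‖z‖) (hp : ‖resonancePoly (z, (δ : ℂ))‖ ≤ κ) (him : z.im < 0)
    (hg : 51639 / 100000 ≤ (z + z⁻¹).im) :
    |δ - 1 / 2| ≤ 1 / 50 ∧ ‖z - centralRoot‖ ≤ 1 / 10 := by
  have z0 : z ≠ 0 := by rw [← norm_pos_iff]; linarith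
  -- After division by z the imaginary part reads y(3v - 5) ≈ 0 with y = -Im z and v = |z|⁻². The
  -- growth y(v - 1) is then about 2y/3, so y is nearly √(3/5) or larger and v is near 5/3; as v|z|²
  -- = 1, little is left for Re z. The real part finally yields δ ≈ 1/2.
  have e : resonancePoly (z, (δ : ℂ)) = z * (5 * z + 3 * z⁻¹ - ((4 * (1 - 2 * δ) : ℝ) : ℂ)) := by
    unfold resonancePoly; push_cast; field_simp; ring
  have hw : ‖5 * z + 3 * z⁻¹ - ((4 * (1 - 2 * δ) : ℝ) : ℂ)‖ ≤ 100 * κ := by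
    rw [e, norm_mul] at hp
    have := mul_le_mul_of_nonneg_right hz.le
      (norm_nonneg (5 * z + 3 * z⁻¹ - ((4 * (1 - 2 * δ) : ℝ) : ℂ)))
    linarith
  have w1 := (Complex.abs_re_le_norm _).trans hw
  have w2 := (Complex.abs_im_le_norm _).trans hw
  rw [im_add_inv] at hg
  have r1 : z⁻¹.re = z.re * (‖z‖ ^ 2)⁻¹ := by
    rw [Complex.inv_re, Complex.normSq_eq_norm_sq]; rfl
  have i1 : z⁻¹.im = -z.im * (‖z‖ ^ 2)⁻¹ := by
    rw [Complex.inv_im, Complex.normSq_eq_norm_sq]; rfl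
  have r2 : (5 * z + 3 * z⁻¹ - ((4 * (1 - 2 * δ) : ℝ) : ℂ)).re
      = z.re * (5 + 3 * (‖z‖ ^ 2)⁻¹) - 4 * (1 - 2 * δ) := by
    rw [Complex.sub_re, Complex.add_re, Complex.mul_re, Complex.mul_re, r1, Complex.ofReal_re]
    simp only [Complex.re_ofNat, Complex.im_ofNat]
    ring
  have i2 : (5 * z + 3 * z⁻¹ - ((4 * (1 - 2 * δ) : ℝ) : ℂ)).im
      = z.im * (5 - 3 * (‖z‖ ^ 2)⁻¹) := by
    rw [Complex.sub_im, Complex.add_im, Complex.mul_im, Complex.mul_im, i1, Complex.ofReal_im]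
    simp only [Complex.re_ofNat, Complex.im_ofNat]
    ring
  rw [r2] at w1
  rw [i2] at w2
  have hn : ‖z‖ ^ 2 = z.re ^ 2 + z.im ^ 2 := by
    rw [← Complex.normSq_eq_norm_sq, Complex.normSq_apply]; ring
  obtain ⟨y, hy⟩ : ∃ y, y = -z.im := ⟨_, rfl⟩
  obtain ⟨v, hv⟩ : ∃ v, v = (‖z‖ ^ 2)⁻¹ := ⟨_, rfl⟩
  obtain ⟨x, hx⟩ : ∃ x, x = z.re := ⟨_, rfl⟩
  have hzi : z.im = -y := by rw [hy]; ring
  have v0 : 0 < v := by rw [hv]; have : 0 < ‖z‖ := by linarith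
                        positivity
  have hvn : v * (x ^ 2 + y ^ 2) = 1 := by
    rw [hv, hn, hx, hy, neg_sq]
    refine inv_mul_cancel₀ ?_
    rw [← hn]
    have : 0 < ‖z‖ := by linarith
    positivity
  have near : |x| ≤ 1 / 100 → |y - √(3 / 5)| ≤ 1 / 100 → ‖z - centralRoot‖ ≤ 1 / 10 := by
    intro h1 h2
    refine (Complex.norm_le_abs_re_add_abs_im _).trans ?_
    rw [Complex.sub_re, Complex.sub_im, centralRoot_re, centralRoot_im, sub_zero, hzi, ← hx,
      ← abs_neg (-y - _)]
    have : -(-y - -√(3 / 5)) = y - √(3 / 5) := by ring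
    rw [this]
    linarith
  rw [hzi, ← hv] at hg w2
  rw [← hx, ← hv] at w1
  have y0 : 0 < y := by linarith
  clear hw hp e r1 i1 r2 i2 hn hx hv hy hzi him z0 hz
  obtain ⟨w2a, w2b⟩ := abs_le.1 w2
  have hyv : 51639 / 100000 ≤ y * (v - 1) := by linarith
  have hv5 : |y * (3 * v - 5)| ≤ 100 * κ := by
    rw [abs_le]; constructor <;> linarith
  have hy2 : v * y ^ 2 ≤ 1 := by
    have := mul_nonneg v0.le (sq_nonneg x)
    linarith
  have hv1 : 1 < v := by
    by_contra! h
    have := mul_nonneg y0.le (sub_nonneg.2 h)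
    linarith
  have hy1 : y < 1 := by
    by_contra! h
    have : 1 ≤ y ^ 2 := by nlinarith
    nlinarith
  have hyl : 7 / 10 ≤ y := by
    have h1 : (5 * y : ℝ) - 3 * (y * v) ≤ 100 * κ := by linarith
    have h2 : 3 * (y * v) - 5 * y ≤ 100 * κ := by linarith
    linarith
  have hvb : |v - 5 / 3| ≤ 50 * κ := by
    have : |y * (3 * v - 5)| = 3 * y * |v - 5 / 3| := by
      rw [abs_mul, abs_of_pos y0, show 3 * v - 5 = 3 * (v - 5 / 3) by ring, abs_mul]
      norm_num; ring
    rw [this] at hv5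
    have h3 := mul_le_mul_of_nonneg_right hyl (abs_nonneg (v - 5 / 3))
    linarith
  obtain ⟨va, vb⟩ := abs_le.1 hvb
  have hyl' : 77458 / 100000 ≤ y := by
    have : y * (v - 1) ≤ y * (2 / 3 + 50 * κ) := mul_le_mul_of_nonneg_left (by linarith) y0.le
    nlinarith
  have hx2 : x ^ 2 ≤ 3 / 10 ^ 5 := by
    have h1 : v * (x ^ 2 + y ^ 2) ≥ (5 / 3 - 50 * κ) * (x ^ 2 + y ^ 2) :=
      mul_le_mul_of_nonneg_right (by linarith) (by positivity)
    have h2 : (77458 / 100000) ^ 2 ≤ y ^ 2 := by gcongr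
    nlinarith [sq_nonneg x]
  have hxa : |x| ≤ 6 / 1000 := by
    refine abs_le_of_sq_le_sq ?_ (by norm_num)
    linarith
  have hyu : y ≤ 77465 / 100000 := by
    refine le_of_sq_le_sq ?_ (by norm_num)
    have h1 : v * (x ^ 2 + y ^ 2) ≥ (5 / 3 - 50 * κ) * y ^ 2 := by
      have := mul_nonneg v0.le (sq_nonneg x)
      have := mul_le_mul_of_nonneg_right (show 5 / 3 - 50 * κ ≤ v by linarith) (sq_nonneg y)
      linarith
    nlinarith [sq_nonneg y]
  obtain ⟨s1, s2⟩ := sqrt_three_fifths_bounds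
  obtain ⟨xa, xb⟩ := abs_le.1 hxa
  refine ⟨?_, near (hxa.trans (by norm_num)) (by rw [abs_le]; constructor <;> linarith)⟩
  have hxv : |x * (5 + 3 * v)| ≤ 7 / 100 := by
    rw [abs_mul, abs_of_pos (show (0 : ℝ) < 5 + 3 * v by linarith)]
    have := mul_le_mul hxa (show 5 + 3 * v ≤ 11 by linarith) (by linarith) (by norm_num)
    linarith
  obtain ⟨p1, p2⟩ := abs_le.1 hxv
  obtain ⟨q1, q2⟩ := abs_le.1 w1
  rw [abs_le]; constructor <;> linarith

/-- The zero of largest growth rate. -/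
theorem exists_growth_maximum (hF : DifferentiableOn ℂ F evansDomain)
    (hκ : ∀ x ∈ evansDomain, ‖F x - resonancePoly x‖ ≤ κ) (hκ0 : 0 ≤ κ) (hκ' : κ ≤ 1 / 10 ^ 9) :
    ∃ (δs : ℝ) (zs : ℂ), |δs - 1 / 2| ≤ 250 * κ ∧ ‖zs - centralRoot‖ ≤ 1 / 10 ∧
      F (zs, δs) = 0 ∧ 51639 / 100000 ≤ (zs + zs⁻¹).im ∧
      (∀ z, (z, (δs : ℂ)) ∈ evansDomain → F (z, δs) = 0 → z.im < 0 → z = zs) ∧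
      ∀ (z : ℂ) (δ : ℝ), (z, (δ : ℂ)) ∈ evansDomain → F (z, δ) = 0 → z.im < 0 →
        (zs + zs⁻¹).im ≤ (z + z⁻¹).im → z = zs ∧ δ = δs := by
  obtain ⟨Z, δs, hZ, h1, h2, h3⟩ := exists_local_growth_maximum hF hκ hκ0 hκ'
  have hmem : ∀ {δ : ℝ}, |δ - 1 / 2| ≤ 1 / 50 → (δ : ℂ) ∈ Metric.ball (1 / 2 : ℂ) (1 / 20) :=
    fun {δ} h => by rw [mem_ball_iff_norm, norm_ofReal_sub_half]; linarith
  have hs : |δs - 1 / 2| ≤ 1 / 50 := h1.trans (by linarith)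
  have hpoly : ∀ {z : ℂ} {δ : ℝ}, (z, (δ : ℂ)) ∈ evansDomain → F (z, δ) = 0 →
      ‖resonancePoly (z, (δ : ℂ))‖ ≤ κ := fun {z δ} hz h0 => by
    have := hκ _ hz
    rwa [h0, zero_sub, norm_neg] at this
  refine ⟨δs, Z δs, h1, (hZ δs (hmem hs)).1, (hZ δs (hmem hs)).2.1, h2, fun z hz h0 him => ?_,
    fun z δ hz h0 him hle => ?_⟩
  · have hs' : |δs - 1 / 2| ≤ 1 / 20 := by linarith
    have hb := (resonanceDisc_bounds hs').1
    have k1 := norm_sub_resonanceRoot_le (by linarith) him (hpoly hz h0)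
    have k2 : 1 ≤ √(resonanceDisc δs) := Real.one_le_sqrt.2 (by linarith)
    have k3 : κ / √(resonanceDisc δs) ≤ κ := div_le_self hκ0 k2
    refine (hZ δs (hmem hs)).2.2 z ?_ h0
    have := norm_add_le (z - resonanceRoot δs) (resonanceRoot δs - centralRoot)
    rw [sub_add_sub_cancel] at this
    linarith [norm_resonanceRoot_sub_centralRoot_le hs']
  · obtain ⟨n1, n2⟩ := near_centralRoot_of_growth hκ0 hκ' hz.1 (hpoly hz h0) him (h2.trans hle)
    have hzZ := (hZ δ (hmem n1)).2.2 z n2 h0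
    have := h3 δ n1 (by rwa [← hzZ])
    subst this
    exact ⟨hzZ, rfl⟩

end GrowthMaximum

/-! ### Unstable eigenvalues at a fixed coupling. -/

/-- The two roots of z² - wz + 1 are reciprocal, so one lies in the closed unit disc. This recovers
z from a given eigenvalue. -/
theorem exists_add_inv_eq (w : ℂ) : ∃ z : ℂ, z ≠ 0 ∧ ‖z‖ ≤ 1 ∧ z + z⁻¹ = w := by
  obtain ⟨s, hs⟩ := IsAlgClosed.exists_pow_nat_eq (w ^ 2 - 4) (n := 2) (by norm_num)
  have h : (w - s) / 2 * ((w + s) / 2) = 1 := by linear_combination -hs / 4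
  have hinv : ((w - s) / 2)⁻¹ = (w + s) / 2 := inv_eq_of_mul_eq_one_right h
  have hne : (w - s) / 2 ≠ 0 := left_ne_zero_of_mul_eq_one h
  rcases le_total ‖(w - s) / 2‖ 1 with h1 | h1
  · exact ⟨_, hne, h1, by rw [hinv]; ring⟩
  · refine ⟨((w - s) / 2)⁻¹, inv_ne_zero hne, ?_, ?_⟩
    · rw [norm_inv]; exact inv_le_one_of_one_le₀ h1
    · rw [inv_inv, hinv]; ring

theorem isStabilityEigenvalue_of_sq_eq {ε p q : ℝ} {ψ : ℤ → ℝ} {ν : ℂ} (h : p ^ 2 = q ^ 2)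
    (hs : IsStabilityEigenvalue (-1) ε p ψ ν) : IsStabilityEigenvalue (-1) ε q ψ ν := by
  have h' : (p : ℂ) ^ 2 = (q : ℂ) ^ 2 := by exact_mod_cast h
  have : stabilityEigenspace (-1) ε q ψ ν = stabilityEigenspace (-1) ε p ψ ν := by
    ext x
    change (_ ∧ _) ↔ (_ ∧ _)
    simp only [Lplus, Lminus, h']
  unfold IsStabilityEigenvalue
  rwa [this]

/-- The scaled transverse wavenumber. -/
noncomputable def scaledWavenumber (ε p : ℝ) : ℝ := (p ^ 2 - 1 / 4) / ε

/-- `z` is the spectral parameter of an unstable eigenvalue bifurcating from the resonance. -/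
def IsResonantParameter (ε p : ℝ) (ψ : ℤ → ℝ) (z : ℂ) : Prop :=
  z.im < 0 ∧ (z, (scaledWavenumber ε p : ℂ)) ∈ evansDomain ∧
    IsStabilityEigenvalue (-1) ε p ψ (resonantValue ε (scaledWavenumber ε p) z)

/-- The unstable eigenvalue bifurcating from the resonance. -/
noncomputable def unstableEigenvalue (ε p : ℝ) (ψ : ℤ → ℝ) : ℂ :=
  resonantValue ε (scaledWavenumber ε p) (Classical.epsilon (IsResonantParameter ε p ψ))

section FixedCoupling

variable {ε p : ℝ} {ψ : ℤ → ℝ}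

theorem scaledWavenumber_spec (hε : 0 < ε) (p : ℝ) : p ^ 2 = 1 / 4 + ε * scaledWavenumber ε p := by
  unfold scaledWavenumber; field_simp; ring

theorem scaledWavenumber_eq (hε : 0 < ε) {δ : ℝ} (h : p ^ 2 = 1 / 4 + ε * δ) :
    scaledWavenumber ε p = δ := by
  unfold scaledWavenumber; rw [h]; field_simp; ring

theorem unstableEigenvalue_neg (ε p : ℝ) (ψ : ℤ → ℝ) :
    unstableEigenvalue ε (-p) ψ = unstableEigenvalue ε p ψ := by
  have h1 : scaledWavenumber ε (-p) = scaledWavenumber ε p := by simp [scaledWavenumber]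
  have h2 : IsResonantParameter ε (-p) ψ = IsResonantParameter ε p ψ := by
    ext z
    unfold IsResonantParameter
    rw [h1]
    have : IsStabilityEigenvalue (-1) ε (-p) ψ (resonantValue ε (scaledWavenumber ε p) z) ↔
        IsStabilityEigenvalue (-1) ε p ψ (resonantValue ε (scaledWavenumber ε p) z) :=
      ⟨isStabilityEigenvalue_of_sq_eq (neg_sq p), isStabilityEigenvalue_of_sq_eq (neg_sq p).symm⟩
    rw [this]
  unfold unstableEigenvalue
  rw [h1, h2]

theorem resonantValue_conj (ε δ : ℝ) (z : ℂ) :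
    resonantValue ε δ (conj z) = -conj (resonantValue ε δ z) := by
  unfold resonantValue
  simp only [map_mul, map_add, map_sub, map_div₀, map_ofNat, map_inv₀, Complex.conj_ofReal,
    Complex.conj_I]
  ring

theorem resonantValue_re_pos (hε : 0 < ε) {δ : ℝ} {z : ℂ} (hz : (z, (δ : ℂ)) ∈ evansDomain)
    (him : z.im < 0) : 0 < (resonantValue ε δ z).re := by
  rw [resonantValue_re, im_add_inv]
  obtain ⟨h1, h2, -⟩ := hz
  dsimp only at h1 h2
  refine mul_pos hε ?_
  have h3 : 1 < (‖z‖ ^ 2)⁻¹ := (one_lt_inv₀ (by nlinarith)).2 (by nlinarith)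
  nlinarith

/-- The lower bound on the discriminant is five times the error 10¹¹ε of F, exactly what excludes
real zeros. -/
theorem SolitonBounds.exists_isResonantParameter (hψ : SolitonBounds ε ψ) (hε : 0 < ε)
    (hε' : ε ≤ 1 / 10 ^ 20) (hδ : |scaledWavenumber ε p| < 100)
    (hG : 5 * 10 ^ 11 * ε < resonanceDisc (scaledWavenumber ε p)) :
    ∃ z, IsResonantParameter ε p ψ z := by
  obtain ⟨F, hF, hκ, hiff⟩ := hψ.exists_evansFunction hε (hε'.trans (by norm_num))
  set δ := scaledWavenumber ε p with hd
  have hG0 : 0 ≤ resonanceDisc δ := le_trans (by positivity) hG.le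
  obtain ⟨z, hz, h0⟩ := exists_zero_near_resonance hF hκ (by linarith) hδ hG0
  have hs := (hiff z δ p hz (scaledWavenumber_spec hε p)).1 h0
  have him : z.im ≠ 0 := fun h => by
    have k1 := resonanceDisc_div_le_norm hG0 h
    have k2 := hκ _ hz
    rw [h0, zero_sub, norm_neg] at k2
    linarith
  -- Replacing z by its conjugate sends λ to minus its conjugate, which is again an eigenvalue; so
  -- the lower half plane can always be reached.
  rcases lt_or_gt_of_ne him with h | h
  · exact ⟨z, h, hz, hs⟩
  · refine ⟨conj z, by simpa using h, ?_, ?_⟩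
    · rw [← hd]
      obtain ⟨a, b, c⟩ := hz
      exact ⟨by simpa using a, by simpa using b, c⟩
    · rw [← hd, resonantValue_conj]
      exact hs.conj.neg

theorem IsResonantParameter.norm_sub_leadingEigenvalue_le (hψ : SolitonBounds ε ψ) (hε : 0 < ε)
    (hε' : ε ≤ 1 / 10 ^ 20) {z : ℂ} (hz : IsResonantParameter ε p ψ z)
    (hG : 0 < resonanceDisc (scaledWavenumber ε p)) :
    ‖resonantValue ε (scaledWavenumber ε p) z - leadingEigenvalue ε (scaledWavenumber ε p)‖
      ≤ 201 * ε * (10 ^ 11 * ε / √(resonanceDisc (scaledWavenumber ε p))) := by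
  obtain ⟨F, hF, hκ, hiff⟩ := hψ.exists_evansFunction hε (hε'.trans (by norm_num))
  obtain ⟨him, hdom, hs⟩ := hz
  have h0 := (hiff z _ p hdom (scaledWavenumber_spec hε p)).2 hs
  have k2 := hκ _ hdom
  rw [h0, zero_sub, norm_neg] at k2
  have k3 := norm_sub_resonanceRoot_le hG him k2
  have n1 := norm_sq_resonanceRoot hG.le
  rw [leadingEigenvalue_eq _ hG.le]
  refine (norm_resonantValue_sub_resonantValue_le hε hdom.1.le ?_).trans ?_
  · nlinarith [norm_nonneg (resonanceRoot (scaledWavenumber ε p))]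
  · gcongr

/-- The properties of the most unstable eigenvalue. -/
theorem SolitonBounds.exists_most_unstable (hψ : SolitonBounds ε ψ) (hε : 0 < ε)
    (hε' : ε ≤ 1 / 10 ^ 20) :
    ∃ (δs : ℝ) (zs : ℂ), |δs - 1 / 2| ≤ 250 * (10 ^ 11 * ε) ∧
      ‖resonantValue ε δs zs - (3 / 4 * Complex.I
        + (ε : ℂ) * (((2 / √15 : ℝ) : ℂ) + 3 / 2 * Complex.I))‖ ≤ 2 * 10 ^ 14 * ε ^ 2 ∧
      (∀ p : ℝ, p ^ 2 = 1 / 4 + ε * δs → ∀ z, IsResonantParameter ε p ψ z → z = zs) ∧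
      ∀ (p : ℝ) (ν : ℂ), IsStabilityEigenvalue (-1) ε p ψ ν → (resonantValue ε δs zs).re ≤ ν.re →
        p ^ 2 = 1 / 4 + ε * δs ∧
          (ν = resonantValue ε δs zs ∨ ν = conj (resonantValue ε δs zs)) := by
  obtain ⟨F, hF, hκ, hiff⟩ := hψ.exists_evansFunction hε (hε'.trans (by norm_num))
  obtain ⟨δs, zs, h1, h2, h3, h4, h5, h6⟩ := exists_growth_maximum hF hκ (by positivity)
    (by linarith)
  have hδs : ‖(δs : ℂ) - 1 / 2‖ < 1 / 20 := by rw [norm_ofReal_sub_half]; linarith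
  have hzs : (zs, (δs : ℂ)) ∈ evansDomain := mem_evansDomain_of_near (h2.trans (by norm_num)) hδs
  refine ⟨δs, zs, h1, ?_, fun p hp z hz => ?_, ?_⟩
  · have hc0 : ‖centralRoot - centralRoot‖ ≤ 1 / 10 := by rw [sub_self, norm_zero]; norm_num
    have k1 := norm_sub_le_of_resonancePoly h2 hc0 hδs
    have k2 := hκ _ hzs
    rw [h3, zero_sub, norm_neg] at k2
    have e1 : resonancePoly (centralRoot, (δs : ℂ)) = 8 * ((δs : ℂ) - 1 / 2) * centralRoot := by
      unfold resonancePoly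
      simp only
      linear_combination 5 * centralRoot_sq
    obtain ⟨s1, s2⟩ := sqrt_three_fifths_bounds
    have k3 : ‖resonancePoly (centralRoot, (δs : ℂ))‖ ≤ 8 * (250 * (10 ^ 11 * ε)) := by
      rw [e1, norm_mul, norm_mul, norm_centralRoot, norm_ofReal_sub_half, Complex.norm_ofNat]
      have : 8 * |δs - 1 / 2| * √(3 / 5) ≤ 8 * |δs - 1 / 2| * 1 := by gcongr; linarith
      linarith
    have k4 := norm_sub_le (resonancePoly (zs, (δs : ℂ))) (resonancePoly (centralRoot, (δs : ℂ)))
    have k5 := norm_add_inv_sub_add_inv_le (near_centralRoot_bounds h2).1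
      (near_centralRoot_bounds hc0).1
    have cinv : centralRoot⁻¹ = -(5 / 3) * centralRoot := by
      refine inv_eq_of_mul_eq_one_right ?_
      linear_combination -(5 / 3 : ℂ) * centralRoot_sq
    have sq15 : (2 / √15 : ℝ) = 2 / 3 * √(3 / 5) := by
      have q : √(3 / 5 : ℝ) * √15 = 3 := by
        rw [← Real.sqrt_mul (by norm_num)]
        rw [show (3 / 5 * 15 : ℝ) = 3 ^ 2 by norm_num, Real.sqrt_sq (by norm_num)]
      rw [div_eq_iff (by positivity)]
      linear_combination -(2 / 3 : ℝ) * q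
    have e2 : resonantValue ε δs zs - (3 / 4 * Complex.I
        + (ε : ℂ) * (((2 / √15 : ℝ) : ℂ) + 3 / 2 * Complex.I))
        = -(Complex.I * (ε * (((zs + zs⁻¹) - (centralRoot + centralRoot⁻¹))
          + ((δs : ℂ) - 1 / 2)))) := by
      rw [sq15, cinv]
      unfold resonantValue centralRoot
      push_cast
      linear_combination (-(2 / 3 : ℂ) * ε * (√(3 / 5) : ℝ)) * Complex.I_sq
    rw [e2, norm_neg, norm_mul, norm_mul, Complex.norm_I, Complex.norm_of_nonneg hε.le, one_mul]
    have k6 := norm_add_le ((zs + zs⁻¹) - (centralRoot + centralRoot⁻¹)) ((δs : ℂ) - 1 / 2)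
    rw [norm_ofReal_sub_half] at k6
    calc _ ≤ ε * (2 * 10 ^ 14 * ε) := by gcongr; linarith
      _ = _ := by ring
  · obtain ⟨him, hdom, hs⟩ := hz
    rw [scaledWavenumber_eq hε hp] at hdom hs
    exact h5 z hdom ((hiff z δs p hdom hp).2 hs) him
  · have key : ∀ (p : ℝ) (ν : ℂ), IsStabilityEigenvalue (-1) ε p ψ ν →
        (resonantValue ε δs zs).re ≤ ν.re → |p ^ 2 - 1 / 4| ≤ 20 * ε →
        ‖((1 - p ^ 2 : ℝ) : ℂ) + Complex.I * ν‖ ≤ 10 * ε →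
        p ^ 2 = 1 / 4 + ε * δs ∧ ν = resonantValue ε δs zs := by
      intro p ν hs hν hp hloc
      have hp2 := scaledWavenumber_spec hε p
      set δ := scaledWavenumber ε p with hd
      have hδ : |δ| ≤ 20 := by
        rw [show p ^ 2 - 1 / 4 = ε * δ by linarith, abs_mul, abs_of_pos hε, mul_comm] at hp
        exact le_of_mul_le_mul_right hp hε
      have ε0 : (ε : ℂ) ≠ 0 := by exact_mod_cast hε.ne'
      -- This inverts the parametrization, z + z⁻¹ = 2 + (q - ω)/ε. The localization bounds the
      -- right-hand side by 12, hence |z⁻¹| ≤ 13.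
      obtain ⟨z, z0, z1, hz⟩ := exists_add_inv_eq
        (2 + (((1 - p ^ 2 : ℝ) : ℂ) + Complex.I * ν) / ε)
      have hp2' : (p : ℂ) ^ 2 = 1 / 4 + ε * δ := by
        have := congrArg Complex.ofReal hp2
        push_cast at this
        exact this
      have hνz : ν = resonantValue ε δ z := by
        have : resonantValue ε δ z = Complex.I * (3 / 4 + ε * (2 - (z + z⁻¹) - δ)) := by
          unfold resonantValue; ring
        rw [this, hz]
        push_cast
        rw [hp2']
        field_simp
        linear_combination (4 * ν) * Complex.I_sq
      have hgr : (zs + zs⁻¹).im ≤ (z + z⁻¹).im := by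
        rw [hνz, resonantValue_re, resonantValue_re] at hν
        exact le_of_mul_le_mul_left hν hε
      have hzl : 1 / 13 ≤ ‖z‖ := by
        have k1 : ‖z⁻¹‖ ≤ 13 := by
          have e : z⁻¹ = 2 + (((1 - p ^ 2 : ℝ) : ℂ) + Complex.I * ν) / ε - z := by
            rw [← hz]; ring
          have k2 : ‖(((1 - p ^ 2 : ℝ) : ℂ) + Complex.I * ν) / ε‖ ≤ 10 := by
            rw [norm_div, Complex.norm_of_nonneg hε.le, div_le_iff₀ hε]
            exact hloc
          rw [e]
          have k3 := norm_sub_le (2 + (((1 - p ^ 2 : ℝ) : ℂ) + Complex.I * ν) / ε) z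
          have k4 := norm_add_le 2 ((((1 - p ^ 2 : ℝ) : ℂ) + Complex.I * ν) / ε)
          rw [Complex.norm_ofNat] at k4
          linarith
        rw [norm_inv, inv_le_comm₀ (norm_pos_iff.2 z0) (by norm_num)] at k1
        linarith
      have hg := h4.trans hgr
      rw [im_add_inv] at hg
      have hv1 : 1 ≤ (‖z‖ ^ 2)⁻¹ :=
        (one_le_inv₀ (by positivity)).2 (pow_le_one₀ (norm_nonneg z) z1)
      have him : z.im < 0 := by
        by_contra! h
        have := mul_nonneg h (sub_nonneg.2 hv1)
        linarith
      -- Close to the unit circle the scaled growth rate is at most 1/10, below the required 0.516.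
      have hzu : ‖z‖ < 99 / 100 := by
        by_contra! h
        have a1 : -z.im ≤ 1 := (neg_le_abs _).trans ((Complex.abs_im_le_norm z).trans z1)
        have a2 : (‖z‖ ^ 2)⁻¹ ≤ 11 / 10 := by
          rw [inv_le_comm₀ (by positivity) (by norm_num)]
          nlinarith
        have a3 : -z.im * ((‖z‖ ^ 2)⁻¹ - 1) ≤ 1 * (1 / 10) :=
          mul_le_mul a1 (by linarith) (by linarith) (by norm_num)
        linarith
      have hdom : (z, (δ : ℂ)) ∈ evansDomain := by
        refine ⟨by dsimp only; linarith, hzu, ?_⟩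
        dsimp only
        rw [Complex.norm_real, Real.norm_eq_abs]
        linarith
      have hF0 : F (z, δ) = 0 := (hiff z δ p hdom hp2).2 (by
        change IsStabilityEigenvalue (-1) ε p ψ (resonantValue ε δ z)
        rwa [← hνz])
      obtain ⟨c1, c2⟩ := h6 z δ hdom hF0 him hgr
      rw [c2] at hp2 hνz
      rw [c1] at hνz
      exact ⟨hp2, hνz⟩
    intro p ν hs hν
    -- The best rate is at least 0.51639ε, so every competitor passes the threshold of the
    -- localization.
    have hν2 : ε / 2 ≤ ν.re := by
      refine le_trans ?_ hν
      rw [resonantValue_re]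
      have := mul_le_mul_of_nonneg_left h4 hε.le
      linarith
    obtain ⟨l1, l2 | l2⟩ := hψ.eigenvalue_localization hε (hε'.trans (by norm_num)) hs hν2
    · obtain ⟨a, b⟩ := key p ν hs hν l1 l2
      exact ⟨a, Or.inl b⟩
    · obtain ⟨a, b⟩ := key p (conj ν) hs.conj (by rwa [Complex.conj_re]) l1 (by
        have e : ((1 - p ^ 2 : ℝ) : ℂ) + Complex.I * conj ν
            = conj (((1 - p ^ 2 : ℝ) : ℂ) - Complex.I * ν) := by
          rw [map_sub, map_mul, Complex.conj_ofReal, Complex.conj_I]; ring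
        rw [e, Complex.norm_conj]
        exact l2)
      exact ⟨a, Or.inr (by rw [← b, Complex.conj_conj])⟩

end FixedCoupling

/-! ### The interval of unstable wavenumbers. -/

/-- Lower end point of the interval of unstable wavenumbers. -/
noncomputable def lowerEdge (ε : ℝ) : ℝ := 1 / 2 + ε / 2 * (1 - √15 / 2) + 10 ^ 12 * ε ^ 2

/-- Upper end point of the interval of unstable wavenumbers. -/
noncomputable def upperEdge (ε : ℝ) : ℝ := 1 / 2 + ε / 2 * (1 + √15 / 2) - 10 ^ 12 * ε ^ 2

/-- The discriminant is four times the difference of the squares of √15/2 and |2δ - 1|, and the sum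
of these numbers is at least 7/4. -/
theorem resonanceDisc_ge {δ c : ℝ} (hc : 0 ≤ c) (h : |2 * δ - 1| ≤ √15 / 2 - c) :
    7 * c ≤ resonanceDisc δ := by
  obtain ⟨s1, s2⟩ := sqrt_fifteen_bounds
  have q : (√15 / 2) ^ 2 = (15 / 4 : ℝ) := by rw [div_pow, Real.sq_sqrt (by norm_num)]; norm_num
  have e : resonanceDisc δ = 4 * ((√15 / 2 - |2 * δ - 1|) * (√15 / 2 + |2 * δ - 1|)) := by
    have : |2 * δ - 1| ^ 2 = (2 * δ - 1) ^ 2 := sq_abs _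
    unfold resonanceDisc
    linear_combination 4 * this - 4 * q
  have := mul_le_mul (show c ≤ √15 / 2 - |2 * δ - 1| by linarith)
    (show 7 / 4 ≤ √15 / 2 + |2 * δ - 1| by linarith [abs_nonneg (2 * δ - 1)]) (by norm_num)
    (by linarith)
  linarith

/-- With t = |p| - 1/2 one has εδ = t + t². The corrections 10¹²ε² in the edges absorb t² and leave
a margin that makes the discriminant at least 7·10¹²ε. -/
theorem scaledWavenumber_of_mem_edges {ε p : ℝ} (hε : 0 < ε) (hε' : ε ≤ 1 / 10 ^ 20)
    (h1 : lowerEdge ε < |p|) (h2 : |p| < upperEdge ε) :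
    |2 * scaledWavenumber ε p - 1| ≤ √15 / 2 - 10 ^ 12 * ε := by
  obtain ⟨s1, s2⟩ := sqrt_fifteen_bounds
  have hp := scaledWavenumber_spec hε p
  set δ := scaledWavenumber ε p
  unfold lowerEdge at h1
  unfold upperEdge at h2
  obtain ⟨t, ht⟩ : ∃ t, t = |p| - 1 / 2 := ⟨_, rfl⟩
  have hδ : ε * δ = t + t ^ 2 := by
    rw [← sq_abs] at hp
    rw [ht]
    linear_combination -hp
  have sq0 : 0 ≤ ε ^ 2 := sq_nonneg ε
  have εs : ε / 2 * (√15 / 2) ≤ ε := by nlinarith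
  have hta : |t| ≤ 3 / 2 * ε := by
    rw [abs_le]; constructor <;> linarith
  have ht2 : t ^ 2 ≤ 9 / 4 * ε ^ 2 := by
    rw [← sq_abs]
    have := pow_le_pow_left₀ (abs_nonneg t) hta 2
    linarith
  rw [abs_le]
  constructor
  · refine le_of_mul_le_mul_left ?_ hε
    nlinarith [sq_nonneg t]
  · refine le_of_mul_le_mul_left ?_ hε
    nlinarith [sq_nonneg t]

theorem abs_half_wavenumber_le {ε p δ : ℝ} (hε : 0 < ε) (hp : p ^ 2 = 1 / 4 + ε * δ)
    (hδ : |δ| ≤ 3 / 2) : |(|p| - 1 / 2)| ≤ 3 * ε := by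
  have h : (|p| - 1 / 2) * (|p| + 1 / 2) = ε * δ := by
    rw [← sq_abs] at hp
    linear_combination hp
  have h1 : |(|p| - 1 / 2)| * (|p| + 1 / 2) = ε * |δ| := by
    have h0 : |ε * δ| = ε * |δ| := by rw [abs_mul, abs_of_pos hε]
    rw [← h0, ← h, abs_mul, abs_of_pos (show 0 < |p| + 1 / 2 by positivity)]
  have h2 := mul_le_mul_of_nonneg_left hδ hε.le
  have h3 := mul_le_mul_of_nonneg_left (show 1 / 2 ≤ |p| + 1 / 2 by linarith [abs_nonneg p])
    (abs_nonneg (|p| - 1 / 2))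
  linarith

theorem mem_edges_of_scaledWavenumber {ε p δ c : ℝ} (hε : 0 < ε) (hc : 10 ^ 13 * ε ≤ c)
    (hp : p ^ 2 = 1 / 4 + ε * δ) (h : |2 * δ - 1| ≤ √15 / 2 - c) :
    lowerEdge ε < |p| ∧ |p| < upperEdge ε := by
  obtain ⟨s1, s2⟩ := sqrt_fifteen_bounds
  have hc0 : 0 ≤ c := le_trans (by positivity) hc
  obtain ⟨u1, u2⟩ := abs_le.1 h
  have hδ : |δ| ≤ 3 / 2 := by rw [abs_le]; constructor <;> linarith
  have hta := abs_half_wavenumber_le hε hp hδ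
  obtain ⟨t, ht⟩ : ∃ t, t = |p| - 1 / 2 := ⟨_, rfl⟩
  have hδt : ε * δ = t + t ^ 2 := by
    rw [← sq_abs] at hp
    rw [ht]
    linear_combination -hp
  rw [← ht] at hta
  have ht2 : t ^ 2 ≤ 9 * ε ^ 2 := by
    rw [← sq_abs]
    have := pow_le_pow_left₀ (abs_nonneg t) hta 2
    linarith
  have e : |p| = 1 / 2 + t := by linarith
  have sq0 : 0 < ε ^ 2 := by positivity
  have hcε := mul_le_mul_of_nonneg_left hc hε.le
  have v1 := mul_le_mul_of_nonneg_left u1 hε.le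
  have v2 := mul_le_mul_of_nonneg_left u2 hε.le
  unfold lowerEdge upperEdge
  rw [e]
  constructor <;> nlinarith [sq_nonneg t]

theorem lowerEdge_pos {ε : ℝ} (hε : 0 < ε) (hε' : ε ≤ 1 / 10 ^ 20) :
    0 < lowerEdge ε ∧ lowerEdge ε < upperEdge ε := by
  obtain ⟨s1, s2⟩ := sqrt_fifteen_bounds
  unfold lowerEdge upperEdge
  constructor <;> nlinarith

theorem isBigO_edges :
    ((fun ε => lowerEdge ε - (1 / 2 + ε / 2 * (1 - √15 / 2))) =O[𝓝[>] (0 : ℝ)] fun ε => ε ^ 2) ∧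
    ((fun ε => upperEdge ε - (1 / 2 + ε / 2 * (1 + √15 / 2))) =O[𝓝[>] (0 : ℝ)] fun ε => ε ^ 2) := by
  constructor <;> refine IsBigO.of_bound (10 ^ 12) (Eventually.of_forall fun ε => le_of_eq ?_)
  · rw [show lowerEdge ε - (1 / 2 + ε / 2 * (1 - √15 / 2)) = 10 ^ 12 * ε ^ 2 by
      unfold lowerEdge; ring, norm_mul]
    norm_num
  · rw [show upperEdge ε - (1 / 2 + ε / 2 * (1 + √15 / 2)) = -(10 ^ 12 * ε ^ 2) by
      unfold upperEdge; ring, norm_neg, norm_mul]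
    norm_num

section FixedCoupling

variable {ε p : ℝ} {ψ : ℤ → ℝ}

theorem SolitonBounds.isResonantParameter_epsilon (hψ : SolitonBounds ε ψ) (hε : 0 < ε)
    (hε' : ε ≤ 1 / 10 ^ 20) (h1 : lowerEdge ε < |p|) (h2 : |p| < upperEdge ε) :
    IsResonantParameter ε p ψ (Classical.epsilon (IsResonantParameter ε p ψ)) := by
  obtain ⟨s1, s2⟩ := sqrt_fifteen_bounds
  have h := scaledWavenumber_of_mem_edges hε hε' h1 h2
  have hd := resonanceDisc_ge (by positivity) h
  refine Classical.epsilon_spec (hψ.exists_isResonantParameter hε hε' ?_ (by linarith))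
  rw [abs_le] at h
  rw [abs_lt]
  have : (0 : ℝ) ≤ 10 ^ 12 * ε := by positivity
  constructor <;> linarith

theorem SolitonBounds.unstable_quartet (hψ : SolitonBounds ε ψ) (hε : 0 < ε)
    (hε' : ε ≤ 1 / 10 ^ 20) (h1 : lowerEdge ε < |p|) (h2 : |p| < upperEdge ε) :
    0 < (unstableEigenvalue ε p ψ).re ∧ 0 < (unstableEigenvalue ε p ψ).im ∧
      IsStabilityEigenvalue (-1) ε p ψ (unstableEigenvalue ε p ψ) ∧
      IsStabilityEigenvalue (-1) ε p ψ (-unstableEigenvalue ε p ψ) ∧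
      IsStabilityEigenvalue (-1) ε p ψ (conj (unstableEigenvalue ε p ψ)) ∧
      IsStabilityEigenvalue (-1) ε p ψ (-conj (unstableEigenvalue ε p ψ)) ∧
      ‖unstableEigenvalue ε p ψ - 3 / 4 * Complex.I‖ ≤ 203 * ε := by
  obtain ⟨him, hdom, hs⟩ := hψ.isResonantParameter_epsilon hε hε' h1 h2
  have hn := norm_resonantValue_sub_le hε hdom
  refine ⟨resonantValue_re_pos hε hdom him, ?_, hs, hs.neg, hs.conj, hs.conj.neg, hn⟩
  have := (abs_le.1 ((Complex.abs_im_le_norm _).trans hn)).1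
  rw [Complex.sub_im] at this
  have e : (3 / 4 * Complex.I).im = 3 / 4 := by simp
  rw [e] at this
  unfold unstableEigenvalue
  linarith

theorem SolitonBounds.norm_unstableEigenvalue_sub_le (hψ : SolitonBounds ε ψ) (hε : 0 < ε)
    (hε' : ε ≤ 1 / 10 ^ 20) {δ c : ℝ} (hc0 : 0 < c) (hc : 10 ^ 13 * ε ≤ c)
    (hp : p ^ 2 = 1 / 4 + ε * δ) (h : |2 * δ - 1| ≤ √15 / 2 - c) :
    ‖unstableEigenvalue ε p ψ - leadingEigenvalue ε δ‖ ≤ 201 * 10 ^ 11 / √(7 * c) * ε ^ 2 := by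
  obtain ⟨h1, h2⟩ := mem_edges_of_scaledWavenumber hε hc hp h
  have hz := hψ.isResonantParameter_epsilon hε hε' h1 h2
  have e := scaledWavenumber_eq hε hp
  have hd := resonanceDisc_ge hc0.le h
  have := hz.norm_sub_leadingEigenvalue_le hψ hε hε' (by rw [e]; linarith)
  unfold unstableEigenvalue
  rw [e] at this ⊢
  refine this.trans ?_
  have h7 : 0 < √(7 * c) := Real.sqrt_pos.2 (by linarith)
  calc _ ≤ 201 * ε * (10 ^ 11 * ε / √(7 * c)) := by gcongr
    _ = _ := by ring

/-- The eigenvalue is defined through a choice of z, but at the optimal δ the lower zero is unique,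
so the chosen value is the maximal one. -/
theorem SolitonBounds.exists_maximal_wavenumber (hψ : SolitonBounds ε ψ) (hε : 0 < ε)
    (hε' : ε ≤ 1 / 10 ^ 20) :
    ∃ pm : ℝ, lowerEdge ε < pm ∧ pm < upperEdge ε ∧
      (∀ (p : ℝ) (ν : ℂ), IsStabilityEigenvalue (-1) ε p ψ ν →
        ν.re ≤ (unstableEigenvalue ε pm ψ).re ∧
        (ν.re = (unstableEigenvalue ε pm ψ).re →
          |p| = pm ∧ (ν = unstableEigenvalue ε pm ψ ∨ ν = conj (unstableEigenvalue ε pm ψ)))) ∧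
      ‖unstableEigenvalue ε pm ψ - (3 / 4 * Complex.I
        + (ε : ℂ) * (((2 / √15 : ℝ) : ℂ) + 3 / 2 * Complex.I))‖ ≤ 2 * 10 ^ 14 * ε ^ 2 ∧
      |pm - (1 / 2 + ε / 2)| ≤ 10 ^ 14 * ε ^ 2 := by
  obtain ⟨s1, s2⟩ := sqrt_fifteen_bounds
  obtain ⟨δs, zs, h1, h2, h3, h4⟩ := hψ.exists_most_unstable hε hε'
  obtain ⟨a1, a2⟩ := abs_le.1 h1
  have hδ : |δs| ≤ 3 / 2 := by rw [abs_le]; constructor <;> linarith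
  have hpos : 0 ≤ 1 / 4 + ε * δs := by nlinarith [abs_le.1 hδ]
  have hpm : √(1 / 4 + ε * δs) ^ 2 = 1 / 4 + ε * δs := Real.sq_sqrt hpos
  have hpm0 : |√(1 / 4 + ε * δs)| = √(1 / 4 + ε * δs) := abs_of_nonneg (Real.sqrt_nonneg _)
  set pm := √(1 / 4 + ε * δs)
  obtain ⟨e1, e2⟩ := mem_edges_of_scaledWavenumber (c := 1) hε (by linarith) hpm (by
    rw [abs_le]; constructor <;> linarith)
  have hz := h3 pm hpm _ (hψ.isResonantParameter_epsilon hε hε' e1 e2)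
  have hlam : unstableEigenvalue ε pm ψ = resonantValue ε δs zs := by
    unfold unstableEigenvalue
    rw [hz, scaledWavenumber_eq hε hpm]
  have ht := abs_half_wavenumber_le hε hpm hδ
  rw [hpm0] at e1 e2 ht
  have heq : ∀ (p : ℝ) (ν : ℂ), IsStabilityEigenvalue (-1) ε p ψ ν →
      (resonantValue ε δs zs).re ≤ ν.re →
        |p| = pm ∧ (ν = resonantValue ε δs zs ∨ ν = conj (resonantValue ε δs zs)) := by
    intro p ν hs hle
    obtain ⟨b1, b2⟩ := h4 p ν hs hle
    refine ⟨?_, b2⟩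
    rw [← hpm0]
    exact sq_eq_sq_iff_abs_eq_abs _ _ |>.1 (b1.trans hpm.symm)
  refine ⟨pm, e1, e2, ?_⟩
  rw [hlam]
  refine ⟨fun p ν hs => ⟨?_, fun h => heq p ν hs h.ge⟩, h2, ?_⟩
  · rcases le_total ν.re (resonantValue ε δs zs).re with h | h
    · exact h
    · rcases (heq p ν hs h).2 with h' | h' <;> rw [h']
      rw [Complex.conj_re]
  · have ht2 : (pm - 1 / 2) ^ 2 ≤ 9 * ε ^ 2 := by
      rw [← sq_abs]
      have := pow_le_pow_left₀ (abs_nonneg (pm - 1 / 2)) ht 2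
      linarith
    -- Both terms on the right are O(ε²), since δs - 1/2 and pm - 1/2 are O(ε).
    have e : pm - (1 / 2 + ε / 2) = ε * (δs - 1 / 2) - (pm - 1 / 2) ^ 2 := by
      linear_combination hpm
    have c1 := mul_le_mul_of_nonneg_left a1 hε.le
    have c2 := mul_le_mul_of_nonneg_left a2 hε.le
    rw [e, abs_le]
    constructor <;> nlinarith [sq_nonneg (pm - 1 / 2), sq_nonneg ε]

end FixedCoupling

/-! ### Assembly of the theorem. -/

theorem theorem4 (ψ : ℝ → lp (fun _ : ℤ => ℝ) 2) (hψ : IsFundamentalLineSoliton ψ) :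
    -- at `ε = 0`: an eigenvalue of negative Krein signature and one of infinite multiplicity
    -- and positive energy, which resonate exactly at `|p| = 1/2`, `lam = 3i/4`
    (∀ p : ℝ, 0 < |p| → |p| < 1 →
      (|p| ≠ 1 / 2 →
        Module.finrank ℂ (stabilityEigenspace (-1) 0 p singleSite
          (Complex.I * ((|p| * Real.sqrt (2 + p ^ 2) : ℝ) : ℂ))) = 1 ∧
        (∀ x ∈ stabilityEigenspace (-1) 0 p singleSite
          (Complex.I * ((|p| * Real.sqrt (2 + p ^ 2) : ℝ) : ℂ)),
          x ≠ 0 → kreinEnergy (-1) 0 p singleSite x.1 < 0) ∧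
        ¬ FiniteDimensional ℂ (stabilityEigenspace (-1) 0 p singleSite
          (Complex.I * ((1 - p ^ 2 : ℝ) : ℂ))) ∧
        (∀ x ∈ stabilityEigenspace (-1) 0 p singleSite (Complex.I * ((1 - p ^ 2 : ℝ) : ℂ)),
          x ≠ 0 → 0 < kreinEnergy (-1) 0 p singleSite x.1)) ∧
      (|p| * Real.sqrt (2 + p ^ 2) = 1 - p ^ 2 ↔ |p| = 1 / 2)) ∧
    -- for small `ε > 0`
    ∃ ε₀ : ℝ, 0 < ε₀ ∧ ∃ (pcm pcp pmax : ℝ → ℝ) (lam : ℝ → ℝ → ℂ),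
      -- the quartet of complex eigenvalues
      (∀ ε : ℝ, 0 < ε → ε < ε₀ →
        0 < pcm ε ∧ pcm ε < pcp ε ∧
        ∀ p : ℝ, pcm ε < |p| → |p| < pcp ε →
          0 < (lam ε p).re ∧ 0 < (lam ε p).im ∧
          IsStabilityEigenvalue (-1) ε p (ψ ε) (lam ε p) ∧
          IsStabilityEigenvalue (-1) ε p (ψ ε) (-lam ε p) ∧
          IsStabilityEigenvalue (-1) ε p (ψ ε) (conj (lam ε p)) ∧
          IsStabilityEigenvalue (-1) ε p (ψ ε) (-conj (lam ε p))) ∧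
      -- it emanates from the resonance point, uniformly on the whole interval
      (∃ C : ℝ, ∀ ε : ℝ, 0 < ε → ε < ε₀ → ∀ p : ℝ, pcm ε < |p| → |p| < pcp ε →
        ‖lam ε p - 3 / 4 * Complex.I‖ ≤ C * ε) ∧
      -- end points of the interval of unstable wavenumbers
      ((fun ε => pcm ε - (1 / 2 + ε / 2 * (1 - Real.sqrt 15 / 2)))
        =O[𝓝[>] (0 : ℝ)] fun ε => ε ^ 2) ∧
      ((fun ε => pcp ε - (1 / 2 + ε / 2 * (1 + Real.sqrt 15 / 2)))
        =O[𝓝[>] (0 : ℝ)] fun ε => ε ^ 2) ∧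
      -- the eigenvalue, locally uniformly in the scaled wavenumber `δ = (p² - 1/4) / ε`
      (∀ K : Set ℝ, IsCompact K → (∀ δ ∈ K, 4 * (1 - 2 * δ) ^ 2 < 15) →
        ∃ C : ℝ, ∀ᶠ ε in 𝓝[>] (0 : ℝ), ∀ δ ∈ K, ∀ p : ℝ, p ^ 2 = 1 / 4 + ε * δ →
          pcm ε < |p| ∧ |p| < pcp ε ∧ ‖lam ε p - leadingEigenvalue ε δ‖ ≤ C * ε ^ 2) ∧
      -- the most unstable eigenvalue among all eigenvalues at all transverse wavenumbers
      (∀ ε : ℝ, 0 < ε → ε < ε₀ →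
        pcm ε < pmax ε ∧ pmax ε < pcp ε ∧ lam ε (-pmax ε) = lam ε (pmax ε) ∧
        ∀ (p : ℝ) (ν : ℂ), IsStabilityEigenvalue (-1) ε p (ψ ε) ν →
          ν.re ≤ (lam ε (pmax ε)).re ∧
          (ν.re = (lam ε (pmax ε)).re →
            |p| = pmax ε ∧ (ν = lam ε (pmax ε) ∨ ν = conj (lam ε (pmax ε))))) ∧
      ((fun ε => lam ε (pmax ε)
          - (3 / 4 * Complex.I + (ε : ℂ) * (((2 / Real.sqrt 15 : ℝ) : ℂ) + 3 / 2 * Complex.I)))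
        =O[𝓝[>] (0 : ℝ)] fun ε => ε ^ 2) ∧
      ((fun ε => pmax ε - (1 / 2 + ε / 2)) =O[𝓝[>] (0 : ℝ)] fun ε => ε ^ 2) := by
  refine ⟨antiContinuum_spectrum, ?_⟩
  obtain ⟨η, hη0, hη⟩ := mem_nhdsGT_iff_exists_Ioo_subset.1 hψ.eventually_solitonBounds
  have hη0 : 0 < η := hη0
  have hmem : ∀ {ε : ℝ}, 0 < ε → ε < min η (1 / 10 ^ 20) →
      SolitonBounds ε (ψ ε) ∧ ε ≤ 1 / 10 ^ 20 := fun h0 h1 =>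
    ⟨hη ⟨h0, h1.trans_le (min_le_left _ _)⟩, (h1.trans_le (min_le_right _ _)).le⟩
  have hε₀ : 0 < min η (1 / 10 ^ 20) := lt_min hη0 (by norm_num)
  have hev : ∀ᶠ ε in 𝓝[>] (0 : ℝ), 0 < ε ∧ ε < min η (1 / 10 ^ 20) := by
    filter_upwards [Ioo_mem_nhdsGT hε₀] with ε hε using hε
  have hmax : ∀ ε : ℝ, ∃ pm : ℝ, 0 < ε → ε < min η (1 / 10 ^ 20) →
      lowerEdge ε < pm ∧ pm < upperEdge ε ∧
      (∀ (p : ℝ) (ν : ℂ), IsStabilityEigenvalue (-1) ε p (ψ ε) ν →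
        ν.re ≤ (unstableEigenvalue ε pm (ψ ε)).re ∧
        (ν.re = (unstableEigenvalue ε pm (ψ ε)).re →
          |p| = pm ∧ (ν = unstableEigenvalue ε pm (ψ ε) ∨
            ν = conj (unstableEigenvalue ε pm (ψ ε))))) ∧
      ‖unstableEigenvalue ε pm (ψ ε) - (3 / 4 * Complex.I
        + (ε : ℂ) * (((2 / √15 : ℝ) : ℂ) + 3 / 2 * Complex.I))‖ ≤ 2 * 10 ^ 14 * ε ^ 2 ∧
      |pm - (1 / 2 + ε / 2)| ≤ 10 ^ 14 * ε ^ 2 := by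
    intro ε
    by_cases h : 0 < ε ∧ ε < min η (1 / 10 ^ 20)
    · obtain ⟨hs, hε'⟩ := hmem h.1 h.2
      obtain ⟨pm, hpm⟩ := hs.exists_maximal_wavenumber h.1 hε'
      exact ⟨pm, fun _ _ => hpm⟩
    -- A default value, for couplings outside the admissible range.
    · exact ⟨0, fun h1 h2 => absurd ⟨h1, h2⟩ h⟩
  choose pmax hpmax using hmax
  refine ⟨min η (1 / 10 ^ 20), hε₀, lowerEdge, upperEdge, pmax,
    fun ε p => unstableEigenvalue ε p (ψ ε), fun ε h0 h1 => ?_, ⟨203, fun ε h0 h1 p hp1 hp2 => ?_⟩,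
    isBigO_edges.1, isBigO_edges.2, fun K hK hK' => ?_, fun ε h0 h1 => ?_, ?_, ?_⟩
  · obtain ⟨hs, hε'⟩ := hmem h0 h1
    refine ⟨(lowerEdge_pos h0 hε').1, (lowerEdge_pos h0 hε').2, fun p hp1 hp2 => ?_⟩
    obtain ⟨a, b, c, d, e, f, -⟩ := hs.unstable_quartet h0 hε' hp1 hp2
    exact ⟨a, b, c, d, e, f⟩
  · obtain ⟨hs, hε'⟩ := hmem h0 h1
    obtain ⟨-, -, -, -, -, -, h⟩ := hs.unstable_quartet h0 hε' hp1 hp2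
    exact h
  -- Compactness turns the strict inequality into a uniform margin c, through which alone the
  -- constant depends on K.
  · obtain ⟨c, hc0, hc⟩ : ∃ c : ℝ, 0 < c ∧ ∀ δ ∈ K, |2 * δ - 1| ≤ √15 / 2 - c := by
      have hpos : ∀ δ ∈ K, 0 < √15 / 2 - |2 * δ - 1| := fun δ hδ => by
        have h1 := hK' δ hδ
        have h2 : |2 * (2 * δ - 1)| < √15 := Real.lt_sqrt_of_sq_lt (by rw [sq_abs]; linarith)
        rw [abs_mul, abs_two] at h2
        linarith
      rcases K.eq_empty_or_nonempty with rfl | hne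
      · exact ⟨1, one_pos, fun δ hδ => absurd hδ (Set.notMem_empty δ)⟩
      · obtain ⟨d, hd, hmin⟩ := hK.exists_isMinOn hne
          (f := fun δ : ℝ => √15 / 2 - |2 * δ - 1|) (by fun_prop)
        refine ⟨_, hpos d hd, fun δ hδ => ?_⟩
        have : √15 / 2 - |2 * d - 1| ≤ √15 / 2 - |2 * δ - 1| := hmin hδ
        linarith
    refine ⟨201 * 10 ^ 11 / √(7 * c), ?_⟩
    filter_upwards [hev, Ioo_mem_nhdsGT (show 0 < c / 10 ^ 13 by positivity)] with ε hε hε2 δ hδ p hp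
    obtain ⟨hs, hε'⟩ := hmem hε.1 hε.2
    have hcε : 10 ^ 13 * ε ≤ c := by
      have := (lt_div_iff₀ (by norm_num : (0 : ℝ) < 10 ^ 13)).1 hε2.2
      linarith
    obtain ⟨e1, e2⟩ := mem_edges_of_scaledWavenumber hε.1 hcε hp (hc δ hδ)
    exact ⟨e1, e2, hs.norm_unstableEigenvalue_sub_le hε.1 hε' hc0 hcε hp (hc δ hδ)⟩
  · obtain ⟨a, b, c, -⟩ := hpmax ε h0 h1
    exact ⟨a, b, unstableEigenvalue_neg _ _ _, c⟩
  · refine IsBigO.of_bound (2 * 10 ^ 14) ?_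
    filter_upwards [hev] with ε hε
    obtain ⟨-, -, -, d, -⟩ := hpmax ε hε.1 hε.2
    rwa [Real.norm_of_nonneg (sq_nonneg ε)]
  · refine IsBigO.of_bound (10 ^ 14) ?_
    filter_upwards [hev] with ε hε
    obtain ⟨-, -, -, -, e⟩ := hpmax ε hε.1 hε.2
    rwa [Real.norm_of_nonneg (sq_nonneg ε), Real.norm_eq_abs]
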